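/- Let $\mathbb{DH}=\mathbb H\otimes_{\mathbb R}\mathbb R[\epsilon]/(\epsilon^2)$ be the algebra of real dual quaternions, $\mathbb{DH}_{\mathbb C}$ its complexification, and $q\mapsto\overline q$ the ($\mathbb C[\epsilon]$-linear) quaternion conjugation. Let $h_1,\dots,h_6\in\mathbb{DH}$ be a closed 6R linkage, i.e. $h_k^2=-1$ and $h_k\neq\pm h_{k+1}$ for all $k$ (indices modulo $6$). Its configuration set $K\subset(\mathbb P^1_{\mathbb R})^6$ is the set of all $(t_1,\dots,t_6)$ with $(t_1-h_1)\cdots(t_6-h_6)\in\mathbb R^*$, where the factor is $1$ if $t_k=\infty$; assume that $\dim K=1$ (mobility one). Let $K_{\mathbb C}$ be the Zariski closure of $K$ in $(\mathbb P^1_{\mathbb C})^6$ and $N(K)$ its normalization. A *bond* is a point $\beta\in N(K)$ lying over a point $(t_1,\dots,t_6)\in K_{\mathbb C}$ with all $t_k$ finite and $(t_1-h_1)\cdots(t_6-h_6)=0$. It *connects* $h_1$ and $h_4$ if $t_1,t_4\in\{\mathrm i,-\mathrm i\}$ and $t_k\ne\pm\mathrm i$ for $k=2,3,5,6$; its *multiplicity*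 is then the connection number $k_\beta(1,4)=v_\beta(1,3)+v_\beta(0,4)-v_\beta(1,4)-v_\beta(0,3)$, where $v_\beta(i,j)$ is the vanishing order at $\beta$ of $F_{i,j}=(t_{i+1}-h_{i+1})\cdots(t_j-h_j)$, as a function on $N(K)$ with values in $\mathbb{DH}_{\mathbb C}$. Assume $l_{1,2,3}=l_{6,5,4}=8$, where $l_{a,b,c}$ is the dimension of the real span of $1,h_a,h_b,h_c,h_ah_b,h_ah_c,h_bh_c,h_ah_bh_c$. For lines $a,b,c,d$ and $g\in\mathbb{DH}_{\mathbb C}$ let $Q^{g}_{a,b,c,d}\in\mathbb C[x]$ be the monic generator of the elimination ideal $I\cap\mathbb C[x]$, where $I\subset\mathbb C[x,y,t_2,t_3]$ is generated by the coordinates of $(\mathrm i-a)(t_2-b)(t_3-c)(\mathrm i-d)$ and of $(\mathrm i-a)(t_2-b)(t_3-c)-y(1+x\epsilon)g$. If $a,d$ are not parallel, put $Q_{a,b,c,d}:=Q^{g}_{a,b,c,d}$ with $g=(\mathrm i-a)(\mathrm i+d)$; this $g$ generates the $\mathbb C[\epsilon]$-module $G_{a,d}:=(\mathrm i-a)\mathbb{DH}_{\mathbb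 C}\cap\{q\mid q(\mathrm i-d)=0\}$. 1. Suppose that $h_1$ and $h_4$ are not parallel. Then the number of bonds connecting $h_1$ and $h_4$ with $t_1=t_4=+\mathrm i$ is finite and, counted with multiplicity, at most the degree of $\gcd(Q_{h_1,h_2,h_3,h_4},Q_{h_4,h_5,h_6,h_1})$. The number of bonds connecting $h_1$ and $h_4$ with $t_1=+\mathrm i$, $t_4=-\mathrm i$ is finite and, counted with multiplicity, at most the degree of $\gcd(Q_{h_1,h_2,h_3,-h_4},Q_{-h_4,h_5,h_6,h_1})$. 2. In general ($h_1$, $h_4$ parallel or not), the first bound holds with $\gcd(Q^{g}_{h_1,h_2,h_3,h_4},Q^{\overline g}_{h_4,h_5,h_6,h_1})$ for every generator $g$ of the $\mathbb C[\epsilon]$-module $G_{h_1,h_4}$, and the second one with $\gcd(Q^{g}_{h_1,h_2,h_3,-h_4},Q^{\overline g}_{-h_4,h_5,h_6,h_1})$ for every generator $g$ of $G_{h_1,-h_4}$. -/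

import Mathlib

open scoped Quaternion DualNumber

noncomputable section

namespace BondTheory

/-! ### Dual quaternions -/

/-- Quaternions over a commutative ring. -/
abbrev Quat (S : Type*) [CommRing S] : Type _ := ℍ[S]

/-- Dual quaternions with coefficients in `R`: `DH ℝ` is the real algebra of dual quaternions and
`DH ℂ` its complexification. Quaternion conjugation is `star`; it is `R[ε]`-linear. -/
abbrev DH (R : Type*) [CommRing R] : Type _ := Quat R[ε]

/-- Extension of scalars for dual numbers. -/
def mapDual {R S : Type*} [CommRing R] [CommRing S] (f : R →+* S) (d : R[ε]) : S[ε] :=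
  TrivSqZeroExt.inl (f d.fst) + TrivSqZeroExt.inr (f d.snd)

/-- Extension of scalars for dual quaternions. -/
def mapDH {R S : Type*} [CommRing R] [CommRing S] (f : R →+* S) (q : DH R) : DH S :=
  ⟨mapDual f q.re, mapDual f q.imI, mapDual f q.imJ, mapDual f q.imK⟩

/-- The eight coordinates of a dual quaternion. -/
def coords {R : Type*} [CommRing R] (q : DH R) : Set R :=
  {q.re.fst, q.imI.fst, q.imJ.fst, q.imK.fst, q.re.snd, q.imI.snd, q.imJ.snd, q.imK.snd}

/-- The primal part of a dual quaternion; for a line `h` it is its unit direction vector. -/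
def primal {R : Type*} [CommRing R] (q : DH R) : Quat R :=
  ⟨q.re.fst, q.imI.fst, q.imJ.fst, q.imK.fst⟩

/-- Two oriented lines are parallel: their directions agree up to sign. -/
def Parallel (h h' : DH ℝ) : Prop :=
  primal h = primal h' ∨ primal h = -primal h'

/-! ### Closed linkages, coupling dimensions, configuration sets -/

/-- A closed `n`R linkage, given by its rotation axes `h 0, …, h (n - 1)` (indices cyclic). -/
def IsClosedLinkage {n : ℕ} [NeZero n] (h : Fin n → DH ℝ) : Prop :=
  4 ≤ n ∧ (∀ i, h i ^ 2 = -1) ∧ ∀ i, h i ≠ h (i + 1) ∧ h i ≠ -h (i + 1)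

/-- The coupling dimension of a sequence of lines: the dimension of the real span of all products
of subsequences, the empty product `1` included. -/
def couplingDim (l : List (DH ℝ)) : ℕ :=
  Module.finrank ℝ (Submodule.span ℝ {q : DH ℝ | ∃ s : List (DH ℝ), s.Sublist l ∧ q = s.prod})

/-- The rotation `t - h` about the line `h` with parameter `t ∈ ℙ¹(ℝ)`; `t = ∞` is the identity. -/
def rotation (h : DH ℝ) : OnePoint ℝ → DH ℝ
  | none => 1
  | some t => algebraMap ℝ (DH ℝ) t - h

/-- The configuration set in `(ℙ¹(ℝ))ⁿ`, given by the closure condition. -/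
def configSet {n : ℕ} (h : Fin n → DH ℝ) : Set (Fin n → OnePoint ℝ) :=
  {t | ∃ r : ℝ, r ≠ 0 ∧
    ((List.finRange n).map fun k => rotation (h k) (t k)).prod = algebraMap ℝ (DH ℝ) r}

/-- The affine charts of `(ℙ¹(ℝ))ⁿ`: the coordinate on the `k`-th factor is `1 / t k` if `k ∈ s`
and `t k` otherwise. -/
def chart {n : ℕ} (s : Finset (Fin n)) (x : Fin n → ℝ) : Fin n → OnePoint ℝ := fun k =>
  if k ∈ s then (if x k = 0 then OnePoint.infty else ((x k)⁻¹ : ℝ)) else (x k : ℝ)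

/-- The ideal, in the chart `s`, of the Zariski closure in `(ℙ¹(ℂ))ⁿ` of the configuration set. -/
def configIdeal {n : ℕ} (h : Fin n → DH ℝ) (s : Finset (Fin n)) :
    Ideal (MvPolynomial (Fin n) ℂ) where
  carrier := {p | ∀ x : Fin n → ℝ, chart s x ∈ configSet h →
    MvPolynomial.eval (fun k => (x k : ℂ)) p = 0}
  add_mem' := by
    intro a b ha hb x hx
    rw [map_add, ha x hx, hb x hx, add_zero]
  zero_mem' := by
    intro x _
    exact map_zero _
  smul_mem' := by
    intro c a ha x hx
    rw [smul_eq_mul, map_mul, ha x hx, mul_zero]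

/-- The mobility of a linkage: the dimension of its configuration set (the Krull dimension of the
Zariski closure, computed in the charts that cover it; `⊥` if it is empty). -/
def mobility {n : ℕ} (h : Fin n → DH ℝ) : WithBot ℕ∞ :=
  ⨆ s : Finset (Fin n), ringKrullDim (MvPolynomial (Fin n) ℂ ⧸ configIdeal h s)

/-! ### Bonds and connection numbers -/

/-- The coordinate ring of the part of the complexified configuration curve where all `t k` are
finite. -/
abbrev CoordRing {n : ℕ} (h : Fin n → DH ℝ) : Type :=
  MvPolynomial (Fin n) ℂ ⧸ configIdeal h ∅

/-- The coordinate ring of its normalization: the integral closure in the total ring of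
fractions. -/
abbrev NormRing {n : ℕ} (h : Fin n → DH ℝ) : Type :=
  integralClosure (CoordRing h) (FractionRing (CoordRing h))

/-- The points of the normalization over the part where all `t k` are finite. -/
abbrev NormPoint {n : ℕ} (h : Fin n → DH ℝ) : Type :=
  MaximalSpectrum (NormRing h)

/-- Pullback of polynomial functions to the normalization. -/
def toNormRing {n : ℕ} (h : Fin n → DH ℝ) : MvPolynomial (Fin n) ℂ →+* NormRing h :=
  (algebraMap (CoordRing h) (NormRing h)).comp (Ideal.Quotient.mk (configIdeal h ∅))

/-- The point `β` of the normalization lies over the point `c`. -/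
def LiesOver {n : ℕ} (h : Fin n → DH ℝ) (β : NormPoint h) (c : Fin n → ℂ) : Prop :=
  ∀ k, toNormRing h (MvPolynomial.X k - MvPolynomial.C (c k)) ∈ β.asIdeal

/-- The product `(t_{i+1} - h_{i+1}) ⋯ (t_j - h_j)` (joints numbered from `1`, so that the `k`-th
joint is `h (k - 1)`), with parameters in an extension `R` of the field of real numbers. -/
def chainProd {n : ℕ} {R : Type*} [CommRing R] (f : ℝ →+* R) (h : Fin n → DH ℝ) (t : Fin n → R)
    (i j : ℕ) : DH R :=
  ((((List.finRange n).take j).drop i).map fun k => algebraMap R (DH R) (t k) - mapDH f (h k)).prod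

/-- A bond (at finite parameter values): a point of the normalization of the configuration curve
that lies over a point where the product of all the `t_k - h_k` vanishes. -/
def IsBond {n : ℕ} (h : Fin n → DH ℝ) (β : NormPoint h) : Prop :=
  ∃ c : Fin n → ℂ, LiesOver h β c ∧ chainProd Complex.ofRealHom h c 0 n = 0

/-- The function `F_{i,j}` on the normalization. -/
def couplerFun {n : ℕ} (h : Fin n → DH ℝ) (i j : ℕ) : DH (NormRing h) :=
  chainProd ((toNormRing h).comp (MvPolynomial.C.comp Complex.ofRealHom)) h
    (fun k => toNormRing h (MvPolynomial.X k)) i j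

/-- The vanishing order of `F_{i,j}` at the point `β` of the normalization. -/
def vanishingOrder {n : ℕ} (h : Fin n → DH ℝ) (β : NormPoint h) (i j : ℕ) : ℕ :=
  sSup {m : ℕ | ∀ x ∈ coords (couplerFun h i j), x ∈ β.asIdeal ^ m}

/-- The connection number `k_β(i, j)`, for joints `1 ≤ i < j ≤ n` numbered from `1`. -/
def connectionNumber {n : ℕ} (h : Fin n → DH ℝ) (β : NormPoint h) (i j : ℕ) : ℤ :=
  (vanishingOrder h β i (j - 1) : ℤ) + vanishingOrder h β (i - 1) j
    - vanishingOrder h β i j - vanishingOrder h β (i - 1) (j - 1)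

/-- The bonds that connect the joints `i < j`, numbered from `1`, with `t_i = a` and `t_j = b`: the
bonds over a point whose coordinates with values `± i` are exactly the `i`-th and the `j`-th. -/
def connectingBonds {n : ℕ} (h : Fin n → DH ℝ) (i j : ℕ) (a b : ℂ) : Set (NormPoint h) :=
  {β | IsBond h β ∧ ∃ c : Fin n → ℂ, LiesOver h β c ∧
    (∀ k : Fin n, c k ^ 2 + 1 = 0 ↔ (k : ℕ) + 1 = i ∨ (k : ℕ) + 1 = j) ∧
    (∀ k : Fin n, (k : ℕ) + 1 = i → c k = a) ∧ ∀ k : Fin n, (k : ℕ) + 1 = j → c k = b}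

/-- There are finitely many bonds that connect the joints `i < j` with `t_i = a` and `t_j = b`, and
their number, counted with multiplicity, is at most `d`. -/
def BondCountLE {n : ℕ} (h : Fin n → DH ℝ) (i j : ℕ) (a b : ℂ) (d : ℕ) : Prop :=
  (connectingBonds h i j a b).Finite ∧
    ∑ᶠ β ∈ connectingBonds h i j a b, connectionNumber h β i j ≤ (d : ℤ)

/-! ### Quad polynomials -/

/-- The complexification of a real dual quaternion. -/
abbrev toDHC (h : DH ℝ) : DH ℂ := mapDH Complex.ofRealHom h

/-- The imaginary unit of the field of complex numbers, as a scalar in the dual quaternions. -/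
abbrev iDH : DH ℂ := algebraMap ℂ (DH ℂ) Complex.I

/-- `g` generates, as a module over the complex dual numbers, the intersection of the right ideal
of `i - h₁` and the left annihilator of `i - h₄`. -/
def IsGeneratorG (g : DH ℂ) (h₁ h₄ : DH ℝ) : Prop :=
  {q : DH ℂ | (∃ r : DH ℂ, q = (iDH - toDHC h₁) * r) ∧ q * (iDH - toDHC h₄) = 0} =
    Set.range fun d : ℂ[ε] => algebraMap ℂ[ε] (DH ℂ) d * g

/-- The ring `ℂ[x, y, t₂, t₃]`, with the variables in this order. -/
abbrev QuadRing : Type := MvPolynomial (Fin 4) ℂ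

/-- The product `(i - h₁) (t₂ - h₂) (t₃ - h₃)` with indeterminates `t₂`, `t₃`. -/
def quadProduct (h₁ h₂ h₃ : DH ℝ) : DH QuadRing :=
  mapDH MvPolynomial.C (iDH - toDHC h₁) *
    (algebraMap QuadRing (DH QuadRing) (MvPolynomial.X 2) - mapDH MvPolynomial.C (toDHC h₂)) *
    (algebraMap QuadRing (DH QuadRing) (MvPolynomial.X 3) - mapDH MvPolynomial.C (toDHC h₃))

/-- The scalar `y (1 + x ε)`. -/
def quadScalar : QuadRing[ε] :=
  TrivSqZeroExt.inl (MvPolynomial.X 1) *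
    (1 + TrivSqZeroExt.inl (MvPolynomial.X 0) * DualNumber.eps)

/-- The ideal of `ℂ[x, y, t₂, t₃]` generated by the coordinates of
`(i - h₁) (t₂ - h₂) (t₃ - h₃) (i - h₄)` and of `(i - h₁) (t₂ - h₂) (t₃ - h₃) - y (1 + x ε) g`. -/
def quadIdeal (g : DH ℂ) (h₁ h₂ h₃ h₄ : DH ℝ) : Ideal QuadRing :=
  Ideal.span
    (coords (quadProduct h₁ h₂ h₃ * mapDH MvPolynomial.C (iDH - toDHC h₄)) ∪
      coords (quadProduct h₁ h₂ h₃ - algebraMap QuadRing[ε] (DH QuadRing) quadScalar * mapDH MvPolynomial.C g))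

/-- The elimination ideal in `ℂ[x]`. -/
def elimIdeal (g : DH ℂ) (h₁ h₂ h₃ h₄ : DH ℝ) : Ideal (Polynomial ℂ) :=
  (quadIdeal g h₁ h₂ h₃ h₄).comap
    (Polynomial.aeval (MvPolynomial.X 0 : QuadRing) : Polynomial ℂ →ₐ[ℂ] QuadRing)

/-- The quad polynomial formed with the generator `g`: the monic generator of the elimination
ideal. -/
def quadPolyWith (g : DH ℂ) (h₁ h₂ h₃ h₄ : DH ℝ) : Polynomial ℂ :=
  normalize (Submodule.IsPrincipal.generator (elimIdeal g h₁ h₂ h₃ h₄))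

/-- The standard generator `(i - h₁) (i + h₄)`, for lines `h₁`, `h₄` that are not parallel. -/
def stdGenerator (h₁ h₄ : DH ℝ) : DH ℂ :=
  (iDH - toDHC h₁) * (iDH + toDHC h₄)

/-- The quad polynomial `Q_{h₁,h₂,h₃,h₄}` of lines with `h₁`, `h₄` not parallel. -/
def quadPoly (h₁ h₂ h₃ h₄ : DH ℝ) : Polynomial ℂ :=
  quadPolyWith (stdGenerator h₁ h₄) h₁ h₂ h₃ h₄

end BondTheory

end

open scoped Quaternion DualNumber

noncomputable section

namespace BondTheory

/-! ### Coordinates, linear functions and extension of scalars -/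

section Coordinates

variable {R S T : Type*} [CommRing R] [CommRing S] [CommRing T]

/-! Write `X` and `Y` for the half chains `(t₁ - h₁)(t₂ - h₂)(t₃ - h₃)` and `(t₄ - h₄)(t₅ - h₅)(t₆ -
h₆)`, and put `f = t₁ - i`. The bonds in question are counted by the length of the fibre `f = 0` of
the configuration curve, restricted to the open set `D ≠ 0` that excludes the other ways in which a
`t k ^ 2 + 1` can vanish. The theorem says that this piece of fibre embeds scheme-theoretically in a
line with coordinate `x`, inside the common zeros of the two quad polynomials.

Let `A` be the coordinate ring and `B = A[1/D]`. On the curve `X * Y` is a scalar. Comparing with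
the norms of `X` and `Y` gives `X = w * star Y` with a unit `w`, and `f ∣ t₄ - i`
(`closed_chain_relations`). Modulo `f`, therefore, `X` is killed on the left by `i + h₁` and on the
right by `i - h₄`. So it lies in the scalar extension of `G` and has the form `y (1 + x ε) g` with
`y` a unit, while `Y` is a unit times `(1 + x ε) star g` with the same `x`. Hence both quad
polynomials, and so their gcd, vanish at `x`. Coupling dimension 8 makes the eight subproducts of
the lines a basis. In this basis the coordinates of `X` include `t₂`, `t₃` and `-1`, whereas those
of `y (1 + x ε) g` are `y` times affine functions of `x`; the entry `-1` determines `y`, so `t₂` and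
`t₃` are functions of `x`. The same holds for `t₅` and `t₆`. Thus `B / f` is generated by `x`, and
its dimension is at most the degree of the gcd (`finrank_le_natDegree_gcd`), provided the first quad
polynomial is not zero (`elimIdeal_ne_bot`).

`rank_quotient_le` carries this bound from `B / f` to the normalization: multiplication by `f` has
cokernels of equal length on commensurable modules. At a connecting bond `v(1,3) = 0`, so the
connection number is at most `v(0,4)`; moreover a norm computation puts `f` in the `v(0,4)`-th power
of the maximal ideal. The Chinese remainder theorem adds up these local contributions
(`bondCountLE_of_rank_le`).

The case `t₄ = -i` is the same one for the line `-h₄` with parameter `-t₄`; a sign `ρ` treats both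
at once. If the lines are not parallel, `(i - h₁)(i + h₄)` is a generator, and its conjugate is the
standard generator with the lines exchanged. -/

lemma DH.ext_coords {p q : DH R}
    (h1 : p.re.fst = q.re.fst) (h2 : p.imI.fst = q.imI.fst) (h3 : p.imJ.fst = q.imJ.fst)
    (h4 : p.imK.fst = q.imK.fst) (h5 : p.re.snd = q.re.snd) (h6 : p.imI.snd = q.imI.snd)
    (h7 : p.imJ.snd = q.imJ.snd) (h8 : p.imK.snd = q.imK.snd) : p = q := by
  apply Quaternion.ext
  all_goals apply TrivSqZeroExt.ext <;> assumption

/-- The coordinate vector of a dual quaternion. -/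
def coordEquiv (R : Type*) [CommRing R] : DH R ≃ₗ[R] (Fin 8 → R) where
  toFun q := ![q.re.fst, q.imI.fst, q.imJ.fst, q.imK.fst, q.re.snd, q.imI.snd, q.imJ.snd,
    q.imK.snd]
  invFun v := ⟨(v 0, v 4), (v 1, v 5), (v 2, v 6), (v 3, v 7)⟩
  map_add' p q := by
    ext k; fin_cases k <;> rfl
  map_smul' r q := by
    ext k; fin_cases k <;> rfl
  left_inv q := rfl
  right_inv v := by
    ext k; fin_cases k <;> rfl

lemma coordEquiv_apply (q : DH R) : coordEquiv R q =
    ![q.re.fst, q.imI.fst, q.imJ.fst, q.imK.fst, q.re.snd, q.imI.snd, q.imJ.snd, q.imK.snd] :=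
  rfl

lemma coords_eq_range (q : DH R) : coords q = Set.range (coordEquiv R q) := by
  rw [coordEquiv_apply]
  ext x
  simp only [coords, Matrix.range_cons, Matrix.range_empty, Set.union_empty, Set.mem_insert_iff,
    Set.mem_singleton_iff, Set.mem_union]

/-- This turns vanishing of a dual quaternion to some order into scalar statements: one tests it
with a well-chosen functional. -/
lemma linearMap_mem_of_coords {I : Ideal R} {q : DH R} (hq : ∀ x ∈ coords q, x ∈ I)
    (l : DH R →ₗ[R] R) : l q ∈ I := by
  rw [coords_eq_range] at hq
  have : l q = ∑ k, (coordEquiv R q k) * l ((coordEquiv R).symm (Pi.single k 1)) := by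
    conv_lhs => rw [← (coordEquiv R).symm_apply_apply q, pi_eq_sum_univ' (coordEquiv R q)]
    simp [map_sum]
  rw [this]
  exact I.sum_mem fun k _ => I.mul_mem_right _ (hq _ ⟨k, rfl⟩)

@[simp] lemma mapDual_fst (f : R →+* S) (d : R[ε]) : (mapDual f d).fst = f d.fst := by
  simp [mapDual]

@[simp] lemma mapDual_snd (f : R →+* S) (d : R[ε]) : (mapDual f d).snd = f d.snd := by
  simp [mapDual]

@[simp] lemma mapDH_re (f : R →+* S) (q : DH R) : (mapDH f q).re = mapDual f q.re := rfl
@[simp] lemma mapDH_imI (f : R →+* S) (q : DH R) : (mapDH f q).imI = mapDual f q.imI := rfl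
@[simp] lemma mapDH_imJ (f : R →+* S) (q : DH R) : (mapDH f q).imJ = mapDual f q.imJ := rfl
@[simp] lemma mapDH_imK (f : R →+* S) (q : DH R) : (mapDH f q).imK = mapDual f q.imK := rfl

@[simp] lemma scal_re (r : R) : (algebraMap R (DH R) r).re = TrivSqZeroExt.inl r := rfl
@[simp] lemma scal_imI (r : R) : (algebraMap R (DH R) r).imI = 0 := rfl
@[simp] lemma scal_imJ (r : R) : (algebraMap R (DH R) r).imJ = 0 := rfl
@[simp] lemma scal_imK (r : R) : (algebraMap R (DH R) r).imK = 0 := rfl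

/-- Extension of scalars for dual quaternions, as a ring homomorphism. -/
def mapDHHom (f : R →+* S) : DH R →+* DH S where
  toFun := mapDH f
  map_one' := by ext <;> simp
  map_zero' := by ext <;> simp
  map_add' a b := by ext <;> simp
  map_mul' a b := by ext <;> simp

@[simp] lemma mapDHHom_apply (f : R →+* S) (q : DH R) : mapDHHom f q = mapDH f q := rfl

lemma mapDH_mul (f : R →+* S) (p q : DH R) : mapDH f (p * q) = mapDH f p * mapDH f q :=
  map_mul (mapDHHom f) p q

lemma mapDH_add (f : R →+* S) (p q : DH R) : mapDH f (p + q) = mapDH f p + mapDH f q :=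
  map_add (mapDHHom f) p q

lemma mapDH_sub (f : R →+* S) (p q : DH R) : mapDH f (p - q) = mapDH f p - mapDH f q :=
  map_sub (mapDHHom f) p q

lemma mapDH_neg (f : R →+* S) (p : DH R) : mapDH f (-p) = -mapDH f p :=
  map_neg (mapDHHom f) p

lemma mapDH_one (f : R →+* S) : mapDH f 1 = 1 := map_one (mapDHHom f)

lemma mapDH_mapDH (f : R →+* S) (g : S →+* T) (q : DH R) :
    mapDH g (mapDH f q) = mapDH (g.comp f) q := by
  ext <;> simp

lemma mapDH_star (f : R →+* S) (q : DH R) : mapDH f (star q) = star (mapDH f q) := by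
  ext <;> simp

lemma mapDH_algebraMap (f : R →+* S) (r : R) :
    mapDH f (algebraMap R (DH R) r) = algebraMap S (DH S) (f r) := by
  ext <;> simp

lemma mapDH_dual (f : R →+* S) (d : R[ε]) :
    mapDH f (algebraMap R[ε] (DH R) d) = algebraMap S[ε] (DH S) (mapDual f d) := by
  ext <;> simp [Quaternion.algebraMap_def]

lemma coordEquiv_mapDH (f : R →+* S) (q : DH R) (k : Fin 8) :
    coordEquiv S (mapDH f q) k = f (coordEquiv R q k) := by
  rw [coordEquiv_apply, coordEquiv_apply]
  fin_cases k <;> simp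

/-- Extension of scalars for linear functions on dual quaternions. -/
def extFun (f : R →+* S) (l : DH R →ₗ[R] R) : DH S →ₗ[S] S :=
  (∑ k, f (l ((coordEquiv R).symm (Pi.single k 1))) • LinearMap.proj k) ∘ₗ
    (coordEquiv S).toLinearMap

lemma extFun_mapDH (f : R →+* S) (l : DH R →ₗ[R] R) (q : DH R) :
    extFun f l (mapDH f q) = f (l q) := by
  conv_rhs => rw [← (coordEquiv R).symm_apply_apply q, pi_eq_sum_univ' (coordEquiv R q)]
  simp [extFun, coordEquiv_mapDH, map_sum, mul_comm]

/-- The real primal coordinate. -/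
def reFst (R : Type*) [CommRing R] : DH R →ₗ[R] R where
  toFun q := q.re.fst
  map_add' _ _ := rfl
  map_smul' _ _ := rfl

/-- A scalar of the base ring, as a dual quaternion. -/
abbrev scal (r : R) : DH R := algebraMap R (DH R) r

lemma scal_mul_eq_smul (r : R) (q : DH R) : scal r * q = r • q := (Algebra.smul_def r q).symm

lemma star_scal (r : R) : star (scal r) = scal r := by
  ext <;> simp

lemma star_dual (d : R[ε]) : star (algebraMap R[ε] (DH R) d) = algebraMap R[ε] (DH R) d := by
  ext <;> simp [Quaternion.algebraMap_def]

lemma reFst_dual_mul (d : R[ε]) (q : DH R) :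
    reFst R (algebraMap R[ε] (DH R) d * q) = d.fst * reFst R q := by
  change (algebraMap R[ε] (DH R) d * q).re.fst = d.fst * q.re.fst
  simp [Quaternion.algebraMap_def]

lemma reFst_scal (r : R) : reFst R (scal r) = r := by
  rfl

end Coordinates

/-! ### Algebra of lines -/

section Lines

variable {R : Type*} [CommRing R]

lemma scal_sub_mul_scal_add {a : DH R} (ha : a ^ 2 = -1) (t : R) :
    (scal t - a) * (scal t + a) = scal (t ^ 2 + 1) := by
  have : (scal t - a) * (scal t + a) = scal t * scal t - a ^ 2 := by
    rw [sub_mul, mul_add, mul_add, (Algebra.commutes t a).symm]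
    noncomm_ring
  rw [this, ha]; simp [pow_two]

lemma scal_add_mul_scal_sub {a : DH R} (ha : a ^ 2 = -1) (t : R) :
    (scal t + a) * (scal t - a) = scal (t ^ 2 + 1) := by
  have := scal_sub_mul_scal_add (a := -a) (by rw [neg_sq, ha]) t
  simpa [← sub_eq_add_neg] using this

/-- The vector part of `h ^ 2` is twice the real part times the vector part. A nonzero primal real
part would kill the primal vector part and make `-1` a real square; then a nonzero dual real part
would kill the primal vector part as well, leaving primal real part `0` for `h ^ 2`. -/
lemma real_line_pure {h : DH ℝ} (hh : h ^ 2 = -1) : h.re = 0 := by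
  have e := hh
  rw [pow_two] at e
  have e1 := congrArg (fun q : DH ℝ => q.re.fst) e
  have e2 := congrArg (fun q : DH ℝ => q.imI.fst) e
  have e3 := congrArg (fun q : DH ℝ => q.imJ.fst) e
  have e4 := congrArg (fun q : DH ℝ => q.imK.fst) e
  have e5 := congrArg (fun q : DH ℝ => q.re.snd) e
  have e6 := congrArg (fun q : DH ℝ => q.imI.snd) e
  have e7 := congrArg (fun q : DH ℝ => q.imJ.snd) e
  have e8 := congrArg (fun q : DH ℝ => q.imK.snd) e
  simp at e1 e2 e3 e4 e5 e6 e7 e8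
  have h0 : h.re.fst = 0 := by
    by_contra hne
    have i1 : h.imI.fst = 0 := by
      have : h.re.fst * h.imI.fst = 0 := by linarith
      simpa [hne] using this
    have i2 : h.imJ.fst = 0 := by
      have : h.re.fst * h.imJ.fst = 0 := by linarith
      simpa [hne] using this
    have i3 : h.imK.fst = 0 := by
      have : h.re.fst * h.imK.fst = 0 := by linarith
      simpa [hne] using this
    rw [i1, i2, i3] at e1
    nlinarith
  rw [h0] at e1 e6 e7 e8
  have h1 : h.re.snd = 0 := by
    have a1 : h.re.snd * h.imI.fst = 0 := by linarith
    have a2 : h.re.snd * h.imJ.fst = 0 := by linarith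
    have a3 : h.re.snd * h.imK.fst = 0 := by linarith
    by_contra hne
    simp [hne] at a1 a2 a3
    rw [a1, a2, a3] at e1
    norm_num at e1
  exact TrivSqZeroExt.ext h0 h1

lemma real_line_star {h : DH ℝ} (hh : h ^ 2 = -1) : star h = -h := by
  have := real_line_pure hh
  ext <;> simp [this]

end Lines

/-! ### The basis of subproducts for coupling dimension eight -/

section CouplingBasis

variable {R S : Type*} [CommRing R] [CommRing S]

/-- The products of the subsequences of a sequence of three dual quaternions. -/
def subProducts (a b c : DH R) : Fin 8 → DH R :=
  ![1, a, b, c, a * b, a * c, b * c, a * b * c]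

lemma mapDH_subProducts (f : R →+* S) (a b c : DH R) (k : Fin 8) :
    mapDH f (subProducts a b c k) = subProducts (mapDH f a) (mapDH f b) (mapDH f c) k := by
  fin_cases k <;> simp [subProducts, mapDH_mul, mapDH_one]

/-- Three lines have only eight subsequences, so a span of dimension 8 leaves no room for a
relation. -/
lemma linearIndependent_subProducts {a b c : DH ℝ} (h : couplingDim [a, b, c] = 8) :
    LinearIndependent ℝ (subProducts a b c) := by
  rw [linearIndependent_iff_card_eq_finrank_span, Set.finrank, Fintype.card_fin]
  refine h.symm.trans ?_
  suffices hs : {q : DH ℝ | ∃ s : List (DH ℝ), s.Sublist [a, b, c] ∧ q = s.prod} =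
      Set.range (subProducts a b c) by rw [couplingDim, hs]
  ext q
  simp only [Set.mem_ofPred_eq, ← List.mem_sublists, Set.mem_range]
  simp only [List.sublists, List.foldr, List.flatMap_cons, List.flatMap_nil, List.append_nil,
    List.cons_append, List.nil_append, List.mem_cons, List.not_mem_nil, or_false]
  constructor
  · rintro ⟨s, hs, rfl⟩
    rcases hs with rfl | rfl | rfl | rfl | rfl | rfl | rfl | rfl
    · exact ⟨0, by simp [subProducts]⟩
    · exact ⟨1, by simp [subProducts]⟩
    · exact ⟨2, by simp [subProducts]⟩
    · exact ⟨4, by simp [subProducts]⟩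
    · exact ⟨3, by simp [subProducts]⟩
    · exact ⟨5, by simp [subProducts]⟩
    · exact ⟨6, by simp [subProducts]⟩
    · exact ⟨7, by simp [subProducts, mul_assoc]⟩
  · rintro ⟨k, rfl⟩
    fin_cases k
    · exact ⟨_, .inl rfl, by simp [subProducts]⟩
    · exact ⟨_, .inr <| .inl rfl, by simp [subProducts]⟩
    · exact ⟨_, .inr <| .inr <| .inl rfl, by simp [subProducts]⟩
    · exact ⟨_, .inr <| .inr <| .inr <| .inr <| .inl rfl, by simp [subProducts]⟩
    · exact ⟨_, .inr <| .inr <| .inr <| .inl rfl, by simp [subProducts]⟩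
    · exact ⟨_, .inr <| .inr <| .inr <| .inr <| .inr <| .inl rfl, by simp [subProducts]⟩
    · exact ⟨_, .inr <| .inr <| .inr <| .inr <| .inr <| .inr <| .inl rfl, by simp [subProducts]⟩
    · exact ⟨_, .inr <| .inr <| .inr <| .inr <| .inr <| .inr <| .inr rfl,
        by simp [subProducts, mul_assoc]⟩

lemma LinearIndependent.subProducts_neg {a b c : DH ℝ}
    (h : LinearIndependent ℝ (subProducts a b c)) :
    LinearIndependent ℝ (subProducts a b (-c)) := by
  have := h.units_smul ![1, 1, 1, -1, 1, -1, -1, -1]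
  convert this using 1
  ext1 k
  fin_cases k <;> simp [subProducts]

/-- Real linear functions on the dual quaternions that are dual to the products of the
subsequences of `a, b, c`. -/
structure IsDualSystem (a b c : DH ℝ) (l : Fin 8 → DH ℝ →ₗ[ℝ] ℝ) : Prop where
  apply_subProducts : ∀ j k, l j (subProducts a b c k) = if j = k then 1 else 0
  sum_smul : ∀ q, ∑ k, l k q • subProducts a b c k = q

lemma exists_isDualSystem {a b c : DH ℝ} (h : LinearIndependent ℝ (subProducts a b c)) :
    ∃ l, IsDualSystem a b c l := by
  have hc : Fintype.card (Fin 8) = Module.finrank ℝ (DH ℝ) := by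
    rw [(coordEquiv ℝ).finrank_eq]; simp
  let B := basisOfLinearIndependentOfCardEqFinrank h hc
  have hB : ∀ k, B k = subProducts a b c k := fun k => by simp [B]
  refine ⟨fun k => B.coord k, fun j k => ?_, fun q => ?_⟩
  · rw [← hB, Module.Basis.coord_apply, Module.Basis.repr_self, Finsupp.single_apply]
    simp only [eq_comm]
  · simp only [← hB, Module.Basis.coord_apply]
    exact B.sum_repr q

/-- The coordinate basis already comes from the smaller ring; identities over `S` may thus be
checked on extended elements. -/
lemma linearMap_ext_mapDH {M : Type*} [AddCommGroup M] [Module S M] (f : R →+* S)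
    {u v : DH S →ₗ[S] M} (h : ∀ q, u (mapDH f q) = v (mapDH f q)) : u = v := by
  have hb : ∀ k, (coordEquiv S).symm (Pi.single k 1) =
      mapDH f ((coordEquiv R).symm (Pi.single k 1)) := by
    intro k
    rw [LinearEquiv.symm_apply_eq]
    ext j
    rw [coordEquiv_mapDH, LinearEquiv.apply_symm_apply, Pi.single_apply, Pi.single_apply]
    split_ifs <;> simp
  have : u ∘ₗ (coordEquiv S).symm.toLinearMap = v ∘ₗ (coordEquiv S).symm.toLinearMap := by
    refine LinearMap.pi_ext' fun k => LinearMap.ext_ring ?_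
    simp [hb, h]
  ext q
  have := LinearMap.congr_fun this (coordEquiv S q)
  simpa using this

lemma IsDualSystem.sum_extFun {a b c : DH ℝ} {l : Fin 8 → DH ℝ →ₗ[ℝ] ℝ}
    (hl : IsDualSystem a b c l) (f : ℝ →+* S) (q : DH S) :
    ∑ k, extFun f (l k) q • subProducts (mapDH f a) (mapDH f b) (mapDH f c) k = q := by
  let u : DH S →ₗ[S] DH S :=
    ∑ k, (extFun f (l k)).smulRight (subProducts (mapDH f a) (mapDH f b) (mapDH f c) k)
  have hu : u = LinearMap.id := by
    apply linearMap_ext_mapDH f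
    intro q
    conv_rhs => rw [← hl.sum_smul q, LinearMap.id_apply, ← mapDHHom_apply, map_sum]
    simp only [u, LinearMap.sum_apply, LinearMap.smulRight_apply, extFun_mapDH]
    refine Finset.sum_congr rfl fun k _ => ?_
    rw [Algebra.smul_def, Algebra.smul_def, mapDHHom_apply, mapDH_mul, mapDH_algebraMap,
      mapDH_subProducts]
  have := LinearMap.congr_fun hu q
  simpa [u, LinearMap.sum_apply] using this

lemma IsDualSystem.extFun_subProducts {a b c : DH ℝ} {l : Fin 8 → DH ℝ →ₗ[ℝ] ℝ}
    (hl : IsDualSystem a b c l) (f : ℝ →+* S) (j k : Fin 8) :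
    extFun f (l j) (subProducts (mapDH f a) (mapDH f b) (mapDH f c) k) = if j = k then 1 else 0 := by
  rw [← mapDH_subProducts, extFun_mapDH, hl.apply_subProducts]
  split_ifs <;> simp

lemma triple_product_expand (a b c : DH R) (r s t : R) :
    (scal r - a) * (scal s - b) * (scal t - c) =
      ∑ k, (![r * s * t, -(s * t), -(r * t), -(r * s), t, s, r, -1] : Fin 8 → R) k •
        subProducts a b c k := by
  simp only [Fin.sum_univ_eight, subProducts, Matrix.cons_val, Algebra.algebraMap_eq_smul_one,
    sub_mul, mul_sub, smul_mul_assoc, mul_smul_comm, one_mul, mul_one]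
  module

/-- Entries 4, 5 and 7 return `t`, `s` and `-1`: the joint parameters can be read off the product,
once it is known up to a scalar. -/
lemma IsDualSystem.extFun_triple {a b c : DH ℝ} {l : Fin 8 → DH ℝ →ₗ[ℝ] ℝ}
    (hl : IsDualSystem a b c l) (f : ℝ →+* S) (r s t : S) (j : Fin 8) :
    extFun f (l j) ((scal r - mapDH f a) * (scal s - mapDH f b) * (scal t - mapDH f c)) =
      (![r * s * t, -(s * t), -(r * t), -(r * s), t, s, r, -1] : Fin 8 → S) j := by
  rw [triple_product_expand, map_sum]
  simp only [map_smul, hl.extFun_subProducts, smul_eq_mul, mul_ite, mul_one, mul_zero]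
  simp

end CouplingBasis

/-! ### Multiplication by dual scalars -/

section DualScalars

variable {R S : Type*} [CommRing R] [CommRing S]

/-- The dual unit, as a dual quaternion. -/
abbrev epsDH (R : Type*) [CommRing R] : DH R := algebraMap R[ε] (DH R) ε

@[simp] lemma dual_re (d : R[ε]) : (algebraMap R[ε] (DH R) d).re = d := rfl
@[simp] lemma dual_imI (d : R[ε]) : (algebraMap R[ε] (DH R) d).imI = 0 := rfl
@[simp] lemma dual_imJ (d : R[ε]) : (algebraMap R[ε] (DH R) d).imJ = 0 := rfl
@[simp] lemma dual_imK (d : R[ε]) : (algebraMap R[ε] (DH R) d).imK = 0 := rfl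

lemma dual_mul_eq (d : R[ε]) (q : DH R) :
    algebraMap R[ε] (DH R) d * q = d.fst • q + d.snd • (epsDH R * q) := by
  ext <;> simp [mul_comm]

lemma epsDH_mul_epsDH : epsDH R * epsDH R = 0 := by
  rw [← map_mul, DualNumber.eps_mul_eps, map_zero]

lemma mapDH_epsDH (f : R →+* S) : mapDH f (epsDH R) = epsDH S := by
  rw [mapDH_dual]
  congr 1
  ext <;> simp

lemma mapDH_smul (f : R →+* S) (r : R) (q : DH R) : mapDH f (r • q) = f r • mapDH f q := by
  rw [Algebra.smul_def, Algebra.smul_def, mapDH_mul, mapDH_algebraMap]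

lemma extFun_comp {T : Type*} [CommRing T] (f : R →+* S) (g : S →+* T) (l : DH R →ₗ[R] R)
    (q : DH S) : extFun (g.comp f) l (mapDH g q) = g (extFun f l q) := by
  simp [extFun, coordEquiv_mapDH, map_sum]

lemma extFun_dual_mul {T : Type*} [CommRing T] (f : R →+* S) (g : S →+* T) (l : DH R →ₗ[R] R)
    (d : T[ε]) (q : DH S) :
    extFun (g.comp f) l (algebraMap T[ε] (DH T) d * mapDH g q) =
      d.fst * g (extFun f l q) + d.snd * g (extFun f l (epsDH S * q)) := by
  rw [dual_mul_eq, map_add, map_smul, map_smul, extFun_comp, ← mapDH_epsDH g, ← mapDH_mul,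
    extFun_comp, smul_eq_mul, smul_eq_mul]

end DualScalars

/-! ### A primeness property, and the module `G` -/

section Prime

/-- If `P` has invertible real part and `P z S = 0` for all `z`, then `S = 0`. -/
lemma eq_zero_of_forall_mul_mul_eq_zero {P S : DH ℂ} (hP : IsUnit P.re)
    (h : ∀ z, P * z * S = 0) : S = 0 := by
  obtain ⟨e1, a1, b1, c1, d1⟩ : ∃ e : DH ℂ, e.re = 0 ∧ e.imI = 1 ∧ e.imJ = 0 ∧ e.imK = 0 :=
    ⟨⟨0, 1, 0, 0⟩, rfl, rfl, rfl, rfl⟩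
  obtain ⟨e2, a2, b2, c2, d2⟩ : ∃ e : DH ℂ, e.re = 0 ∧ e.imI = 0 ∧ e.imJ = 1 ∧ e.imK = 0 :=
    ⟨⟨0, 0, 1, 0⟩, rfl, rfl, rfl, rfl⟩
  obtain ⟨e3, a3, b3, c3, d3⟩ : ∃ e : DH ℂ, e.re = 0 ∧ e.imI = 0 ∧ e.imJ = 0 ∧ e.imK = 1 :=
    ⟨⟨0, 0, 0, 1⟩, rfl, rfl, rfl, rfl⟩
  -- Averaging over the quaternion units gives `P - iPi - jPj - kPk = 4 Re P`, which is central.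
  have key : algebraMap ℂ[ε] (DH ℂ) (4 * P.re) * S =
      P * 1 * S - e1 * (P * e1 * S) - e2 * (P * e2 * S) - e3 * (P * e3 * S) := by
    have : algebraMap ℂ[ε] (DH ℂ) (4 * P.re) = P * 1 - e1 * (P * e1) - e2 * (P * e2) -
        e3 * (P * e3) := by
      apply Quaternion.ext <;> simp [a1, b1, c1, d1, a2, b2, c2, d2, a3, b3, c3, d3]
      ring
    rw [this]; noncomm_ring
  rw [h, h, h, h] at key
  simp only [mul_zero, sub_zero] at key
  have h4 : IsUnit (4 * P.re) := by
    refine IsUnit.mul ?_ hP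
    exact (IsUnit.mk0 (4 : ℂ) (by norm_num)).map (algebraMap ℂ ℂ[ε])
  obtain ⟨u, hu⟩ := h4
  have := congrArg (fun q => algebraMap ℂ[ε] (DH ℂ) (↑u⁻¹) * q) key
  simp only [mul_zero] at this
  rwa [← hu, ← mul_assoc, ← map_mul, Units.inv_mul, map_one, one_mul] at this

lemma isUnit_inl_I : IsUnit (TrivSqZeroExt.inl Complex.I : ℂ[ε]) :=
  (IsUnit.mk0 Complex.I Complex.I_ne_zero).map (algebraMap ℂ ℂ[ε])

lemma toDHC_sq {h : DH ℝ} (hh : h ^ 2 = -1) : toDHC h ^ 2 = -1 := by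
  rw [pow_two, ← mapDH_mul, ← pow_two, hh, mapDH_neg, mapDH_one]

lemma toDHC_re {h : DH ℝ} (hh : h ^ 2 = -1) : (toDHC h).re = 0 := by
  rw [toDHC, mapDH_re, real_line_pure hh]
  ext <;> simp

lemma scal_I_sq_add_one : (scal (Complex.I ^ 2 + 1) : DH ℂ) = 0 := by simp

lemma iDH_sub_mul_add {h : DH ℝ} (hh : h ^ 2 = -1) :
    (iDH - toDHC h) * (iDH + toDHC h) = 0 := by
  rw [iDH, scal_sub_mul_scal_add (toDHC_sq hh), scal_I_sq_add_one]

lemma iDH_add_mul_sub {h : DH ℝ} (hh : h ^ 2 = -1) :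
    (iDH + toDHC h) * (iDH - toDHC h) = 0 := by
  rw [iDH, scal_add_mul_scal_sub (toDHC_sq hh), scal_I_sq_add_one]

/-- Since `(i - h) + (i + h) = 2i`, an element killed by `i + h` is multiplied by `2i` under `i -
h`. Membership in the right ideal thereby becomes a linear equation, which survives extension of
scalars. -/
lemma exists_left_factor_iff {h : DH ℝ} (hh : h ^ 2 = -1) (q : DH ℂ) :
    (∃ r, q = (iDH - toDHC h) * r) ↔ (iDH + toDHC h) * q = 0 := by
  constructor
  · rintro ⟨r, rfl⟩
    rw [← mul_assoc, iDH_add_mul_sub hh, zero_mul]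
  · intro hq
    refine ⟨(2 * Complex.I)⁻¹ • q, ?_⟩
    have h2 : (iDH - toDHC h) * q = (2 * Complex.I) • q := by
      calc (iDH - toDHC h) * q = (iDH + iDH) * q - (iDH + toDHC h) * q := by noncomm_ring
        _ = (2 * Complex.I) • q := by
            rw [hq, sub_zero, ← map_add, ← two_mul, Algebra.smul_def]
    rw [mul_smul_comm, h2, smul_smul, inv_mul_cancel₀ (by simp), one_smul]

lemma IsGeneratorG.mem_iff {g : DH ℂ} {h₁ h₄ : DH ℝ} (hg : IsGeneratorG g h₁ h₄)
    (hh : h₁ ^ 2 = -1) (q : DH ℂ) :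
    ((iDH + toDHC h₁) * q = 0 ∧ q * (iDH - toDHC h₄) = 0) ↔
      ∃ d : ℂ[ε], algebraMap ℂ[ε] (DH ℂ) d * g = q := by
  rw [← exists_left_factor_iff hh]
  exact Set.ext_iff.1 hg q

/-- Every `(i - h₁) z (i + h₄)` is a multiple of `g`. If `ε g = 0`, primeness gives `ε (i + h₄) =
0`, yet the real part of this element is `ε i`. -/
lemma IsGeneratorG.epsDH_mul_ne_zero {g : DH ℂ} {h₁ h₄ : DH ℝ} (hg : IsGeneratorG g h₁ h₄)
    (hh₁ : h₁ ^ 2 = -1) (hh₄ : h₄ ^ 2 = -1) : epsDH ℂ * g ≠ 0 := by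
  intro h0
  have hz : ∀ z, (iDH - toDHC h₁) * z * (epsDH ℂ * (iDH + toDHC h₄)) = 0 := by
    intro z
    obtain ⟨d, hd⟩ := (hg.mem_iff hh₁ ((iDH - toDHC h₁) * z * (iDH + toDHC h₄))).1
      ⟨by rw [← mul_assoc, ← mul_assoc, iDH_add_mul_sub hh₁, zero_mul, zero_mul],
       by rw [mul_assoc, iDH_add_mul_sub hh₄, mul_zero]⟩
    calc (iDH - toDHC h₁) * z * (epsDH ℂ * (iDH + toDHC h₄))
        = epsDH ℂ * ((iDH - toDHC h₁) * z * (iDH + toDHC h₄)) := by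
          rw [← mul_assoc, ← Algebra.commutes, mul_assoc]
      _ = algebraMap ℂ[ε] (DH ℂ) d * (epsDH ℂ * g) := by
          rw [← hd, ← mul_assoc, Algebra.commutes, mul_assoc]
      _ = 0 := by rw [h0, mul_zero]
  have hu : IsUnit (iDH - toDHC h₁).re := by
    rw [Quaternion.re_sub, toDHC_re hh₁, sub_zero]
    exact isUnit_inl_I
  have := eq_zero_of_forall_mul_mul_eq_zero hu hz
  have := congrArg (fun q : DH ℂ => q.re.snd) this
  simp [real_line_pure hh₄] at this

end Prime

/-! ### A lemma on nilpotent multipliers -/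

section Isotropic

/-- Put `M = α + β b` and `M' = α' + β' b`, which commute. From `E Q M = Q M'` and `E * E = 0`
follows `E Q M' = 0`. If `M'` has nonzero norm it is invertible, so `E Q = 0`. Otherwise `M' * M' =
2 α' M'`, and right multiplication of the relation by `M'` gives `2 α' Q M' = 0`; if `α' = 0`,
isotropy gives `M' = 0`. -/
lemma mul_mul_eq_zero_of_isotropic {H : Type*} [Ring H] [Algebra ℂ H] {E Q b : H}
    (hE : E * E = 0) (hb : b * b = -1) {α β α' β' : ℂ}
    (h : E * (Q * (α • 1 + β • b)) = Q * (α' • 1 + β' • b)) :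
    E * (Q * (α • 1 + β • b)) = 0 := by
  have h0 : E * (Q * (α' • 1 + β' • b)) = 0 := by
    rw [← h, ← mul_assoc, hE, zero_mul]
  have hc : (α • 1 + β • b) * (α' • 1 + β' • b) = (α' • 1 + β' • b) * (α • 1 + β • b) := by
    simp only [add_mul, mul_add, smul_mul_assoc, mul_smul_comm, one_mul, mul_one, hb]
    module
  by_cases hn : α' ^ 2 + β' ^ 2 = 0
  · have h1 := congrArg (fun q => q * (α' • 1 + β' • b)) h
    simp only [mul_assoc] at h1
    rw [hc, ← mul_assoc Q, ← mul_assoc E, h0, zero_mul] at h1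
    have h2 : (α' • (1 : H) + β' • b) * (α' • 1 + β' • b) = (2 * α') • (α' • 1 + β' • b) := by
      simp only [add_mul, mul_add, smul_mul_assoc, mul_smul_comm, one_mul, mul_one, hb]
      match_scalars
      · linear_combination -hn
      · ring
    rw [h2, mul_smul_comm, ← h] at h1
    rcases smul_eq_zero.1 h1.symm with h3 | h3
    · have ha : α' = 0 := by simpa using h3
      have hb' : β' = 0 := by simpa [ha] using hn
      rw [h, ha, hb']; simp
    · exact h3
  · have h1 : (α' • (1 : H) + β' • b) * (α' • 1 - β' • b) = (α' ^ 2 + β' ^ 2) • 1 := by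
      simp only [add_mul, mul_sub, smul_mul_assoc, mul_smul_comm, one_mul, mul_one, hb]
      match_scalars <;> ring
    have h2 := congrArg (fun q => q * (α' • 1 - β' • b)) h0
    simp only [mul_assoc, zero_mul, h1, mul_smul_comm, mul_one] at h2
    have h3 : E * Q = 0 := (smul_eq_zero.1 h2).resolve_left hn
    rw [← mul_assoc, h3, zero_mul]

end Isotropic

/-! ### Points of the quad ideal -/

section QuadIdeal

variable {R B : Type*} [CommRing R] [CommRing B]

lemma mapDH_eq_zero_iff (f : R →+* B) (q : DH R) :
    mapDH f q = 0 ↔ ∀ x ∈ coords q, f x = 0 := by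
  rw [coords_eq_range, Set.forall_mem_range, ← (coordEquiv B).map_eq_zero_iff, funext_iff]
  simp only [coordEquiv_mapDH, Pi.zero_apply]

/-- This describes the `B`-valued points of the scheme cut out by the quad ideal. It is used for the
universal point in one direction and for points found on the curve in the other. -/
lemma quadIdeal_le_ker_iff (χ : QuadRing →+* B) (g : DH ℂ) (h₁ h₂ h₃ h₄ : DH ℝ)
    {ψ : ℂ →+* B} (hψ : χ.comp MvPolynomial.C = ψ) {f : ℝ →+* B}
    (hf : ψ.comp Complex.ofRealHom = f) :
    quadIdeal g h₁ h₂ h₃ h₄ ≤ RingHom.ker χ ↔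
      ((scal (ψ Complex.I) - mapDH f h₁) * (scal (χ (MvPolynomial.X 2)) - mapDH f h₂) *
        (scal (χ (MvPolynomial.X 3)) - mapDH f h₃)) * (scal (ψ Complex.I) - mapDH f h₄) = 0 ∧
      (scal (ψ Complex.I) - mapDH f h₁) * (scal (χ (MvPolynomial.X 2)) - mapDH f h₂) *
        (scal (χ (MvPolynomial.X 3)) - mapDH f h₃) =
      algebraMap B[ε] (DH B) (TrivSqZeroExt.inl (χ (MvPolynomial.X 1)) +
        TrivSqZeroExt.inr (χ (MvPolynomial.X 1) * χ (MvPolynomial.X 0))) * mapDH ψ g := by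
  have hC : ∀ h : DH ℝ, mapDH χ (mapDH MvPolynomial.C (toDHC h)) = mapDH f h := by
    intro h
    rw [toDHC, mapDH_mapDH, mapDH_mapDH, hψ, hf]
  have hCi : χ (MvPolynomial.C Complex.I) = ψ Complex.I := RingHom.congr_fun hψ _
  have hs : mapDual χ quadScalar = TrivSqZeroExt.inl (χ (MvPolynomial.X 1)) +
        TrivSqZeroExt.inr (χ (MvPolynomial.X 1) * χ (MvPolynomial.X 0)) := by
    ext <;> simp [quadScalar]
  have hq : mapDH χ (quadProduct h₁ h₂ h₃) = (scal (ψ Complex.I) - mapDH f h₁) *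
      (scal (χ (MvPolynomial.X 2)) - mapDH f h₂) * (scal (χ (MvPolynomial.X 3)) - mapDH f h₃) := by
    simp only [quadProduct, mapDH_mul, mapDH_sub, hC, mapDH_algebraMap, hCi]
  rw [quadIdeal, Ideal.span_le, Set.union_subset_iff, ← hq]
  have hc : mapDH χ (mapDH MvPolynomial.C (iDH - toDHC h₄)) =
      scal (ψ Complex.I) - mapDH f h₄ := by
    simp only [mapDH_sub, hC, mapDH_algebraMap, hCi]
  have hgg : mapDH χ (mapDH MvPolynomial.C g) = mapDH ψ g := by rw [mapDH_mapDH, hψ]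
  rw [← hs, ← mapDH_dual, ← hgg, ← mapDH_mul, ← hc, ← mapDH_mul, ← sub_eq_zero (a := mapDH χ (quadProduct h₁ h₂ h₃)),
    ← mapDH_sub, mapDH_eq_zero_iff, mapDH_eq_zero_iff]
  rfl

end QuadIdeal

/-! ### The quad polynomial is not zero -/

section Nonvanishing

lemma toDHC_add_I_mul_eq_zero {p q : DH ℝ} (h : toDHC p + iDH * toDHC q = 0) : q = 0 := by
  rw [← (coordEquiv ℝ).map_eq_zero_iff]
  ext k
  have := congrFun (congrArg (coordEquiv ℂ) h) k
  rw [iDH, ← Algebra.smul_def, map_add, map_smul, Pi.add_apply, Pi.smul_apply, coordEquiv_mapDH,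
    coordEquiv_mapDH, map_zero] at this
  simpa using congrArg Complex.im this

/-- With `k = ± i`, the imaginary part of the product is `h₃ - h₄` or `h₃ + h₄`. -/
lemma eq_or_eq_neg_of_mul_eq_zero {h₃ h₄ : DH ℝ} {k : ℂ} (hk : k ^ 2 = -1)
    (h : (scal k + toDHC h₃) * (iDH - toDHC h₄) = 0) : h₃ = h₄ ∨ h₃ = -h₄ := by
  have hI : (iDH * iDH : DH ℂ) = -1 := by
    rw [iDH, ← map_mul, Complex.I_mul_I, map_neg, map_one]
  have hc : toDHC h₃ * iDH = iDH * toDHC h₃ := (Algebra.commutes _ _).symm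
  have hk' : k = Complex.I ∨ k = -Complex.I := by
    apply sq_eq_sq_iff_eq_or_eq_neg.1
    rw [hk, Complex.I_sq]
  rcases hk' with rfl | rfl
  · left
    rw [← sub_eq_zero]
    apply toDHC_add_I_mul_eq_zero (p := -1 - h₃ * h₄)
    rw [← h]
    simp only [toDHC, mapDH_sub, mapDH_neg, mapDH_one, mapDH_mul]
    simp only [add_mul, mul_sub, hc, hI]
    abel
  · right
    rw [← sub_eq_zero, sub_neg_eq_add]
    apply toDHC_add_I_mul_eq_zero (p := 1 - h₃ * h₄)
    rw [← h]
    simp only [toDHC, mapDH_sub, mapDH_add, mapDH_one, mapDH_mul, map_neg]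
    simp only [add_mul, mul_sub, neg_mul, mul_add, hc, hI]
    abel

/-- Two linear polynomials whose product equals a product of two other ones. -/
lemma exists_const_of_linear_mul_eq {p₁ q₁ p₄ q₄ p₅ q₅ p₇ q₇ : ℂ}
    (h0 : p₁ * p₇ = p₄ * p₅) (h1 : p₁ * q₇ + q₁ * p₇ = p₄ * q₅ + q₄ * p₅)
    (h2 : q₁ * q₇ = q₄ * q₅) (h7 : ¬ (p₇ = 0 ∧ q₇ = 0)) :
    ∃ k, (p₅ = k * p₇ ∧ q₅ = k * q₇ ∧ p₁ = k * p₄ ∧ q₁ = k * q₄) ∨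
      (p₄ = k * p₇ ∧ q₄ = k * q₇ ∧ p₁ = k * p₅ ∧ q₁ = k * q₅) := by
  have aux : ∀ {p₄ q₄ p₅ q₅ : ℂ}, p₁ * p₇ = p₄ * p₅ → p₁ * q₇ + q₁ * p₇ = p₄ * q₅ + q₄ * p₅ →
      q₁ * q₇ = q₄ * q₅ → p₅ * q₇ - q₅ * p₇ = 0 →
      ∃ k, p₅ = k * p₇ ∧ q₅ = k * q₇ ∧ p₁ = k * p₄ ∧ q₁ = k * q₄ := by
    intro p₄ q₄ p₅ q₅ h0 h1 h2 hd
    by_cases hp : p₇ = 0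
    · have hq : q₇ ≠ 0 := fun hq => h7 ⟨hp, hq⟩
      subst hp
      have e5 : p₅ = 0 := by simpa [hq] using hd
      subst e5
      refine ⟨q₅ / q₇, by simp, by field_simp, ?_, ?_⟩
      · field_simp; linear_combination h1
      · field_simp; linear_combination h2
    · have e1 : p₁ = p₅ / p₇ * p₄ := by field_simp; linear_combination h0
      have e5 : q₅ = p₅ / p₇ * q₇ := by field_simp; linear_combination -hd
      refine ⟨p₅ / p₇, by field_simp, e5, e1, ?_⟩
      apply mul_right_cancel₀ hp
      rw [e1, e5] at h1
      have : p₅ = p₅ / p₇ * p₇ := by field_simp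
      linear_combination h1 + q₄ * this
  -- This evaluates the homogenized product of the forms 4 and 5 at the root of form 7; one of the
  -- two must share that root.
  have hm : (p₅ * q₇ - q₅ * p₇) * (p₄ * q₇ - q₄ * p₇) = 0 := by
    linear_combination -q₇ ^ 2 * h0 + p₇ * q₇ * h1 - p₇ ^ 2 * h2
  rcases mul_eq_zero.1 hm with h | h
  · obtain ⟨k, hk⟩ := aux h0 h1 h2 h
    exact ⟨k, .inl hk⟩
  · obtain ⟨k, hk⟩ := aux (p₄ := p₅) (q₄ := q₅) (p₅ := p₄) (q₅ := q₄) (by rw [h0, mul_comm])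
      (by rw [h1]; ring) (by rw [h2, mul_comm]) h
    exact ⟨k, .inr hk⟩

end Nonvanishing

section Nonvanishing

variable {h₁ h₂ h₃ h₄ : DH ℝ} {l : Fin 8 → DH ℝ →ₗ[ℝ] ℝ}

/-- An element of the right ideal of `i - h₁` is determined by four of its coordinates. -/
lemma IsDualSystem.eq_of_left_mul_eq_zero (hl : IsDualSystem h₁ h₂ h₃ l) (hh₁ : h₁ ^ 2 = -1)
    {q : DH ℂ} (hq : (iDH + toDHC h₁) * q = 0) :
    q = -((iDH - toDHC h₁) * (extFun Complex.ofRealHom (l 1) q • 1 + extFun Complex.ofRealHom (l 4) q • toDHC h₂ +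
      extFun Complex.ofRealHom (l 5) q • toDHC h₃ + extFun Complex.ofRealHom (l 7) q • (toDHC h₂ * toDHC h₃))) := by
  set a := toDHC h₁ with ha
  set b := toDHC h₂ with hb
  set c := toDHC h₃ with hc
  have haa : a * a = -1 := by rw [← pow_two, ha, toDHC_sq hh₁]
  set m : Fin 8 → ℂ := fun k => extFun Complex.ofRealHom (l k) q with hm
  have hsum : q = ∑ k, m k • subProducts a b c k := (hl.sum_extFun Complex.ofRealHom q).symm
  have hz : (iDH + a) * q = ∑ k, (![Complex.I * m 0 - m 1, Complex.I * m 1 + m 0,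
      Complex.I * m 2 - m 4, Complex.I * m 3 - m 5, Complex.I * m 4 + m 2, Complex.I * m 5 + m 3,
      Complex.I * m 6 - m 7, Complex.I * m 7 + m 6] : Fin 8 → ℂ) k • subProducts a b c k := by
    conv_lhs => rw [hsum]
    simp only [Fin.sum_univ_eight, subProducts, Matrix.cons_val, iDH,
      Algebra.algebraMap_eq_smul_one, mul_add, add_mul, smul_mul_assoc, mul_smul_comm, one_mul,
      mul_one, ← mul_assoc, haa, neg_mul]
    module
  have hj : ∀ j, (![Complex.I * m 0 - m 1, Complex.I * m 1 + m 0,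
      Complex.I * m 2 - m 4, Complex.I * m 3 - m 5, Complex.I * m 4 + m 2, Complex.I * m 5 + m 3,
      Complex.I * m 6 - m 7, Complex.I * m 7 + m 6] : Fin 8 → ℂ) j = 0 := by
    intro j
    have := congrArg (extFun Complex.ofRealHom (l j)) hz
    rw [hq, map_zero, map_sum] at this
    simp only [map_smul, a, b, c, toDHC, hl.extFun_subProducts, smul_eq_mul, mul_ite, mul_one,
      mul_zero, Finset.sum_ite_eq, Finset.mem_univ, if_true] at this
    exact this.symm
  have e0 : m 0 = -Complex.I * m 1 := by have := hj 1; simp at this; linear_combination this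
  have e2 : m 2 = -Complex.I * m 4 := by have := hj 4; simp at this; linear_combination this
  have e3 : m 3 = -Complex.I * m 5 := by have := hj 5; simp at this; linear_combination this
  have e6 : m 6 = -Complex.I * m 7 := by have := hj 7; simp at this; linear_combination this
  conv_lhs => rw [hsum]
  simp only [Fin.sum_univ_eight, subProducts, Matrix.cons_val, iDH, e0, e2, e3, e6,
      Algebra.algebraMap_eq_smul_one, mul_add, sub_mul, smul_mul_assoc, mul_smul_comm, one_mul,
      mul_one, ← mul_assoc]
  module

/-- The image of a generator in the quotient by the quad ideal has controlled coordinates. -/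
lemma IsDualSystem.apply_quad_relation {B : Type*} [CommRing B] (hl : IsDualSystem h₁ h₂ h₃ l)
    (ψ : ℂ →+* B) {r s t y x : B} {g : DH ℂ}
    (h : (scal r - mapDH (ψ.comp Complex.ofRealHom) h₁) * (scal s - mapDH (ψ.comp Complex.ofRealHom) h₂) *
        (scal t - mapDH (ψ.comp Complex.ofRealHom) h₃) =
      algebraMap B[ε] (DH B) (TrivSqZeroExt.inl y + TrivSqZeroExt.inr (y * x)) * mapDH ψ g)
    (j : Fin 8) :
    (![r * s * t, -(s * t), -(r * t), -(r * s), t, s, r, -1] : Fin 8 → B) j =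
      y * (ψ (extFun Complex.ofRealHom (l j) g) + x * ψ (extFun Complex.ofRealHom (l j) (epsDH ℂ * g))) := by
  rw [← hl.extFun_triple (ψ.comp Complex.ofRealHom), h, extFun_dual_mul]
  simp only [TrivSqZeroExt.fst_add, TrivSqZeroExt.fst_inl, TrivSqZeroExt.fst_inr,
    TrivSqZeroExt.snd_add, TrivSqZeroExt.snd_inl, TrivSqZeroExt.snd_inr]
  ring

-- Write `Lⱼ = pⱼ + x qⱼ`. The coordinates satisfy `-(t₂ t₃) = y L₁`, `t₃ = y L₄`, `t₂ = y L₅`, `-1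
-- = y L₇`, so `L₁ L₇ - L₄ L₅` lies in the elimination ideal. If that ideal is zero, this is an
-- identity of polynomials in `x`, and two products of linear forms agree only when their factors
-- match up to constants.
open Polynomial in
lemma IsDualSystem.linear_relation (hl : IsDualSystem h₁ h₂ h₃ l) {g : DH ℂ}
    (h0 : elimIdeal g h₁ h₂ h₃ h₄ = ⊥) :
    ∃ k : ℂ, (∀ q, q = g ∨ q = epsDH ℂ * g →
        extFun Complex.ofRealHom (l 5) q = k * extFun Complex.ofRealHom (l 7) q ∧ extFun Complex.ofRealHom (l 1) q = k * extFun Complex.ofRealHom (l 4) q) ∨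
      (∀ q, q = g ∨ q = epsDH ℂ * g →
        extFun Complex.ofRealHom (l 4) q = k * extFun Complex.ofRealHom (l 7) q ∧ extFun Complex.ofRealHom (l 1) q = k * extFun Complex.ofRealHom (l 5) q) := by
  set p : Fin 8 → ℂ := fun j => extFun Complex.ofRealHom (l j) g with hp
  set q : Fin 8 → ℂ := fun j => extFun Complex.ofRealHom (l j) (epsDH ℂ * g) with hq
  let J := quadIdeal g h₁ h₂ h₃ h₄
  let χ := Ideal.Quotient.mk J
  let ψ : ℂ →+* QuadRing ⧸ J := χ.comp MvPolynomial.C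
  have hk := ((quadIdeal_le_ker_iff χ g h₁ h₂ h₃ h₄ (ψ := ψ) rfl (f := ψ.comp Complex.ofRealHom) rfl).1
    (by rw [Ideal.mk_ker])).2
  have hrel := hl.apply_quad_relation ψ hk
  set x := χ (MvPolynomial.X 0)
  set y := χ (MvPolynomial.X 1)
  set s := χ (MvPolynomial.X 2)
  set t := χ (MvPolynomial.X 3)
  have r1 : -(s * t) = y * (ψ (p 1) + x * ψ (q 1)) := hrel 1
  have r4 : t = y * (ψ (p 4) + x * ψ (q 4)) := hrel 4
  have r5 : s = y * (ψ (p 5) + x * ψ (q 5)) := hrel 5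
  have r7 : -1 = y * (ψ (p 7) + x * ψ (q 7)) := hrel 7
  have hev : ∀ P : ℂ[X], χ (aeval (MvPolynomial.X 0 : QuadRing) P) = 0 → P = 0 := by
    intro P hP
    have : P ∈ elimIdeal g h₁ h₂ h₃ h₄ := by
      rw [elimIdeal, Ideal.mem_comap]
      exact Ideal.Quotient.eq_zero_iff_mem.1 hP
    rwa [h0, Ideal.mem_bot] at this
  have hC : ∀ z : ℂ, χ (algebraMap ℂ QuadRing z) = ψ z := fun z => rfl
  have h7 : ¬ (p 7 = 0 ∧ q 7 = 0) := by
    rintro ⟨hp7, hq7⟩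
    rw [hp7, hq7] at r7
    have := hev 1 (by
      rw [map_one, map_one]
      simp only [map_zero, mul_zero, add_zero] at r7
      linear_combination -r7)
    exact one_ne_zero this
  have hE := hev ((C (p 1) + X * C (q 1)) * (C (p 7) + X * C (q 7)) -
      (C (p 4) + X * C (q 4)) * (C (p 5) + X * C (q 5))) (by
    simp only [map_sub, map_mul, map_add, aeval_X, aeval_C, hC]
    change (ψ (p 1) + x * ψ (q 1)) * (ψ (p 7) + x * ψ (q 7)) -
      (ψ (p 4) + x * ψ (q 4)) * (ψ (p 5) + x * ψ (q 5)) = 0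
    generalize ψ (p 1) + x * ψ (q 1) = L1 at *
    generalize ψ (p 4) + x * ψ (q 4) = L4 at *
    generalize ψ (p 5) + x * ψ (q 5) = L5 at *
    generalize ψ (p 7) + x * ψ (q 7) = L7 at *
    -- The factor `y ^ 2` can be removed afterwards, because `-1 = y * L7` makes `y` a unit.
    have e : y ^ 2 * (L1 * L7 - L4 * L5) = 0 := by
      linear_combination (-(y * L7)) * r1 + (s * t) * r7 + s * r4 + y * L4 * r5
    have e7 : y ^ 2 * L7 ^ 2 = 1 := by linear_combination (1 - y * L7) * r7
    linear_combination L7 ^ 2 * e - (L1 * L7 - L4 * L5) * e7)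
  have hcoef : ∀ n, ((C (p 1) + X * C (q 1)) * (C (p 7) + X * C (q 7)) -
      (C (p 4) + X * C (q 4)) * (C (p 5) + X * C (q 5))).coeff n = 0 := by
    intro n; rw [hE, coeff_zero]
  have hexp : (C (p 1) + X * C (q 1)) * (C (p 7) + X * C (q 7)) -
      (C (p 4) + X * C (q 4)) * (C (p 5) + X * C (q 5)) =
      C (p 1 * p 7 - p 4 * p 5) + C (p 1 * q 7 + q 1 * p 7 - (p 4 * q 5 + q 4 * p 5)) * X +
        C (q 1 * q 7 - q 4 * q 5) * X ^ 2 := by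
    simp only [map_sub, map_add, map_mul]; ring
  rw [hexp] at hcoef
  have hquad : ∀ a b c : ℂ, (∀ n, (C a + C b * X + C c * X ^ 2).coeff n = 0) →
      a = 0 ∧ b = 0 ∧ c = 0 := by
    intro a b c h
    refine ⟨by simpa using h 0, ?_, ?_⟩
    · simpa [coeff_X, coeff_C, coeff_X_pow] using h 1
    · simpa [coeff_X, coeff_C] using h 2
  obtain ⟨c0, c1, c2⟩ := hquad _ _ _ hcoef
  obtain ⟨k, hk | hk⟩ := exists_const_of_linear_mul_eq (sub_eq_zero.1 c0) (sub_eq_zero.1 c1)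
    (sub_eq_zero.1 c2) h7
  · refine ⟨k, .inl ?_⟩
    rintro _ (rfl | rfl)
    exacts [⟨hk.1, hk.2.2.1⟩, ⟨hk.2.1, hk.2.2.2⟩]
  · refine ⟨k, .inr ?_⟩
    rintro _ (rfl | rfl)
    exacts [⟨hk.1, hk.2.2.1⟩, ⟨hk.2.1, hk.2.2.2⟩]

/-- If the elimination ideal vanished, `linear_relation` would factor `g` and `ε g` simultaneously,
either with common left part `-(i - h₁)(k + h₂)` or with common right factor `k + h₃`. The lemma on
nilpotent multipliers then forces `ε g = 0`, except when `k + h₃` is a zero divisor; in that case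
`h₃ = ± h₄`. Both conclusions are excluded. -/
lemma elimIdeal_ne_bot {g : DH ℂ} (hl : IsDualSystem h₁ h₂ h₃ l) (hh₁ : h₁ ^ 2 = -1)
    (hh₂ : h₂ ^ 2 = -1) (hh₃ : h₃ ^ 2 = -1) (hh₄ : h₄ ^ 2 = -1) (hne : h₃ ≠ h₄) (hne' : h₃ ≠ -h₄)
    (hg : IsGeneratorG g h₁ h₄) : elimIdeal g h₁ h₂ h₃ h₄ ≠ ⊥ := by
  intro h0
  have hεg := hg.epsDH_mul_ne_zero hh₁ hh₄
  have hεε : ∀ q, epsDH ℂ * (epsDH ℂ * q) = 0 := fun q => by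
    rw [← mul_assoc, epsDH_mul_epsDH, zero_mul]
  obtain ⟨hg1, hg4⟩ := (hg.mem_iff hh₁ g).2 ⟨1, by rw [map_one, one_mul]⟩
  obtain ⟨he1, he4⟩ := (hg.mem_iff hh₁ (epsDH ℂ * g)).2 ⟨ε, rfl⟩
  have eg := hl.eq_of_left_mul_eq_zero hh₁ hg1
  have ee := hl.eq_of_left_mul_eq_zero hh₁ he1
  have haa : toDHC h₁ * toDHC h₁ = -1 := by rw [← pow_two, toDHC_sq hh₁]
  have hbb : toDHC h₂ * toDHC h₂ = -1 := by rw [← pow_two, toDHC_sq hh₂]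
  have hcc : toDHC h₃ * toDHC h₃ = -1 := by rw [← pow_two, toDHC_sq hh₃]
  obtain ⟨k, hk | hk⟩ := hl.linear_relation h0
  · obtain ⟨k1, k2⟩ := hk _ (.inl rfl)
    obtain ⟨k3, k4⟩ := hk _ (.inr rfl)
    have hfac : ∀ u v : ℂ, -((iDH - toDHC h₁) * ((k * u) • 1 + u • toDHC h₂ +
        (k * v) • toDHC h₃ + v • (toDHC h₂ * toDHC h₃))) =
        (-((iDH - toDHC h₁) * (k • 1 + toDHC h₂))) * (u • 1 + v • toDHC h₃) := by
      intro u v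
      rw [neg_mul, mul_assoc]
      congr 2
      simp only [add_mul, mul_add, smul_mul_assoc, mul_smul_comm, one_mul, mul_one]
      module
    rw [k1, k2, hfac] at eg
    rw [k3, k4, hfac] at ee
    apply hεg
    conv_lhs => rw [eg]
    apply mul_mul_eq_zero_of_isotropic epsDH_mul_epsDH hcc
    exact (congrArg _ eg.symm).trans ee
  · obtain ⟨k1, k2⟩ := hk _ (.inl rfl)
    obtain ⟨k3, k4⟩ := hk _ (.inr rfl)
    set R₀ := k • 1 + toDHC h₃ with hR
    have hfac : ∀ u v : ℂ, -((iDH - toDHC h₁) * ((k * u) • 1 + (k * v) • toDHC h₂ +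
        u • toDHC h₃ + v • (toDHC h₂ * toDHC h₃))) =
        (-(iDH - toDHC h₁)) * (u • 1 + v • toDHC h₂) * R₀ := by
      intro u v
      rw [neg_mul, neg_mul, mul_assoc, hR]
      congr 2
      simp only [add_mul, mul_add, smul_mul_assoc, mul_smul_comm, one_mul, mul_one]
      module
    rw [k1, k2, hfac] at eg
    rw [k3, k4, hfac] at ee
    generalize extFun Complex.ofRealHom (l 5) g = u at *
    generalize extFun Complex.ofRealHom (l 7) g = v at *
    generalize extFun Complex.ofRealHom (l 5) (epsDH ℂ * g) = u' at *
    generalize extFun Complex.ofRealHom (l 7) (epsDH ℂ * g) = v' at *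
    set Q := -(iDH - toDHC h₁) with hQ
    by_cases hk1 : k ^ 2 = -1
    · have hN : ∀ q, q = g ∨ q = epsDH ℂ * g → q * (iDH - toDHC h₄) = 0 := by
        rintro _ (rfl | rfl)
        exacts [hg4, he4]
      -- Here `k + h₃` cannot be cancelled. Cramer's rule instead expresses `Q * R₀` and `Q * h₂ *
      -- R₀` through `g` and `ε g`, both of which `i - h₄` kills.
      have e1 : v' • g - v • (epsDH ℂ * g) = (u * v' - v * u') • (Q * R₀) := by
        conv_lhs => rw [ee, eg]
        simp only [add_mul, mul_add, smul_mul_assoc, mul_smul_comm, mul_one]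
        module
      have e2 : u • (epsDH ℂ * g) - u' • g = (u * v' - v * u') • (Q * toDHC h₂ * R₀) := by
        conv_lhs => rw [ee, eg]
        simp only [add_mul, mul_add, smul_mul_assoc, mul_smul_comm, mul_one]
        module
      have hdet : u * v' - v * u' ≠ 0 := by
        intro hd
        rw [hd, zero_smul] at e1 e2
        have f1 := congrArg (fun q => epsDH ℂ * q) e1
        have f2 := congrArg (fun q => epsDH ℂ * q) e2
        simp only [mul_sub, mul_smul_comm, hεε, smul_zero, sub_zero, zero_sub, mul_zero,
          neg_eq_zero] at f1 f2
        have hv := (smul_eq_zero.1 f1).resolve_right hεg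
        have hu := (smul_eq_zero.1 f2).resolve_right hεg
        apply hεg
        rw [ee, hv, hu]
        simp
      have z1 : (iDH - toDHC h₁) * (R₀ * (iDH - toDHC h₄)) = 0 := by
        have := congrArg (fun q => q * (iDH - toDHC h₄)) e1
        simp only [sub_mul _ _ (iDH - toDHC h₄), smul_mul_assoc, hN _ (.inl rfl),
          hN _ (.inr rfl), smul_zero, sub_zero] at this
        have := (smul_eq_zero.1 this.symm).resolve_left hdet
        rwa [hQ, neg_mul, neg_mul, neg_eq_zero, mul_assoc] at this
      have z2 : (iDH - toDHC h₁) * toDHC h₂ * (R₀ * (iDH - toDHC h₄)) = 0 := by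
        have := congrArg (fun q => q * (iDH - toDHC h₄)) e2
        simp only [sub_mul _ _ (iDH - toDHC h₄), smul_mul_assoc, hN _ (.inl rfl),
          hN _ (.inr rfl), smul_zero, sub_zero] at this
        have := (smul_eq_zero.1 this.symm).resolve_left hdet
        rwa [hQ, neg_mul, neg_mul, neg_mul, neg_eq_zero, mul_assoc _ R₀] at this
      have hcR : toDHC h₃ * (R₀ * (iDH - toDHC h₄)) = k • (R₀ * (iDH - toDHC h₄)) := by
        rw [← mul_assoc, ← smul_mul_assoc]
        congr 1
        simp only [hR, mul_add, mul_smul_comm, mul_one, hcc, smul_add, smul_smul]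
        match_scalars
        · rfl
        · linear_combination -hk1
      have hPa : (iDH - toDHC h₁) * toDHC h₁ = -Complex.I • (iDH - toDHC h₁) := by
        simp only [sub_mul, haa, iDH, Algebra.algebraMap_eq_smul_one, smul_mul_assoc, one_mul]
        match_scalars
        · ring
        · linear_combination Complex.I_mul_I
      have z1' := z1
      rw [← mul_assoc] at z1'
      -- Expand `z` in the subproducts: `h₁` is absorbed on the left as the scalar `-i`, `h₃` on the
      -- right as the scalar `k`, leaving only the cases `z = 1` and `z = h₂`.
      have hz : ∀ z, (iDH - toDHC h₁) * z * (R₀ * (iDH - toDHC h₄)) = 0 := by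
        intro z
        rw [← hl.sum_extFun Complex.ofRealHom z]
        change (iDH - toDHC h₁) * (∑ j, extFun Complex.ofRealHom (l j) z •
          subProducts (toDHC h₁) (toDHC h₂) (toDHC h₃) j) * (R₀ * (iDH - toDHC h₄)) = 0
        simp only [Fin.sum_univ_eight, subProducts, Matrix.cons_val, mul_add, add_mul _ _ (R₀ * _),
          mul_smul_comm, smul_mul_assoc, ← mul_assoc (iDH - toDHC h₁), hPa, mul_one, z1', z2,
          smul_zero, mul_assoc _ (toDHC h₃), hcR, add_zero]
      have hu : IsUnit (iDH - toDHC h₁).re := by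
        rw [Quaternion.re_sub, toDHC_re hh₁, sub_zero]
        exact isUnit_inl_I
      have := eq_zero_of_forall_mul_mul_eq_zero hu hz
      rw [hR, ← Algebra.algebraMap_eq_smul_one] at this
      rcases eq_or_eq_neg_of_mul_eq_zero hk1 this with h | h
      exacts [hne h, hne' h]
    · have hinv : R₀ * (k • 1 - toDHC h₃) = (k ^ 2 + 1) • 1 := by
        simp only [hR, add_mul, mul_sub, smul_mul_assoc, mul_smul_comm, one_mul, mul_one, hcc]
        match_scalars <;> ring
      have hk2 : k ^ 2 + 1 ≠ 0 := fun h => hk1 (by linear_combination h)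
      have hi : epsDH ℂ * (Q * (u • 1 + v • toDHC h₂)) = 0 := by
        apply mul_mul_eq_zero_of_isotropic epsDH_mul_epsDH hbb (α' := u') (β' := v')
        have := ee
        conv_lhs at this => rw [eg]
        have := congrArg (fun q => q * (k • 1 - toDHC h₃)) this
        simp only [mul_assoc, hinv, mul_smul_comm, mul_one] at this
        exact smul_right_injective _ hk2 this
      apply hεg
      rw [eg, ← mul_assoc, hi, zero_mul]

end Nonvanishing

/-! ### Norms of half chains and the closure relation -/

section ChainRelations

variable {B : Type*} [CommRing B]

/-- The image of a real line over an extension of the real numbers. -/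
structure IsLine (a : DH B) : Prop where
  sq : a ^ 2 = -1
  star_eq : star a = -a
  reFst_eq : reFst B a = 0

lemma isLine_mapDH (f : ℝ →+* B) {h : DH ℝ} (hh : h ^ 2 = -1) : IsLine (mapDH f h) where
  sq := by rw [pow_two, ← mapDH_mul, ← pow_two, hh, mapDH_neg, mapDH_one]
  star_eq := by rw [← mapDH_star, real_line_star hh, mapDH_neg]
  reFst_eq := by
    change (mapDH f h).re.fst = 0
    simp [real_line_pure hh]

variable {a b c : DH B} (ha : IsLine a) (hb : IsLine b) (hc : IsLine c) (r s t : B)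

include ha in
lemma IsLine.star_sub : star (scal r - a) = scal r + a := by
  rw [_root_.star_sub, star_scal, ha.star_eq, sub_neg_eq_add]

include ha in
lemma IsLine.star_add : star (scal r + a) = scal r - a := by
  rw [StarAddMonoid.star_add, star_scal, ha.star_eq, sub_eq_add_neg]

include ha hb hc in
lemma star_triple : star ((scal r - a) * (scal s - b) * (scal t - c)) =
    (scal t + c) * (scal s + b) * (scal r + a) := by
  rw [star_mul, star_mul, ha.star_sub, hb.star_sub, hc.star_sub, mul_assoc]

include ha hb hc in
lemma triple_mul_star : (scal r - a) * (scal s - b) * (scal t - c) *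
    star ((scal r - a) * (scal s - b) * (scal t - c)) =
      scal ((r ^ 2 + 1) * (s ^ 2 + 1) * (t ^ 2 + 1)) := by
  rw [star_triple ha hb hc]
  calc _ = (scal r - a) * ((scal s - b) * ((scal t - c) * (scal t + c)) * (scal s + b)) *
        (scal r + a) := by noncomm_ring
    _ = _ := by
      rw [scal_sub_mul_scal_add hc.sq, ← Algebra.commutes, mul_assoc (scal (t ^ 2 + 1)),
        scal_sub_mul_scal_add hb.sq, ← map_mul, ← Algebra.commutes, mul_assoc,
        scal_sub_mul_scal_add ha.sq, ← map_mul]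
      congr 1; ring

include ha hb hc in
lemma star_mul_triple : star ((scal r - a) * (scal s - b) * (scal t - c)) *
    ((scal r - a) * (scal s - b) * (scal t - c)) =
      scal ((r ^ 2 + 1) * (s ^ 2 + 1) * (t ^ 2 + 1)) := by
  rw [star_triple ha hb hc]
  calc _ = (scal t + c) * ((scal s + b) * ((scal r + a) * (scal r - a)) * (scal s - b)) *
        (scal t - c) := by noncomm_ring
    _ = _ := by
      rw [scal_add_mul_scal_sub ha.sq, ← Algebra.commutes, mul_assoc (scal (r ^ 2 + 1)),
        scal_add_mul_scal_sub hb.sq, ← map_mul, ← Algebra.commutes, mul_assoc,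
        scal_add_mul_scal_sub hc.sq, ← map_mul]

-- The product telescopes to `(s ^ 2 + 1)(t ^ 2 + 1)(1 + r a)`. No factor `r ^ 2 + 1` appears, so
-- this functional still detects the half chain where its norm vanishes.
include ha hb hc in
lemma reFst_triple : reFst B ((scal r - a) * (scal s - b) * (scal t - c) *
    ((scal t + c) * (scal s + b) * a)) = (s ^ 2 + 1) * (t ^ 2 + 1) := by
  have : (scal r - a) * (scal s - b) * (scal t - c) * ((scal t + c) * (scal s + b) * a) =
      ((s ^ 2 + 1) * (t ^ 2 + 1)) • (r • a + 1) := by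
    calc _ = (scal r - a) * ((scal s - b) * ((scal t - c) * (scal t + c)) * (scal s + b)) *
          a := by noncomm_ring
      _ = _ := by
        rw [scal_sub_mul_scal_add hc.sq, ← Algebra.commutes, mul_assoc (scal (t ^ 2 + 1)),
          scal_sub_mul_scal_add hb.sq, ← map_mul, ← Algebra.commutes, mul_assoc, sub_mul,
          ← pow_two a, ha.sq, sub_neg_eq_add, scal_mul_eq_smul, scal_mul_eq_smul, mul_comm (_ + _)]
  have h1 : reFst B (1 : DH B) = 1 := rfl
  rw [this, map_smul, map_add, map_smul, ha.reFst_eq, h1, smul_eq_mul, smul_zero, zero_add,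
    mul_one]

include ha hb hc in
lemma reFst_star_triple : reFst B ((a * (scal s - b) * (scal t - c)) *
    star ((scal r - a) * (scal s - b) * (scal t - c))) = -((s ^ 2 + 1) * (t ^ 2 + 1)) := by
  have : (a * (scal s - b) * (scal t - c)) * star ((scal r - a) * (scal s - b) * (scal t - c)) =
      ((s ^ 2 + 1) * (t ^ 2 + 1)) • (r • a - 1) := by
    rw [star_triple ha hb hc]
    calc _ = a * ((scal s - b) * ((scal t - c) * (scal t + c)) * (scal s + b)) *
          (scal r + a) := by noncomm_ring
      _ = _ := by
        rw [scal_sub_mul_scal_add hc.sq, ← Algebra.commutes, mul_assoc (scal (t ^ 2 + 1)),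
          scal_sub_mul_scal_add hb.sq, ← map_mul, ← Algebra.commutes, mul_assoc, mul_add a,
          ← pow_two a, ha.sq, ← sub_eq_add_neg, ← Algebra.commutes, scal_mul_eq_smul,
          scal_mul_eq_smul, mul_comm (_ + _)]
  have h1 : reFst B (1 : DH B) = 1 := rfl
  rw [this, map_smul, map_sub, map_smul, ha.reFst_eq, h1, smul_eq_mul, smul_zero, zero_sub,
    mul_neg, mul_one]

lemma smul_eq_smul_star_of_mul_eq_scal {X Y : DH B} {m r : B} (h : X * Y = scal r)
    (hY : Y * star Y = scal m) : m • X = r • star Y := by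
  rw [← scal_mul_eq_smul, ← scal_mul_eq_smul, ← h, mul_assoc, hY, Algebra.commutes]

lemma smul_star_eq_smul_of_mul_eq_scal {X Y : DH B} {m r : B} (h : X * Y = scal r)
    (hX : star X * X = scal m) : m • star Y = r • X := by
  have : m • Y = r • star X := by
    rw [← scal_mul_eq_smul, ← hX, mul_assoc, h, ← Algebra.commutes, scal_mul_eq_smul]
  have := congrArg star this
  rwa [← scal_mul_eq_smul, ← scal_mul_eq_smul, star_mul, star_mul, star_star, star_scal,
    star_scal, ← Algebra.commutes, ← Algebra.commutes, scal_mul_eq_smul,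
    scal_mul_eq_smul] at this

/-- On a closed linkage, near a point with `t₁ = I` and all other `t k ^ 2 + 1` controlled, the two
half chains agree up to a unit and `t₁ - I` divides `t₄ - I`. -/
lemma closed_chain_relations {a₁ a₂ a₃ a₄ a₅ a₆ : DH B} (h₁ : IsLine a₁) (h₂ : IsLine a₂)
    (h₃ : IsLine a₃) (h₄ : IsLine a₄) (h₅ : IsLine a₅) (h₆ : IsLine a₆)
    {t₁ t₂ t₃ t₄ t₅ t₆ r I : B} (hI : I ^ 2 = -1)
    (hclosed : ((scal t₁ - a₁) * (scal t₂ - a₂) * (scal t₃ - a₃)) *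
      ((scal t₄ - a₄) * (scal t₅ - a₅) * (scal t₆ - a₆)) = scal r)
    (hf : ∀ z, (t₁ - I) * z = 0 → z = 0) (u₁ : IsUnit (t₁ + I)) (u₄ : IsUnit (t₄ + I))
    (u₂ : IsUnit (t₂ ^ 2 + 1)) (u₃ : IsUnit (t₃ ^ 2 + 1)) (u₅ : IsUnit (t₅ ^ 2 + 1))
    (u₆ : IsUnit (t₆ ^ 2 + 1)) :
    (t₁ - I ∣ t₄ - I) ∧ ∃ w : Bˣ, (scal t₁ - a₁) * (scal t₂ - a₂) * (scal t₃ - a₃) =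
      (w : B) • star ((scal t₄ - a₄) * (scal t₅ - a₅) * (scal t₆ - a₆)) := by
  set X := (scal t₁ - a₁) * (scal t₂ - a₂) * (scal t₃ - a₃) with hX
  set Y := (scal t₄ - a₄) * (scal t₅ - a₅) * (scal t₆ - a₆) with hY
  have hXX := star_mul_triple h₁ h₂ h₃ t₁ t₂ t₃
  have hYY := triple_mul_star h₄ h₅ h₆ t₄ t₅ t₆
  rw [← hX] at hXX
  rw [← hY] at hYY
  have e1 := smul_eq_smul_star_of_mul_eq_scal hclosed hYY
  have e2 := smul_star_eq_smul_of_mul_eq_scal hclosed hXX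
  -- `L` is a unit on `X` and `L'` is a unit on `star Y`; applied to the norm relations they show
  -- how far `r` is divisible by `t₁ - I`.
  let L : DH B →ₗ[B] B := reFst B ∘ₗ LinearMap.mulRight B ((scal t₃ + a₃) * (scal t₂ + a₂) * a₁)
  let L' : DH B →ₗ[B] B := reFst B ∘ₗ LinearMap.mulLeft B (a₄ * (scal t₅ - a₅) * (scal t₆ - a₆))
  have hL : L X = (t₂ ^ 2 + 1) * (t₃ ^ 2 + 1) := reFst_triple h₁ h₂ h₃ t₁ t₂ t₃
  have hL' : L' (star Y) = -((t₅ ^ 2 + 1) * (t₆ ^ 2 + 1)) := reFst_star_triple h₄ h₅ h₆ t₄ t₅ t₆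
  have f1 := congrArg L e1
  have f2 := congrArg L e2
  have f3 := congrArg L' e2
  simp only [map_smul, smul_eq_mul, hL, hL'] at f1 f2 f3
  obtain ⟨v₁, hv₁⟩ := u₁
  obtain ⟨v₂, hv₂⟩ := u₂
  obtain ⟨v₃, hv₃⟩ := u₃
  obtain ⟨v₄, hv₄⟩ := u₄
  obtain ⟨v₅, hv₅⟩ := u₅
  obtain ⟨v₆, hv₆⟩ := u₆
  rw [← hv₂, ← hv₃] at f1 f2 f3
  rw [← hv₅, ← hv₆] at f1 f3
  have g1 : t₁ ^ 2 + 1 = (t₁ - I) * v₁ := by rw [hv₁]; linear_combination hI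
  have g4 : t₄ ^ 2 + 1 = (t₄ - I) * v₄ := by rw [hv₄]; linear_combination hI
  rw [← hv₂, ← hv₃, g1] at e2
  rw [g1] at f2 f3
  rw [g4] at f1
  set c : B := v₁ * L (star Y) with hcdef
  have hr : r = (t₁ - I) * c := by
    have : (v₂ * v₃ : B) * r = (v₂ * v₃ : B) * ((t₁ - I) * c) := by
      rw [hcdef]; linear_combination -f2
    exact (v₂ * v₃).isUnit.mul_left_cancel (by simpa using this)
  -- Applying `L'` bounds the divisibility from the other side: `r` is `t₁ - I` times a unit `c`.
  have hcu : c * (-(L' X)) = v₁ * v₂ * v₃ * v₅ * v₆ := by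
    rw [← sub_eq_zero]
    apply hf
    rw [hr] at f3
    linear_combination f3
  have hcunit : IsUnit c := by
    refine isUnit_of_mul_isUnit_left (y := -(L' X)) ?_
    rw [hcu]
    exact (v₁ * v₂ * v₃ * v₅ * v₆).isUnit
  refine ⟨?_, ?_⟩
  · have hd : (t₁ - I) ∣ (t₄ - I) * ((v₄ * v₅ * v₆ * v₂ * v₃ : Bˣ) : B) := by
      refine ⟨c * L (star Y), ?_⟩
      rw [hr] at f1
      push_cast
      linear_combination f1
    exact (Units.dvd_mul_right).1 hd
  · obtain ⟨cu, hcu'⟩ := hcunit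
    refine ⟨cu⁻¹ * (v₁ * v₂ * v₃), ?_⟩
    have hcancel : ∀ q : DH B, (t₁ - I) • q = 0 → q = 0 := by
      intro q hq
      rw [← (coordEquiv B).map_eq_zero_iff]
      ext k
      apply hf
      have := congrFun (congrArg (coordEquiv B) hq) k
      simpa using this
    have hfin : (v₁ * v₂ * v₃ : B) • star Y = (cu : B) • X := by
      rw [← sub_eq_zero]
      apply hcancel
      rw [smul_sub, smul_smul, smul_smul, hcu', ← hr, ← e2, sub_eq_zero]
      congr 1; ring
    rw [Units.val_mul, mul_smul]
    push_cast
    rw [hfin, smul_smul, Units.inv_mul, one_smul]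

end ChainRelations

/-! ### Extension of scalars for the module `G` -/

section BaseChange

variable {B : Type*} [CommRing B] [Algebra ℂ B]

/-- A linear function applied to the coordinates of a dual quaternion. -/
def mapLin (l : B →ₗ[ℂ] ℂ) (q : DH B) : DH ℂ :=
  ⟨(l q.re.fst, l q.re.snd), (l q.imI.fst, l q.imI.snd), (l q.imJ.fst, l q.imJ.snd),
    (l q.imK.fst, l q.imK.snd)⟩

variable (l : B →ₗ[ℂ] ℂ) (q : DH B)

@[simp] lemma mapLin_re_fst : (mapLin l q).re.fst = l q.re.fst := rfl
@[simp] lemma mapLin_imI_fst : (mapLin l q).imI.fst = l q.imI.fst := rfl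
@[simp] lemma mapLin_imJ_fst : (mapLin l q).imJ.fst = l q.imJ.fst := rfl
@[simp] lemma mapLin_imK_fst : (mapLin l q).imK.fst = l q.imK.fst := rfl
@[simp] lemma mapLin_re_snd : (mapLin l q).re.snd = l q.re.snd := rfl
@[simp] lemma mapLin_imI_snd : (mapLin l q).imI.snd = l q.imI.snd := rfl
@[simp] lemma mapLin_imJ_snd : (mapLin l q).imJ.snd = l q.imJ.snd := rfl
@[simp] lemma mapLin_imK_snd : (mapLin l q).imK.snd = l q.imK.snd := rfl

lemma mapLin_zero : mapLin l 0 = 0 := by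
  apply DH.ext_coords <;> simp

lemma mapLin_mapDH_mul (p : DH ℂ) : mapLin l (mapDH (algebraMap ℂ B) p * q) = p * mapLin l q := by
  have h : ∀ (c : ℂ) (b : B), l (b * algebraMap ℂ B c) = c * l b := fun c b => by
    rw [mul_comm, ← Algebra.smul_def, map_smul, smul_eq_mul]
  apply DH.ext_coords <;> simp [h, mul_comm] <;> ring

lemma mapLin_mul_mapDH (p : DH ℂ) : mapLin l (q * mapDH (algebraMap ℂ B) p) = mapLin l q * p := by
  have h : ∀ (c : ℂ) (b : B), l (b * algebraMap ℂ B c) = l b * c := fun c b => by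
    rw [mul_comm, ← Algebra.smul_def, map_smul, smul_eq_mul, mul_comm]
  apply DH.ext_coords <;> simp [h, mul_comm] <;> ring

lemma coordEquiv_mapLin (k : Fin 8) : coordEquiv ℂ (mapLin l q) k = l (coordEquiv B q k) := by
  rw [coordEquiv_apply, coordEquiv_apply]
  fin_cases k <;> rfl

lemma exists_sum_mapLin {ι : Type*} (b : Module.Basis ι ℂ B) :
    ∃ T : Finset ι, ∑ j ∈ T, b j • mapDH (algebraMap ℂ B) (mapLin (b.coord j) q) = q := by
  classical
  refine ⟨Finset.univ.biUnion fun k => (b.repr (coordEquiv B q k)).support, ?_⟩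
  apply (coordEquiv B).injective
  rw [map_sum]
  ext k
  simp only [Finset.sum_apply, map_smul, Pi.smul_apply, coordEquiv_mapDH, coordEquiv_mapLin,
    Module.Basis.coord_apply, smul_eq_mul]
  conv_rhs => rw [← b.linearCombination_repr (coordEquiv B q k), Finsupp.linearCombination_apply]
  rw [Finsupp.sum_of_support_subset _ (Finset.subset_biUnion_of_mem
    (fun k => (b.repr (coordEquiv B q k)).support) (Finset.mem_univ k))]
  · refine Finset.sum_congr rfl fun j _ => ?_
    rw [Algebra.smul_def, mul_comm]
  · simp

/-- The module `G` of a generator is compatible with extension of scalars. -/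
lemma IsGeneratorG.exists_dual_mul {g : DH ℂ} {h₁ h₄ : DH ℝ} (hg : IsGeneratorG g h₁ h₄)
    (hh₁ : h₁ ^ 2 = -1) {q : DH B}
    (hl : mapDH (algebraMap ℂ B) (iDH + toDHC h₁) * q = 0)
    (hr : q * mapDH (algebraMap ℂ B) (iDH - toDHC h₄) = 0) :
    ∃ d : B[ε], q = algebraMap B[ε] (DH B) d * mapDH (algebraMap ℂ B) g := by
  -- The defining equations of `G` have coefficients in `ℂ`, so each component of `q` in a `ℂ`-basis
  -- of `B` satisfies them separately.
  let b := Module.Free.chooseBasis ℂ B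
  obtain ⟨T, hT⟩ := exists_sum_mapLin q b
  have hm : ∀ j, ∃ d : ℂ[ε], algebraMap ℂ[ε] (DH ℂ) d * g = mapLin (b.coord j) q := by
    intro j
    rw [← hg.mem_iff hh₁]
    constructor
    · rw [← mapLin_mapDH_mul, hl, mapLin_zero]
    · rw [← mapLin_mul_mapDH, hr, mapLin_zero]
  choose d hd using hm
  refine ⟨∑ j ∈ T, algebraMap B B[ε] (b j) * mapDual (algebraMap ℂ B) (d j), ?_⟩
  conv_lhs => rw [← hT]
  rw [map_sum, Finset.sum_mul]
  refine Finset.sum_congr rfl fun j _ => ?_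
  rw [← hd, mapDH_mul, mapDH_dual, map_mul, mul_assoc, Algebra.smul_def]
  rfl

end BaseChange

/-! ### Algebras generated by a root of a polynomial -/

section QuotientBound

/-- A finite algebra over a field is Artinian, so an element that is regular because it is
invertible in the larger ring has its inverse already in the subalgebra. -/
lemma Subalgebra.mem_of_mul_eq_one {k R : Type*} [Field k] [CommRing R] [Algebra k R]
    (S : Subalgebra k R) [Module.Finite k S] {u v : R} (hu : u ∈ S) (h : u * v = 1) : v ∈ S := by
  have : IsArtinianRing S := IsArtinianRing.of_finite k S
  have hnz : (⟨u, hu⟩ : S) ∈ nonZeroDivisors S := by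
    rw [mem_nonZeroDivisors_iff_right]
    intro z hz
    have hz' : (z : R) * u = 0 := congrArg Subtype.val hz
    apply Subtype.ext
    calc (z : R) = z * u * v := by rw [mul_assoc, h, mul_one]
      _ = 0 := by rw [hz', zero_mul]
  obtain ⟨w, hw⟩ := IsArtinianRing.isUnit_of_mem_nonZeroDivisors hnz
  have h2 : u * ((w⁻¹ : Sˣ) : S) = 1 := by
    have := congrArg Subtype.val w.mul_inv
    rwa [hw] at this
  have : v = ((w⁻¹ : Sˣ) : S) := by
    calc v = u * ((w⁻¹ : Sˣ) : S) * v := by rw [h2, one_mul]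
      _ = (u * v) * ((w⁻¹ : Sˣ) : S) := by ring
      _ = _ := by rw [h, one_mul]
  rw [this]
  exact Subtype.property _

lemma finrank_le_of_adjoin_eq_top {k R : Type*} [Field k] [CommRing R] [Algebra k R] {x : R}
    (hx : Algebra.adjoin k {x} = ⊤) {P : Polynomial k} (hP : P ≠ 0)
    (h : Polynomial.aeval x P = 0) : Module.Finite k R ∧ Module.finrank k R ≤ P.natDegree := by
  have hs : Function.Surjective ((Polynomial.aeval x).toLinearMap ∘ₗ
      (Polynomial.degreeLT k P.natDegree).subtype) := by
    intro r
    have hr : r ∈ Algebra.adjoin k {x} := by rw [hx]; trivial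
    rw [Algebra.adjoin_singleton_eq_range_aeval] at hr
    obtain ⟨p, rfl⟩ := hr
    refine ⟨⟨p % P, ?_⟩, ?_⟩
    · rw [Polynomial.mem_degreeLT, ← Polynomial.degree_eq_natDegree hP]
      exact EuclideanDomain.mod_lt p hP
    · conv_rhs => rw [← EuclideanDomain.mod_add_div p P]
      simp [h]
  have : Module.Finite k (Polynomial.degreeLT k P.natDegree) :=
    Module.Finite.equiv (Polynomial.degreeLTEquiv k P.natDegree).symm
  refine ⟨Module.Finite.of_surjective _ hs, ?_⟩
  refine (LinearMap.finrank_le_finrank_of_surjective hs).trans ?_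
  rw [(Polynomial.degreeLTEquiv k P.natDegree).finrank_eq]
  simp

lemma aeval_quadPolyWith {B : Type*} [CommRing B] [Algebra ℂ B] (χ : QuadRing →ₐ[ℂ] B) {g : DH ℂ}
    {h₁ h₂ h₃ h₄ : DH ℝ} (h : quadIdeal g h₁ h₂ h₃ h₄ ≤ RingHom.ker (χ : QuadRing →+* B)) :
    Polynomial.aeval (χ (MvPolynomial.X 0)) (quadPolyWith g h₁ h₂ h₃ h₄) = 0 := by
  have hmem : quadPolyWith g h₁ h₂ h₃ h₄ ∈ elimIdeal g h₁ h₂ h₃ h₄ := by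
    exact Ideal.mem_of_dvd _ (normalize_associated _).symm.dvd
      (Submodule.IsPrincipal.generator_mem _)
  have := h hmem
  rw [RingHom.mem_ker] at this
  rw [Polynomial.aeval_algHom_apply]
  exact this

lemma quadPolyWith_ne_zero {g : DH ℂ} {h₁ h₂ h₃ h₄ : DH ℝ}
    (h : elimIdeal g h₁ h₂ h₃ h₄ ≠ ⊥) : quadPolyWith g h₁ h₂ h₃ h₄ ≠ 0 := by
  rw [quadPolyWith, Ne, normalize_eq_zero, ← Submodule.IsPrincipal.eq_bot_iff_generator_eq_zero]
  exact h

end QuotientBound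

/-! ### The fibre is generated by `x` -/

section FibreBound

variable {B : Type*} [CommRing B] [Algebra ℂ B]

lemma mapDH_iDH_add (h : DH ℝ) : mapDH (algebraMap ℂ B) (iDH + toDHC h) =
    scal (algebraMap ℂ B Complex.I) + mapDH ((algebraMap ℂ B).comp Complex.ofRealHom) h := by
  rw [mapDH_add, iDH, mapDH_algebraMap, toDHC, mapDH_mapDH]

lemma mapDH_iDH_sub (h : DH ℝ) : mapDH (algebraMap ℂ B) (iDH - toDHC h) =
    scal (algebraMap ℂ B Complex.I) - mapDH ((algebraMap ℂ B).comp Complex.ofRealHom) h := by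
  rw [mapDH_sub, iDH, mapDH_algebraMap, toDHC, mapDH_mapDH]

/-- The entry `-1` says that `-y` is inverse to an affine function of `x`. Finiteness of the
subalgebra places `y` in it, and then all other entries. -/
lemma mem_adjoin_of_quad_relation {x y : B} [Module.Finite ℂ (Algebra.adjoin ℂ {x})]
    {c : Fin 8 → B} {p q : Fin 8 → ℂ}
    (h : ∀ j, c j = y * (algebraMap ℂ B (p j) + x * algebraMap ℂ B (q j))) (h7 : c 7 = -1)
    (j : Fin 8) : c j ∈ Algebra.adjoin ℂ {x} := by
  have hx : x ∈ Algebra.adjoin ℂ {x} := Algebra.subset_adjoin rfl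
  have hL : ∀ j, algebraMap ℂ B (p j) + x * algebraMap ℂ B (q j) ∈ Algebra.adjoin ℂ {x} :=
    fun j => add_mem (Subalgebra.algebraMap_mem _ _)
      (mul_mem hx (Subalgebra.algebraMap_mem _ _))
  have hy : -y ∈ Algebra.adjoin ℂ {x} := by
    refine Subalgebra.mem_of_mul_eq_one _ (hL 7) ?_
    have := h 7
    rw [h7] at this
    linear_combination this
  rw [h]
  exact mul_mem (by simpa using neg_mem hy) (hL j)

/-- The scheme of pairs of half chains over `t₁ = t₄ = i` is finite and its length is bounded by
the degree of the greatest common divisor of the quad polynomials. -/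
theorem finrank_le_natDegree_gcd {h₁ h₂ h₃ h₄ h₅ h₆ : DH ℝ} (hh₁ : h₁ ^ 2 = -1)
    (hh₂ : h₂ ^ 2 = -1) (hh₃ : h₃ ^ 2 = -1) (hh₄ : h₄ ^ 2 = -1) (hh₅ : h₅ ^ 2 = -1)
    (hh₆ : h₆ ^ 2 = -1) (hne : h₃ ≠ h₄) (hne' : h₃ ≠ -h₄)
    (hl : LinearIndependent ℝ (subProducts h₁ h₂ h₃))
    (hl' : LinearIndependent ℝ (subProducts h₆ h₅ h₄)) {g : DH ℂ} (hg : IsGeneratorG g h₁ h₄)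
    {t₂ t₃ t₅ t₆ e D : B} (u₂ : IsUnit (t₂ ^ 2 + 1)) (u₃ : IsUnit (t₃ ^ 2 + 1))
    {I : B} (hI : I = algebraMap ℂ B Complex.I)
    {a₁ a₂ a₃ a₄ a₅ a₆ : DH B} (ha₁ : a₁ = mapDH ((algebraMap ℂ B).comp Complex.ofRealHom) h₁)
    (ha₂ : a₂ = mapDH ((algebraMap ℂ B).comp Complex.ofRealHom) h₂) (ha₃ : a₃ = mapDH ((algebraMap ℂ B).comp Complex.ofRealHom) h₃)
    (ha₄ : a₄ = mapDH ((algebraMap ℂ B).comp Complex.ofRealHom) h₄) (ha₅ : a₅ = mapDH ((algebraMap ℂ B).comp Complex.ofRealHom) h₅)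
    (ha₆ : a₆ = mapDH ((algebraMap ℂ B).comp Complex.ofRealHom) h₆) (w : Bˣ)
    (hw : (scal I - a₁) * (scal t₂ - a₂) * (scal t₃ - a₃) =
      (w : B) • star ((scal I - a₄) * (scal t₅ - a₅) * (scal t₆ - a₆)))
    (hD : D ∈ Algebra.adjoin ℂ {t₂, t₃, t₅, t₆}) (he : D * e = 1)
    (hgen : Algebra.adjoin ℂ {t₂, t₃, t₅, t₆, e} = ⊤) :
    Module.Finite ℂ B ∧ Module.finrank ℂ B ≤
      (EuclideanDomain.gcd (quadPolyWith g h₁ h₂ h₃ h₄)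
        (quadPolyWith (star g) h₄ h₅ h₆ h₁)).natDegree := by
  obtain ⟨l, hl⟩ := exists_isDualSystem hl
  obtain ⟨l', hl'⟩ := exists_isDualSystem hl'
  have la₁ : IsLine a₁ := ha₁ ▸ isLine_mapDH _ hh₁
  have la₂ : IsLine a₂ := ha₂ ▸ isLine_mapDH _ hh₂
  have la₃ : IsLine a₃ := ha₃ ▸ isLine_mapDH _ hh₃
  have la₄ : IsLine a₄ := ha₄ ▸ isLine_mapDH _ hh₄
  have la₅ : IsLine a₅ := ha₅ ▸ isLine_mapDH _ hh₅
  have la₆ : IsLine a₆ := ha₆ ▸ isLine_mapDH _ hh₆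
  have hI2 : I ^ 2 + 1 = 0 := by
    rw [hI, ← map_pow, Complex.I_sq, map_neg, map_one, neg_add_cancel]
  have hpm : ∀ {a : DH B}, IsLine a → (scal I + a) * (scal I - a) = 0 := fun ha => by
    rw [scal_add_mul_scal_sub ha.sq, hI2]; exact map_zero (algebraMap B (DH B))
  have hL : reFst B ((scal I - a₁) * (scal t₂ - a₂) * (scal t₃ - a₃) *
    ((scal t₃ + a₃) * (scal t₂ + a₂) * a₁)) = (t₂ ^ 2 + 1) * (t₃ ^ 2 + 1) :=
    reFst_triple la₁ la₂ la₃ I t₂ t₃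
  have hst := star_triple la₄ la₅ la₆ I t₅ t₆
  set X := (scal I - a₁) * (scal t₂ - a₂) * (scal t₃ - a₃) with hX
  set Y := (scal I - a₄) * (scal t₅ - a₅) * (scal t₆ - a₆) with hY
  have hX1 : (scal I + a₁) * X = 0 := by
    rw [hX, ← mul_assoc, ← mul_assoc, hpm la₁, zero_mul, zero_mul]
  have hX4 : X * (scal I - a₄) = 0 := by
    rw [hw, hst, smul_mul_assoc, mul_assoc, hpm la₄, mul_zero, smul_zero]
  obtain ⟨d, hd⟩ := hg.exists_dual_mul (B := B) hh₁ (q := X)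
    (by rw [mapDH_iDH_add, ← hI, ← ha₁, hX1]) (by rw [mapDH_iDH_sub, ← hI, ← ha₄, hX4])
  rw [hd, mul_assoc, reFst_dual_mul] at hL
  -- The functional is a unit on `X` and sees only the primal part of `d`, so `d` can be written as
  -- `y (1 + x ε)` with `y` a unit.
  have hdu : IsUnit d.fst := isUnit_of_mul_isUnit_left (hL ▸ u₂.mul u₃)
  obtain ⟨y, hy⟩ := hdu
  set x : B := ↑y⁻¹ * d.snd with hxdef
  have hdx : d = TrivSqZeroExt.inl (y : B) + TrivSqZeroExt.inr ((y : B) * x) := by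
    ext
    · simp [hy]
    · simp [hxdef]
  rw [hdx] at hd
  have hYd : Y = algebraMap B[ε] (DH B) (TrivSqZeroExt.inl ((w⁻¹ * y : Bˣ) : B) +
      TrivSqZeroExt.inr (((w⁻¹ * y : Bˣ) : B) * x)) * mapDH (algebraMap ℂ B) (star g) := by
    have h1 : star X = (w : B) • Y := by
      rw [hw, ← scal_mul_eq_smul, ← scal_mul_eq_smul]
      conv_lhs => rw [StarMul.star_mul, star_star, star_scal, ← Algebra.commutes]
    have h2 : Y = (↑w⁻¹ : B) • star X := by rw [h1, smul_smul, Units.inv_mul, one_smul]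
    rw [h2, hd, StarMul.star_mul, star_dual, mapDH_star, ← Algebra.commutes, ← scal_mul_eq_smul,
      ← mul_assoc]
    congr 1
    change algebraMap B[ε] (DH B) (TrivSqZeroExt.inl _) * _ = _
    rw [← map_mul]
    congr 1
    ext
    · simp
    · simp [mul_assoc]
  have hY1 : Y * (scal I - a₁) = 0 := by
    have h1 : star X * (scal I - a₁) = 0 := by
      have := congrArg star hX1
      rw [StarMul.star_mul, la₁.star_add, star_zero] at this
      exact this
    have h2 : star X = (w : B) • Y := by
      rw [hw, ← scal_mul_eq_smul, ← scal_mul_eq_smul]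
      conv_lhs => rw [StarMul.star_mul, star_star, star_scal, ← Algebra.commutes]
    rw [h2, smul_mul_assoc] at h1
    simpa [smul_smul] using congrArg (fun q => (↑w⁻¹ : B) • q) h1
  let χ : QuadRing →ₐ[ℂ] B := MvPolynomial.aeval ![x, (y : B), t₂, t₃]
  let χ' : QuadRing →ₐ[ℂ] B := MvPolynomial.aeval ![x, ((w⁻¹ * y : Bˣ) : B), t₅, t₆]
  have hχC : (χ : QuadRing →+* B).comp MvPolynomial.C = algebraMap ℂ B := χ.comp_algebraMap
  have hχC' : (χ' : QuadRing →+* B).comp MvPolynomial.C = algebraMap ℂ B := χ'.comp_algebraMap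
  have x0 : χ (MvPolynomial.X 0) = x := by simp [χ]
  have x1 : χ (MvPolynomial.X 1) = y := by simp [χ]
  have x2 : χ (MvPolynomial.X 2) = t₂ := by simp [χ]
  have x3 : χ (MvPolynomial.X 3) = t₃ := by simp [χ]
  have x0' : χ' (MvPolynomial.X 0) = x := by simp [χ']
  have x1' : χ' (MvPolynomial.X 1) = ((w⁻¹ * y : Bˣ) : B) := by simp [χ']
  have x2' : χ' (MvPolynomial.X 2) = t₅ := by simp [χ']
  have x3' : χ' (MvPolynomial.X 3) = t₆ := by simp [χ']
  have hQ : Polynomial.aeval x (quadPolyWith g h₁ h₂ h₃ h₄) = 0 := by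
    rw [← x0]
    apply aeval_quadPolyWith
    rw [quadIdeal_le_ker_iff _ _ _ _ _ _ hχC rfl]
    simp only [RingHom.coe_coe, x0, x1, x2, x3, ← ha₁, ← ha₂, ← ha₃, ← ha₄, ← hI, ← hX]
    exact ⟨hX4, hd⟩
  have hQ' : Polynomial.aeval x (quadPolyWith (star g) h₄ h₅ h₆ h₁) = 0 := by
    rw [← x0']
    apply aeval_quadPolyWith
    rw [quadIdeal_le_ker_iff _ _ _ _ _ _ hχC' rfl]
    simp only [RingHom.coe_coe, x0', x1', x2', x3', ← ha₁, ← ha₅, ← ha₆, ← ha₄, ← hI, ← hY]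
    exact ⟨hY1, hYd⟩
  set P := EuclideanDomain.gcd (quadPolyWith g h₁ h₂ h₃ h₄) (quadPolyWith (star g) h₄ h₅ h₆ h₁)
  have hP : Polynomial.aeval x P = 0 := by
    rw [show P = _ from EuclideanDomain.gcd_eq_gcd_ab _ _, map_add, map_mul, map_mul, hQ, hQ',
      zero_mul, zero_mul, add_zero]
  have hP0 : P ≠ 0 := fun h0 =>
    quadPolyWith_ne_zero (elimIdeal_ne_bot hl hh₁ hh₂ hh₃ hh₄ hne hne' hg)
      (EuclideanDomain.gcd_eq_zero_iff.1 h0).1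
  have hint : IsIntegral ℂ x := isAlgebraic_iff_isIntegral.1 ⟨P, hP0, hP⟩
  have hfin : Module.Finite ℂ (Algebra.adjoin ℂ {x}) := by
    have := hint.fg_adjoin_singleton
    exact Module.Finite.iff_fg.2 this
  have hrel := hl.apply_quad_relation (algebraMap ℂ B) (r := I) (s := t₂) (t := t₃) (y := y)
    (x := x) (g := g) (by rw [← ha₁, ← ha₂, ← ha₃]; exact hd)
  -- Conjugation reverses the second half chain and turns each `t - h` into `t + h`. Negating the
  -- three parameters restores the form `t - h` at the cost of an overall sign, so the basis of `h₆,
  -- h₅, h₄` applies with the original `g`.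
  have hrel' := hl'.apply_quad_relation (algebraMap ℂ B) (r := -t₆) (s := -t₅) (t := -I)
    (y := -((w⁻¹ * y : Bˣ) : B)) (x := x) (g := g) (by
      rw [← ha₆, ← ha₅, ← ha₄]
      have h1 : (scal (-t₆) - a₆) * (scal (-t₅) - a₅) * (scal (-I) - a₄) = -star Y := by
        have hn : ∀ z : B, (scal (-z) : DH B) = -scal z := map_neg (algebraMap B (DH B))
        rw [hst, hn, hn, hn]; noncomm_ring
      rw [h1, hYd, StarMul.star_mul, star_dual, ← mapDH_star, star_star, ← Algebra.commutes,
        ← neg_mul, ← map_neg]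
      congr 2
      ext <;> simp)
  have hm := mem_adjoin_of_quad_relation hrel rfl
  have hm' := mem_adjoin_of_quad_relation hrel' rfl
  have m2 : t₂ ∈ Algebra.adjoin ℂ {x} := hm 5
  have m3 : t₃ ∈ Algebra.adjoin ℂ {x} := hm 4
  have m5 : t₅ ∈ Algebra.adjoin ℂ {x} := neg_mem_iff.1 (hm' 5)
  have m6 : t₆ ∈ Algebra.adjoin ℂ {x} := neg_mem_iff.1 (hm' 6)
  have mD : D ∈ Algebra.adjoin ℂ {x} := by
    refine Algebra.adjoin_le ?_ hD
    rintro _ (rfl | rfl | rfl | rfl) <;> assumption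
  have me : e ∈ Algebra.adjoin ℂ {x} := Subalgebra.mem_of_mul_eq_one _ mD he
  have htop : Algebra.adjoin ℂ {x} = ⊤ := by
    rw [eq_top_iff, ← hgen]
    refine Algebra.adjoin_le ?_
    rintro _ (rfl | rfl | rfl | rfl | rfl) <;> assumption
  exact finrank_le_of_adjoin_eq_top htop hP0 hP

end FibreBound

/-! ### Length of a fibre on a curve and on its overrings -/

section LengthComparison

/-- The cokernels of compatible injective endomorphisms of two commensurable vector spaces have the
same length. -/
lemma length_coker_eq {k B M : Type*} [Field k] [AddCommGroup B] [Module k B] [AddCommGroup M]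
    [Module k M] (i : B →ₗ[k] M) (hi : Function.Injective i) (u : B →ₗ[k] B) (v : M →ₗ[k] M)
    (hv : Function.Injective v) (huv : v ∘ₗ i = i ∘ₗ u)
    [Module.Finite k (M ⧸ LinearMap.range i)] :
    Module.length k (M ⧸ LinearMap.range v) = Module.length k (B ⧸ LinearMap.range u) := by
  have huv' : ∀ b, v (i b) = i (u b) := fun b => LinearMap.congr_fun huv b
  -- The length of `M / v i B` is computed through `i B = im i` and through `v M`. Injectivity gives
  -- `M / i B ≅ v M / v i B`, and this common finite length cancels.
  let R := LinearMap.range (v ∘ₗ i)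
  have hR1 : R ≤ LinearMap.range v := LinearMap.range_comp_le_range i v
  have hR2 : R ≤ LinearMap.range i := by
    rintro _ ⟨b, rfl⟩
    exact ⟨u b, (huv' b).symm⟩
  have e1 := Module.length_eq_add_of_exact
    (Submodule.mapQ (LinearMap.range u) R i (by
      rintro _ ⟨b, rfl⟩
      exact ⟨b, huv' b⟩))
    (Submodule.factor hR2) (by
      rw [← LinearMap.ker_eq_bot, LinearMap.ker_eq_bot']
      intro q
      obtain ⟨b, rfl⟩ := Submodule.Quotient.mk_surjective _ q
      intro h
      rw [Submodule.mapQ_apply, Submodule.Quotient.mk_eq_zero] at h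
      obtain ⟨b', hb'⟩ := h
      rw [Submodule.Quotient.mk_eq_zero]
      exact ⟨b', hi (by rw [← huv', ← hb']; rfl)⟩)
    (Submodule.factor_surjective hR2) (by
      intro q
      obtain ⟨m, rfl⟩ := Submodule.Quotient.mk_surjective _ q
      refine (Submodule.Quotient.mk_eq_zero _).trans ⟨?_, ?_⟩
      · rintro ⟨b, rfl⟩
        exact ⟨Submodule.Quotient.mk b, rfl⟩
      · rintro ⟨b, hb⟩
        obtain ⟨b, rfl⟩ := Submodule.Quotient.mk_surjective _ b
        rw [Submodule.mapQ_apply, Submodule.Quotient.eq] at hb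
        have := hR2 hb
        have h2 : i b ∈ LinearMap.range i := ⟨b, rfl⟩
        simpa using sub_mem h2 this)
  have e2 := Module.length_eq_add_of_exact
    (Submodule.mapQ (LinearMap.range i) R v (by
      rintro _ ⟨b, rfl⟩
      exact ⟨b, rfl⟩))
    (Submodule.factor hR1) (by
      rw [← LinearMap.ker_eq_bot, LinearMap.ker_eq_bot']
      intro q
      obtain ⟨m, rfl⟩ := Submodule.Quotient.mk_surjective _ q
      intro h
      rw [Submodule.mapQ_apply, Submodule.Quotient.mk_eq_zero] at h
      obtain ⟨b', hb'⟩ := h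
      rw [Submodule.Quotient.mk_eq_zero]
      exact ⟨b', hv hb'⟩)
    (Submodule.factor_surjective hR1) (by
      intro q
      obtain ⟨m, rfl⟩ := Submodule.Quotient.mk_surjective _ q
      refine (Submodule.Quotient.mk_eq_zero _).trans ⟨?_, ?_⟩
      · rintro ⟨b, rfl⟩
        exact ⟨Submodule.Quotient.mk b, rfl⟩
      · rintro ⟨b, hb⟩
        obtain ⟨b, rfl⟩ := Submodule.Quotient.mk_surjective _ b
        rw [Submodule.mapQ_apply, Submodule.Quotient.eq] at hb
        have := hR1 hb
        have h2 : v b ∈ LinearMap.range v := ⟨b, rfl⟩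
        simpa using sub_mem h2 this)
  rw [e1, add_comm] at e2
  have hne : Module.length k (M ⧸ LinearMap.range i) ≠ ⊤ := Module.length_ne_top
  exact (ENat.add_right_injective_of_ne_top hne e2).symm

/-- If `B` is obtained from `A` by inverting `D`, then `B / c` is finite when `A / c` is. -/
lemma finite_quotient_of_inverts {k A B : Type*} [Field k] [CommRing A] [CommRing B] [Algebra k A]
    [Algebra k B] (α : A →ₐ[k] B) {D c : A} {e : B} (he : α D * e = 1)
    (hB : ∀ b : B, ∃ n a, α D ^ n * b = α a) [Module.Finite k (A ⧸ Ideal.span {c})] :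
    Module.Finite k (B ⧸ Ideal.span {α c}) := by
  let π := Ideal.Quotient.mkₐ k (Ideal.span {α c})
  let β : (A ⧸ Ideal.span {c}) →ₐ[k] (B ⧸ Ideal.span {α c}) :=
    Ideal.Quotient.liftₐ _ (π.comp α) (by
      intro a ha
      obtain ⟨b, rfl⟩ := Ideal.mem_span_singleton'.1 ha
      refine Ideal.Quotient.eq_zero_iff_mem.2 ?_
      rw [map_mul]
      exact Ideal.mul_mem_left _ _ (Ideal.mem_span_singleton_self _))
  have hβ : ∀ a, π (α a) ∈ β.range := fun a => ⟨Ideal.Quotient.mk _ a, rfl⟩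
  have : Module.Finite k β.range := Module.Finite.range β.toLinearMap
  have hDe : π (α D) * π e = 1 := by rw [← map_mul, he, map_one]
  -- Modulo `c` the inverse of `D` already lies in the image of `A / c`, which is therefore
  -- everything.
  have hpe : π e ∈ β.range := Subalgebra.mem_of_mul_eq_one _ (hβ D) hDe
  refine Module.Finite.of_surjective β.toLinearMap fun q => ?_
  obtain ⟨b, rfl⟩ := Ideal.Quotient.mk_surjective q
  obtain ⟨n, a, hna⟩ := hB b
  have hb : π b = π e ^ n * π (α a) := by
    rw [← hna, map_mul, ← mul_assoc, map_pow, ← mul_pow, mul_comm (π e), hDe, one_pow, one_mul]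
  have : π b ∈ β.range := hb ▸ mul_mem (pow_mem hpe n) (hβ a)
  exact this

/-- The length of a quotient of an overring `N ⊆ Frac A`, supported where `D` is invertible, by an
ideal containing `f` is at most the length of `A[1/D] / f`. -/
theorem rank_quotient_le {k A F : Type*} [Field k] [CommRing A] [CommRing F] [Algebra k A]
    [Algebra A F] [Algebra k F] [IsScalarTower k A F] [IsFractionRing A F] (N : Subalgebra A F)
    {f D : A} (hf : f ∈ nonZeroDivisors A)
    (hfin : ∀ c ∈ nonZeroDivisors A, Module.Finite k (A ⧸ Ideal.span {c}))
    (B : Subalgebra k F) (α : A →ₐ[k] B) (hα : ∀ a, (α a : F) = algebraMap A F a) {e : B}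
    (he : α D * e = 1) (hB : ∀ b : B, ∃ n a, α D ^ n * b = α a) (b : Ideal N)
    (hfb : algebraMap A N f ∈ b) (hDb : ∀ z, algebraMap A N D * z ∈ b → z ∈ b)
    {d : ℕ} (hd : Module.Finite k (B ⧸ Ideal.span {α f}) ∧
      Module.finrank k (B ⧸ Ideal.span {α f}) ≤ d) :
    Module.rank k (N ⧸ b) ≤ d := by
  classical
  refine rank_le fun s hs => ?_
  choose w hw using fun q : N ⧸ b => Ideal.Quotient.mk_surjective q
  -- Only finitely many elements of `N` are tested at a time, so a common denominator `c` exists for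
  -- them. No finiteness of `N` over `A` is needed.
  obtain ⟨⟨c, hc⟩, hcw⟩ := IsLocalization.exist_integer_multiples_of_finset (nonZeroDivisors A)
    (s.image fun q => (w q : F))
  have hcu : IsUnit (algebraMap A F c) := IsLocalization.map_units F ⟨c, hc⟩
  have hfu : IsUnit (algebraMap A F f) := IsLocalization.map_units F ⟨f, hf⟩
  -- `M` contains `B` and the chosen lifts and satisfies `c M ⊆ B`, which makes `M / B` finite. The
  -- second condition allows a return from `M` to `N` after multiplication by a power of `D`.
  let M : Submodule k F :=
    { carrier := {z | algebraMap A F c * z ∈ B ∧ ∃ n : ℕ, algebraMap A F D ^ n * z ∈ N}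
      zero_mem' := ⟨by rw [mul_zero]; exact zero_mem _, 0, by rw [mul_zero]; exact zero_mem _⟩
      add_mem' := by
        rintro x y ⟨hx, n, hx'⟩ ⟨hy, m, hy'⟩
        refine ⟨by rw [mul_add]; exact add_mem hx hy, n + m, ?_⟩
        have h1 : algebraMap A F D ^ (n + m) * (x + y) =
            algebraMap A F (D ^ m) * (algebraMap A F D ^ n * x) +
            algebraMap A F (D ^ n) * (algebraMap A F D ^ m * y) := by
          rw [map_pow, map_pow]; ring
        rw [h1]
        exact add_mem (mul_mem (Subalgebra.algebraMap_mem _ _) hx')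
          (mul_mem (Subalgebra.algebraMap_mem _ _) hy')
      smul_mem' := by
        rintro r x ⟨hx, n, hx'⟩
        refine ⟨by rw [mul_smul_comm]; exact Subalgebra.smul_mem _ hx r, n, ?_⟩
        rw [mul_smul_comm, ← algebraMap_smul A r (_ * x)]
        exact Subalgebra.smul_mem _ hx' _ }
  have hBM : ∀ z : B, (z : F) ∈ M := by
    intro z
    refine ⟨?_, ?_⟩
    · rw [← hα]; exact mul_mem (α c).2 z.2
    · obtain ⟨n, a, hna⟩ := hB z
      refine ⟨n, ?_⟩
      have := congrArg (fun q : B => (q : F)) hna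
      simp only [MulMemClass.coe_mul, SubmonoidClass.coe_pow, hα] at this
      rw [this]
      exact Subalgebra.algebraMap_mem _ _
  have hfM : ∀ z ∈ M, algebraMap A F f * z ∈ M := by
    rintro z ⟨hz, n, hz'⟩
    refine ⟨?_, n, ?_⟩
    · rw [mul_left_comm, ← hα f]; exact mul_mem (α f).2 hz
    · rw [mul_left_comm]; exact mul_mem (Subalgebra.algebraMap_mem _ _) hz'
  let i : B →ₗ[k] M := LinearMap.codRestrict M (Subalgebra.val B).toLinearMap hBM
  have hi : Function.Injective i := fun x y h => Subtype.ext (congrArg (fun q : M => (q : F)) h)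
  let u : B →ₗ[k] B := LinearMap.mulLeft k (α f)
  let v : M →ₗ[k] M := (LinearMap.mulLeft k (algebraMap A F f)).restrict hfM
  have hv : Function.Injective v := fun x y h =>
    Subtype.ext (hfu.mul_left_cancel (congrArg (fun q : M => (q : F)) h))
  have huv : v ∘ₗ i = i ∘ₗ u := by
    ext z
    change algebraMap A F f * (z : F) = ((α f * z : B) : F)
    rw [MulMemClass.coe_mul, hα]
  have := hfin c hc
  have hfinB : Module.Finite k (B ⧸ Ideal.span {α c}) := finite_quotient_of_inverts α he hB
  have hfinM : Module.Finite k (M ⧸ LinearMap.range i) := by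
    let κ : M →ₗ[k] B ⧸ Ideal.span {α c} := (Ideal.Quotient.mkₐ k (Ideal.span {α c})).toLinearMap ∘ₗ
      LinearMap.codRestrict (Subalgebra.toSubmodule B)
        (LinearMap.mulLeft k (algebraMap A F c) ∘ₗ M.subtype) (fun z => z.2.1)
    have hκ : LinearMap.ker κ = LinearMap.range i := by
      ext z
      have h1 : z ∈ LinearMap.ker κ ↔
          (⟨algebraMap A F c * z, z.2.1⟩ : B) ∈ Ideal.span {α c} :=
        Ideal.Quotient.eq_zero_iff_mem
      rw [h1, Ideal.mem_span_singleton]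
      constructor
      · rintro ⟨y, hy⟩
        refine ⟨y, Subtype.ext (hcu.mul_left_cancel ?_)⟩
        have := congrArg (fun q : B => (q : F)) hy
        simp only [MulMemClass.coe_mul, hα] at this
        exact this.symm
      · rintro ⟨y, rfl⟩
        refine ⟨y, Subtype.ext ?_⟩
        rw [MulMemClass.coe_mul, hα]
        rfl
    rw [← hκ]
    exact Module.Finite.of_injective (κ.quotKerEquivRange).toLinearMap
      (κ.quotKerEquivRange).injective
  have hlen := length_coker_eq i hi u v hv huv
  have hu : Module.length k (B ⧸ LinearMap.range u) ≤ d := by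
    have hr : LinearMap.range u = (Ideal.span {α f}).restrictScalars k := by
      ext z
      rw [Submodule.restrictScalars_mem, Ideal.mem_span_singleton, LinearMap.mem_range]
      constructor
      · rintro ⟨y, rfl⟩; exact ⟨y, rfl⟩
      · rintro ⟨y, rfl⟩; exact ⟨y, rfl⟩
    have := hd.1
    rw [hr, (Submodule.Quotient.restrictScalarsEquiv k (Ideal.span {α f})).length_eq,
      Module.length_eq_finrank]
    exact_mod_cast hd.2
  rw [← hlen] at hu
  have hwM : ∀ q ∈ s, (w q : F) ∈ M := by
    intro q hq
    refine ⟨?_, 0, by rw [pow_zero, one_mul]; exact (w q).2⟩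
    obtain ⟨a, ha⟩ := hcw _ (Finset.mem_image_of_mem _ hq)
    rw [← Algebra.smul_def]
    have ha' : algebraMap A F a = c • (w q : F) := ha
    rw [← ha', ← hα]
    exact (α a).2
  let W : s → M ⧸ LinearMap.range v := fun q => Submodule.Quotient.mk ⟨w q, hwM q q.2⟩
  have hW : LinearIndependent k W := by
    rw [Fintype.linearIndependent_iff]
    intro r hr
    rw [Fintype.linearIndependent_iff] at hs
    apply hs
    have hz : (Submodule.Quotient.mk (∑ q : s, r q • (⟨w q, hwM q q.2⟩ : M)) :
        M ⧸ LinearMap.range v) = 0 := by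
      rw [← hr]
      simp only [W, ← Submodule.mkQ_apply, map_sum, map_smul]
    rw [Submodule.Quotient.mk_eq_zero] at hz
    obtain ⟨⟨m, hm1, n, hm2⟩, hm⟩ := hz
    have hm' : algebraMap A F f * m = ∑ q : s, r q • (w q : F) := by
      have := congrArg (fun q : M => (q : F)) hm
      rw [AddSubmonoidClass.coe_finsetSum] at this
      exact this
    -- A combination in `f M` enters `f N ⊆ b` after multiplication by a power of `D`, and `b` is
    -- saturated for `D`. Independence modulo `b` therefore implies independence modulo `f M`.
    have hmem : ∑ q : s, r q • w q ∈ b := by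
      have hDn : ∀ (n : ℕ) (z : N), algebraMap A N D ^ n * z ∈ b → z ∈ b := by
        intro n
        induction n with
        | zero => intro z hz; simpa using hz
        | succ n ih => intro z hz; rw [pow_succ', mul_assoc] at hz; exact ih z (hDb _ hz)
      apply hDn n
      have : algebraMap A N D ^ n * ∑ q : s, r q • w q =
          algebraMap A N f * ⟨_, hm2⟩ := by
        apply Subtype.ext
        change algebraMap A F D ^ n * ((∑ q : s, r q • w q : N) : F) =
          algebraMap A F f * (algebraMap A F D ^ n * m)
        have hc : ((∑ q : s, r q • w q : N) : F) = ∑ q : s, r q • (w q : F) := by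
          rw [AddSubmonoidClass.coe_finsetSum]
          rfl
        rw [hc, ← hm']
        ring
      rw [this]
      exact Ideal.mul_mem_right _ _ hfb
    have h3 := (Ideal.Quotient.eq_zero_iff_mem).2 hmem
    rw [← h3, map_sum]
    refine Finset.sum_congr rfl fun q _ => ?_
    conv_lhs => rw [← hw q]
    rfl
  have hfinal : (s.card : ℕ∞) ≤ d := by
    refine le_trans ?_ hu
    have h1 := hW.cardinal_le_rank
    rw [Module.length_eq_rank]
    rw [Cardinal.mk_fintype, Fintype.card_coe] at h1
    have h2 : Cardinal.toENat (s.card : Cardinal) ≤ Cardinal.toENat _ :=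
      Cardinal.toENat.monotone' h1
    rwa [Cardinal.toENat_nat] at h2
  exact_mod_cast hfinal

end LengthComparison

/-! ### The coordinate ring of the configuration curve -/

section CoordinateRing

variable {n : ℕ} (h : Fin n → DH ℝ)

lemma chart_empty (x : Fin n → ℝ) : chart ∅ x = fun k => ((x k : ℝ) : OnePoint ℝ) := by
  ext k; simp [chart]

lemma mem_configIdeal_empty {p : MvPolynomial (Fin n) ℂ} : p ∈ configIdeal h ∅ ↔
    ∀ x : Fin n → ℝ, chart ∅ x ∈ configSet h → MvPolynomial.eval (fun k => (x k : ℂ)) p = 0 :=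
  Iff.rfl

/-- Polynomials without real zeros on the configuration set are regular on its Zariski closure. -/
lemma mk_mem_nonZeroDivisors {p : MvPolynomial (Fin n) ℂ}
    (hp : ∀ x : Fin n → ℝ, MvPolynomial.eval (fun k => (x k : ℂ)) p ≠ 0) :
    (Ideal.Quotient.mk (configIdeal h ∅) p) ∈ nonZeroDivisors (CoordRing h) := by
  rw [mem_nonZeroDivisors_iff_right]
  intro z hz
  obtain ⟨q, rfl⟩ := Ideal.Quotient.mk_surjective z
  rw [← map_mul, Ideal.Quotient.eq_zero_iff_mem, mem_configIdeal_empty] at hz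
  rw [Ideal.Quotient.eq_zero_iff_mem, mem_configIdeal_empty]
  intro x hx
  have := hz x hx
  rw [map_mul] at this
  exact (mul_eq_zero.1 this).resolve_right (hp x)

/-- A regular element lowers the Krull dimension, so the quotient has dimension at most zero; being
of finite type over `ℂ`, it is finite-dimensional. -/
lemma finite_quotient_span_singleton (hmob : mobility h = 1) (c : CoordRing h)
    (hc : c ∈ nonZeroDivisors (CoordRing h)) :
    Module.Finite ℂ (CoordRing h ⧸ Ideal.span {c}) := by
  have h1 : ringKrullDim (CoordRing h) ≤ 1 := by
    rw [← hmob]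
    exact le_iSup (fun s : Finset (Fin n) =>
      ringKrullDim (MvPolynomial (Fin n) ℂ ⧸ configIdeal h s)) ∅
  have h2 := (ringKrullDim_quotient_succ_le_of_nonZeroDivisor hc).trans h1
  have h3 : ringKrullDim (CoordRing h ⧸ Ideal.span {c}) ≤ 0 := by
    exact ENat.WithBot.lt_add_one_iff.1 (ENat.WithBot.add_one_le_natCast_iff.1
      (by exact_mod_cast h2))
  have : Algebra.FiniteType ℂ (CoordRing h ⧸ Ideal.span {c}) := inferInstance
  have h4 : Ring.KrullDimLE 0 (CoordRing h ⧸ Ideal.span {c}) :=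
    Ring.krullDimLE_iff.2 (by exact_mod_cast h3)
  exact (Module.finite_iff_krullDimLE_zero ℂ (CoordRing h ⧸ Ideal.span {c})).2 h4

end CoordinateRing

/-! ### The closure condition over the coordinate ring -/

section ChainProducts

variable {n : ℕ} {R S : Type*} [CommRing R] [CommRing S]

lemma mapDH_chainProd (f : ℝ →+* R) (g : R →+* S) (h : Fin n → DH ℝ) (t : Fin n → R) (i j : ℕ) :
    mapDH g (chainProd f h t i j) = chainProd (g.comp f) h (fun k => g (t k)) i j := by
  rw [chainProd, chainProd, ← mapDHHom_apply, map_list_prod, List.map_map]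
  congr 2
  ext1 k
  simp only [Function.comp_apply, mapDHHom_apply, mapDH_sub, mapDH_algebraMap, mapDH_mapDH]

lemma chainProd_six (f : ℝ →+* R) (h : Fin 6 → DH ℝ) (t : Fin 6 → R) :
    chainProd f h t 0 6 = ((scal (t 0) - mapDH f (h 0)) * (scal (t 1) - mapDH f (h 1)) *
      (scal (t 2) - mapDH f (h 2))) * ((scal (t 3) - mapDH f (h 3)) *
      (scal (t 4) - mapDH f (h 4)) * (scal (t 5) - mapDH f (h 5))) := by
  simp [chainProd, List.finRange_succ, mul_assoc]

lemma chainProd_zero_four (f : ℝ →+* R) (h : Fin 6 → DH ℝ) (t : Fin 6 → R) :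
    chainProd f h t 0 4 = (scal (t 0) - mapDH f (h 0)) * (scal (t 1) - mapDH f (h 1)) *
      (scal (t 2) - mapDH f (h 2)) * (scal (t 3) - mapDH f (h 3)) := by
  simp [chainProd, List.finRange_succ, mul_assoc]

lemma chainProd_one_three (f : ℝ →+* R) (h : Fin 6 → DH ℝ) (t : Fin 6 → R) :
    chainProd f h t 1 3 = (scal (t 1) - mapDH f (h 1)) * (scal (t 2) - mapDH f (h 2)) := by
  simp [chainProd, List.finRange_succ]

/-- Seven coordinates of the full product vanish at all real configurations, hence belong to the
vanishing ideal of the Zariski closure. -/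
lemma exists_chainProd_eq_scal (h : Fin n → DH ℝ) : ∃ r : CoordRing h,
    chainProd ((Ideal.Quotient.mk (configIdeal h ∅)).comp
      (MvPolynomial.C.comp Complex.ofRealHom)) h
      (fun k => Ideal.Quotient.mk (configIdeal h ∅) (MvPolynomial.X k)) 0 n = scal r := by
  set Z := chainProd (MvPolynomial.C.comp Complex.ofRealHom) h
    (fun k => (MvPolynomial.X k : MvPolynomial (Fin n) ℂ)) 0 n with hZ
  refine ⟨Ideal.Quotient.mk (configIdeal h ∅) (coordEquiv _ Z 0), ?_⟩
  rw [← mapDH_chainProd, ← hZ]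
  apply (coordEquiv _).injective
  ext k
  rw [coordEquiv_mapDH]
  have hs : ∀ {T : Type} [CommRing T] (r : T), coordEquiv T (scal r) = Pi.single 0 r := by
    intro T _ r
    rw [coordEquiv_apply]
    ext k
    fin_cases k <;> simp
  rw [hs]
  by_cases hk : k = 0
  · subst hk; simp
  · rw [Pi.single_eq_of_ne hk, Ideal.Quotient.eq_zero_iff_mem, mem_configIdeal_empty]
    rintro x ⟨r, -, hr⟩
    have e1 : mapDH (MvPolynomial.eval fun k => (x k : ℂ)) Z = toDHC (scal r) := by
      rw [show (scal r : DH ℝ) = _ from hr.symm, hZ, mapDH_chainProd, chainProd, toDHC, ← mapDHHom_apply Complex.ofRealHom,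
        map_list_prod, List.map_map, List.take_of_length_le (by simp), List.drop_zero]
      congr 2
      ext1 j
      rw [chart_empty]
      change _ = mapDH Complex.ofRealHom (algebraMap ℝ (DH ℝ) (x j) - h j)
      rw [mapDH_sub, mapDH_algebraMap]
      congr 2
      · simp
      · ext; simp
    rw [← coordEquiv_mapDH, e1, toDHC, mapDH_algebraMap, hs, Pi.single_eq_of_ne hk]

end ChainProducts

/-! ### From the closed chain to the fibre over `t₁ = i` -/

section LocalFibre

variable {B : Type*} [CommRing B] [Algebra ℂ B]

/-- The part of the fibre `t₁ = i` of a closed linkage where only `t₁` and `t₄` take the value `i`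
has length at most the degree of the greatest common divisor of the quad polynomials. -/
theorem finrank_quotient_span_sub_I_le {h₁ h₂ h₃ h₄ h₅ h₆ : DH ℝ} (hh₁ : h₁ ^ 2 = -1)
    (hh₂ : h₂ ^ 2 = -1) (hh₃ : h₃ ^ 2 = -1) (hh₄ : h₄ ^ 2 = -1) (hh₅ : h₅ ^ 2 = -1)
    (hh₆ : h₆ ^ 2 = -1) (hne : h₃ ≠ h₄) (hne' : h₃ ≠ -h₄)
    (hl : LinearIndependent ℝ (subProducts h₁ h₂ h₃))
    (hl' : LinearIndependent ℝ (subProducts h₆ h₅ h₄)) {g : DH ℂ} (hg : IsGeneratorG g h₁ h₄)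
    {t₁ t₂ t₃ t₄ t₅ t₆ r e D I : B} (hI : I = algebraMap ℂ B Complex.I)
    {a₁ a₂ a₃ a₄ a₅ a₆ : DH B} (ha₁ : a₁ = mapDH ((algebraMap ℂ B).comp Complex.ofRealHom) h₁)
    (ha₂ : a₂ = mapDH ((algebraMap ℂ B).comp Complex.ofRealHom) h₂)
    (ha₃ : a₃ = mapDH ((algebraMap ℂ B).comp Complex.ofRealHom) h₃)
    (ha₄ : a₄ = mapDH ((algebraMap ℂ B).comp Complex.ofRealHom) h₄)
    (ha₅ : a₅ = mapDH ((algebraMap ℂ B).comp Complex.ofRealHom) h₅)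
    (ha₆ : a₆ = mapDH ((algebraMap ℂ B).comp Complex.ofRealHom) h₆)
    (hclosed : ((scal t₁ - a₁) * (scal t₂ - a₂) * (scal t₃ - a₃)) *
      ((scal t₄ - a₄) * (scal t₅ - a₅) * (scal t₆ - a₆)) = scal r)
    (hf : ∀ z, (t₁ - I) * z = 0 → z = 0)
    (hDef : D = (t₁ + I) * (t₄ + I) * (t₂ ^ 2 + 1) * (t₃ ^ 2 + 1) * (t₅ ^ 2 + 1) * (t₆ ^ 2 + 1))
    (he : D * e = 1) (hgen : Algebra.adjoin ℂ {t₁, t₂, t₃, t₄, t₅, t₆, e} = ⊤) :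
    Module.Finite ℂ (B ⧸ Ideal.span {t₁ - I}) ∧ Module.finrank ℂ (B ⧸ Ideal.span {t₁ - I}) ≤
      (EuclideanDomain.gcd (quadPolyWith g h₁ h₂ h₃ h₄)
        (quadPolyWith (star g) h₄ h₅ h₆ h₁)).natDegree := by
  have hI2 : I ^ 2 = -1 := by rw [hI, ← map_pow, Complex.I_sq, map_neg, map_one]
  have hunit : ∀ z : B, z ∣ D → IsUnit z := fun z hz =>
    isUnit_of_dvd_unit hz (IsUnit.of_mul_eq_one e he)
  have u₁ : IsUnit (t₁ + I) := hunit _ ⟨(t₄ + I) * (t₂ ^ 2 + 1) * (t₃ ^ 2 + 1) * (t₅ ^ 2 + 1) *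
    (t₆ ^ 2 + 1), by rw [hDef]; ring⟩
  have u₄ : IsUnit (t₄ + I) := hunit _ ⟨(t₁ + I) * (t₂ ^ 2 + 1) * (t₃ ^ 2 + 1) * (t₅ ^ 2 + 1) *
    (t₆ ^ 2 + 1), by rw [hDef]; ring⟩
  have u₂ : IsUnit (t₂ ^ 2 + 1) := hunit _ ⟨(t₁ + I) * (t₄ + I) * (t₃ ^ 2 + 1) * (t₅ ^ 2 + 1) *
    (t₆ ^ 2 + 1), by rw [hDef]; ring⟩
  have u₃ : IsUnit (t₃ ^ 2 + 1) := hunit _ ⟨(t₁ + I) * (t₄ + I) * (t₂ ^ 2 + 1) * (t₅ ^ 2 + 1) *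
    (t₆ ^ 2 + 1), by rw [hDef]; ring⟩
  have u₅ : IsUnit (t₅ ^ 2 + 1) := hunit _ ⟨(t₁ + I) * (t₄ + I) * (t₂ ^ 2 + 1) * (t₃ ^ 2 + 1) *
    (t₆ ^ 2 + 1), by rw [hDef]; ring⟩
  have u₆ : IsUnit (t₆ ^ 2 + 1) := hunit _ ⟨(t₁ + I) * (t₄ + I) * (t₂ ^ 2 + 1) * (t₃ ^ 2 + 1) *
    (t₅ ^ 2 + 1), by rw [hDef]; ring⟩
  have hline : ∀ {a : DH B} {h : DH ℝ}, a = mapDH ((algebraMap ℂ B).comp Complex.ofRealHom) h →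
      h ^ 2 = -1 → IsLine a := fun ha hh => ha ▸ isLine_mapDH _ hh
  obtain ⟨hdvd, w, hw⟩ := closed_chain_relations (hline ha₁ hh₁) (hline ha₂ hh₂) (hline ha₃ hh₃)
    (hline ha₄ hh₄) (hline ha₅ hh₅) (hline ha₆ hh₆) hI2 hclosed hf u₁ u₄ u₂ u₃ u₅ u₆
  set J := Ideal.span {t₁ - I} with hJ
  let π : B →ₐ[ℂ] B ⧸ J := Ideal.Quotient.mkₐ ℂ J
  have hπI : π I = algebraMap ℂ (B ⧸ J) Complex.I := by rw [hI, AlgHom.commutes]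
  have hπ1 : π t₁ = π I := by
    rw [← sub_eq_zero, ← map_sub]
    exact Ideal.Quotient.eq_zero_iff_mem.2 (Ideal.mem_span_singleton_self _)
  have hπ4 : π t₄ = π I := by
    rw [← sub_eq_zero, ← map_sub]
    exact Ideal.Quotient.eq_zero_iff_mem.2 (Ideal.mem_span_singleton.2 hdvd)
  have hπa : ∀ {a : DH B} {h : DH ℝ}, a = mapDH ((algebraMap ℂ B).comp Complex.ofRealHom) h →
      mapDH (π : B →+* B ⧸ J) a =
        mapDH ((algebraMap ℂ (B ⧸ J)).comp Complex.ofRealHom) h := by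
    rintro a h rfl
    rw [mapDH_mapDH, ← RingHom.comp_assoc, π.comp_algebraMap]
  have hrange : (Algebra.adjoin ℂ {t₁, t₂, t₃, t₄, t₅, t₆, e}).map π = ⊤ := by
    rw [hgen, Algebra.map_top, AlgHom.range_eq_top]
    exact Ideal.Quotient.mk_surjective
  refine finrank_le_natDegree_gcd hh₁ hh₂ hh₃ hh₄ hh₅ hh₆ hne hne' hl hl' hg
    (t₂ := π t₂) (t₃ := π t₃) (t₅ := π t₅) (t₆ := π t₆) (e := π e) (D := π D)
    (by simpa using u₂.map π) (by simpa using u₃.map π) hπI (hπa ha₁).symm.symm (hπa ha₂) (hπa ha₃)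
    (hπa ha₄) (hπa ha₅) (hπa ha₆) (Units.map (π : B →* B ⧸ J) w) ?_ ?_
    (by rw [← map_mul, he, map_one]) ?_
  · have h1 := congrArg (mapDH (π : B →+* B ⧸ J)) hw
    rw [← scal_mul_eq_smul] at h1
    simp only [mapDH_mul, mapDH_sub, mapDH_star, mapDH_algebraMap, RingHom.coe_coe, hπ1,
      hπ4] at h1
    rw [← scal_mul_eq_smul]
    exact h1
  · have hz : ∀ z : B ⧸ J, z ∈ Algebra.adjoin ℂ {π t₂, π t₃, π t₅, π t₆} →
        z ^ 2 + 1 ∈ Algebra.adjoin ℂ {π t₂, π t₃, π t₅, π t₆} := fun z hz =>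
      add_mem (pow_mem hz 2) (one_mem _)
    have hs : ∀ z ∈ ({π t₂, π t₃, π t₅, π t₆} : Set (B ⧸ J)),
        z ∈ Algebra.adjoin ℂ {π t₂, π t₃, π t₅, π t₆} := fun z hz => Algebra.subset_adjoin hz
    have hII : π I + π I ∈ Algebra.adjoin ℂ {π t₂, π t₃, π t₅, π t₆} := by
      rw [hπI]
      exact add_mem (Subalgebra.algebraMap_mem _ _) (Subalgebra.algebraMap_mem _ _)
    rw [hDef]
    simp only [map_mul, map_add, map_pow, map_one, hπ1, hπ4]
    exact mul_mem (mul_mem (mul_mem (mul_mem (mul_mem hII hII) (hz _ (hs _ (by simp))))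
      (hz _ (hs _ (by simp)))) (hz _ (hs _ (by simp)))) (hz _ (hs _ (by simp)))
  · rw [eq_top_iff, ← hrange, AlgHom.map_adjoin]
    refine Algebra.adjoin_le ?_
    rintro _ ⟨z, hz, rfl⟩
    have hI' : π I ∈ Algebra.adjoin ℂ {π t₂, π t₃, π t₅, π t₆, π e} := by
      rw [hπI]; exact Subalgebra.algebraMap_mem _ _
    simp only [Set.mem_insert_iff, Set.mem_singleton_iff] at hz
    rcases hz with rfl | rfl | rfl | rfl | rfl | rfl | rfl
    · rw [hπ1]; exact hI'
    · exact Algebra.subset_adjoin (by simp)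
    · exact Algebra.subset_adjoin (by simp)
    · rw [hπ4]; exact hI'
    · exact Algebra.subset_adjoin (by simp)
    · exact Algebra.subset_adjoin (by simp)
    · exact Algebra.subset_adjoin (by simp)

end LocalFibre

/-! ### The fibre on the normalized curve -/

section FibreOnNormalization

open MvPolynomial

/-- A polynomial that does not vanish at the points with `t₁ = i`, `t₄ = ρ i` and all other
`t k ≠ ± i`, and that inverts the remaining factors of the `t k ^ 2 + 1`. -/
def bondDenominator (ρ : ℝ) : MvPolynomial (Fin 6) ℂ :=
  (X 0 + C Complex.I) * (C (ρ : ℂ) * X 3 + C Complex.I) * (X 1 ^ 2 + 1) * (X 2 ^ 2 + 1) *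
    (X 4 ^ 2 + 1) * (X 5 ^ 2 + 1)

lemma ofReal_sq_add_one_ne_zero (x : ℝ) : (x : ℂ) ^ 2 + 1 ≠ 0 := by
  have : x ^ 2 + 1 ≠ 0 := by positivity
  exact_mod_cast this

lemma ofReal_add_I_ne_zero (x : ℝ) : (x : ℂ) + Complex.I ≠ 0 := fun h => by
  simpa using congrArg Complex.im h

lemma ofReal_sub_I_ne_zero (x : ℝ) : (x : ℂ) - Complex.I ≠ 0 := fun h => by
  simpa using congrArg Complex.im h

lemma eval_bondDenominator_ne_zero (ρ : ℝ) (x : Fin 6 → ℝ) :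
    eval (fun k => (x k : ℂ)) (bondDenominator ρ) ≠ 0 := by
  have h1 := ofReal_add_I_ne_zero (ρ * x 3)
  push_cast at h1
  simp only [bondDenominator, map_mul, map_add, map_pow, map_one, eval_X, eval_C]
  exact mul_ne_zero (mul_ne_zero (mul_ne_zero (mul_ne_zero (mul_ne_zero
    (ofReal_add_I_ne_zero _) h1) (ofReal_sq_add_one_ne_zero _)) (ofReal_sq_add_one_ne_zero _))
    (ofReal_sq_add_one_ne_zero _)) (ofReal_sq_add_one_ne_zero _)

lemma exists_pow_mul_eq_algebraMap {k A F : Type*} [CommRing k] [CommRing A] [CommRing F]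
    [Algebra k A] [Algebra A F] [Algebra k F] [IsScalarTower k A F] {D : A} {e : F}
    (he : algebraMap A F D * e = 1) {b : F}
    (hb : b ∈ Algebra.adjoin k (insert e (Set.range (algebraMap A F)))) :
    ∃ n a, algebraMap A F D ^ n * b = algebraMap A F a := by
  induction hb using Algebra.adjoin_induction with
  | mem x hx =>
    rcases hx with rfl | ⟨a, rfl⟩
    · exact ⟨1, 1, by rw [pow_one, he, map_one]⟩
    · exact ⟨0, a, by simp⟩
  | algebraMap r => exact ⟨0, algebraMap k A r, by
      rw [pow_zero, one_mul, ← IsScalarTower.algebraMap_apply]⟩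
  | add x y _ _ hx hy =>
    obtain ⟨n, a, hn⟩ := hx
    obtain ⟨m, c, hm⟩ := hy
    refine ⟨n + m, D ^ m * a + D ^ n * c, ?_⟩
    rw [map_add, map_mul, map_mul, map_pow, map_pow, ← hn, ← hm]
    ring
  | mul x y _ _ hx hy =>
    obtain ⟨n, a, hn⟩ := hx
    obtain ⟨m, c, hm⟩ := hy
    refine ⟨n + m, a * c, ?_⟩
    rw [map_mul, ← hn, ← hm]
    ring

/-- On the normalized configuration curve, the part of the fibre over `t₁ = i` on which the
denominator is invertible has length at most the degree of the greatest common divisor of the quad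
polynomials. -/
theorem rank_normRing_quotient_le {h : Fin 6 → DH ℝ} (hL : IsClosedLinkage h)
    (hmob : mobility h = 1) (h123 : couplingDim [h 0, h 1, h 2] = 8)
    (h654 : couplingDim [h 5, h 4, h 3] = 8) {ρ : ℝ} (hρ : ρ = 1 ∨ ρ = -1) {g : DH ℂ}
    (hg : IsGeneratorG g (h 0) (ρ • h 3)) (b : Ideal (NormRing h))
    (hfb : toNormRing h (X 0 - C Complex.I) ∈ b)
    (hDb : ∀ z, toNormRing h (bondDenominator ρ) * z ∈ b → z ∈ b) :
    Module.rank ℂ (NormRing h ⧸ b) ≤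
      (EuclideanDomain.gcd (quadPolyWith g (h 0) (h 1) (h 2) (ρ • h 3))
        (quadPolyWith (star g) (ρ • h 3) (h 4) (h 5) (h 0))).natDegree := by
  set A := CoordRing h with hA
  set F := FractionRing A with hF
  let mk : MvPolynomial (Fin 6) ℂ →ₐ[ℂ] A := Ideal.Quotient.mkₐ ℂ (configIdeal h ∅)
  set D : A := mk (bondDenominator ρ) with hD
  set f : A := mk (X 0 - C Complex.I) with hf
  have hDreg : D ∈ nonZeroDivisors A := mk_mem_nonZeroDivisors h (eval_bondDenominator_ne_zero ρ)
  have hfreg : f ∈ nonZeroDivisors A := mk_mem_nonZeroDivisors h fun x => by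
    simpa using ofReal_sub_I_ne_zero (x 0)
  obtain ⟨e, he⟩ := (IsLocalization.map_units F ⟨D, hDreg⟩).exists_right_inv
  have he : algebraMap A F D * e = 1 := he
  -- `A[1/D]` is realized inside the total ring of fractions; `D` is regular because it has no zeros
  -- at real parameters.
  let B : Subalgebra ℂ F := Algebra.adjoin ℂ (insert e (Set.range (algebraMap A F)))
  let α : A →ₐ[ℂ] B := (IsScalarTower.toAlgHom ℂ A F).codRestrict B
    fun a => Algebra.subset_adjoin (Or.inr ⟨a, rfl⟩)
  let eB : B := ⟨e, Algebra.subset_adjoin (Or.inl rfl)⟩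
  have hα : ∀ a, (α a : F) = algebraMap A F a := fun a => rfl
  have heB : α D * eB = 1 := Subtype.ext he
  refine rank_quotient_le (integralClosure A F) hfreg
    (finite_quotient_span_singleton h hmob) B α hα heB ?_ b hfb hDb ?_
  · rintro ⟨z, hz⟩
    obtain ⟨n, a, hna⟩ := exists_pow_mul_eq_algebraMap he hz
    exact ⟨n, a, Subtype.ext hna⟩
  · have hsq := hL.2.1
    have hρ2 : ρ * ρ = 1 := by rcases hρ with rfl | rfl <;> norm_num
    have hh4 : (ρ • h 3) ^ 2 = -1 := by
      rw [pow_two, smul_mul_smul_comm, hρ2, one_smul, ← pow_two, hsq]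
    have hl := linearIndependent_subProducts h123
    have hl' : LinearIndependent ℝ (subProducts (h 5) (h 4) (ρ • h 3)) := by
      rcases hρ with rfl | rfl
      · rw [one_smul]; exact linearIndependent_subProducts h654
      · rw [neg_one_smul]
        exact LinearIndependent.subProducts_neg (linearIndependent_subProducts h654)
    have hne : h 2 ≠ ρ • h 3 ∧ h 2 ≠ -(ρ • h 3) := by
      have := hL.2.2 2
      rcases hρ with rfl | rfl
      · rw [one_smul]; exact this
      · rw [neg_one_smul, neg_neg]; exact this.symm
    obtain ⟨r, hr⟩ := exists_chainProd_eq_scal h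
    let t : Fin 6 → B := fun k => α (mk (X k))
    let ι : ℝ →+* B := (algebraMap ℂ B).comp Complex.ofRealHom
    have hmain : (scal (t 0) - mapDH ι (h 0)) * (scal (t 1) - mapDH ι (h 1)) *
        (scal (t 2) - mapDH ι (h 2)) * ((scal (t 3) - mapDH ι (h 3)) *
        (scal (t 4) - mapDH ι (h 4)) * (scal (t 5) - mapDH ι (h 5))) = scal (α r) := by
      have h1 := congrArg (mapDH (α : A →+* B)) hr
      rw [mapDH_chainProd, mapDH_algebraMap, chainProd_six] at h1
      have hι : (α : A →+* B).comp ((Ideal.Quotient.mk (configIdeal h ∅)).comp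
          (C.comp Complex.ofRealHom)) = ι := by
        ext
        · exact congrArg _ ((α.comp mk).commutes _)
      rw [hι] at h1
      exact h1
    have hsm : ∀ x y : B, (scal (x * y) : DH B) = scal x * scal y := map_mul (algebraMap B (DH B))
    -- Reversing the fourth line together with its parameter changes the chain only by the sign `ρ`,
    -- so the closure condition persists.
    have h34 : scal (ι ρ * t 3) - mapDH ι (ρ • h 3) =
        (scal (ι ρ) : DH B) * (scal (t 3) - mapDH ι (h 3)) := by
      rw [mapDH_smul, hsm, mul_sub, scal_mul_eq_smul (ι ρ) (mapDH ι (h 3))]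
    have hclosed : (scal (t 0) - mapDH ι (h 0)) * (scal (t 1) - mapDH ι (h 1)) *
        (scal (t 2) - mapDH ι (h 2)) * ((scal (ι ρ * t 3) - mapDH ι (ρ • h 3)) *
        (scal (t 4) - mapDH ι (h 4)) * (scal (t 5) - mapDH ι (h 5))) = scal (ι ρ * α r) := by
      rw [h34, hsm, ← hmain]
      simp only [scal_mul_eq_smul, smul_mul_assoc, mul_smul_comm]
    have hαf : α f = t 0 - algebraMap ℂ B Complex.I := by
      rw [hf, map_sub, map_sub]
      rfl
    have hαD : α D = (t 0 + algebraMap ℂ B Complex.I) * (ι ρ * t 3 + algebraMap ℂ B Complex.I) *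
        (t 1 ^ 2 + 1) * (t 2 ^ 2 + 1) * (t 4 ^ 2 + 1) * (t 5 ^ 2 + 1) := by
      have hC : ∀ c : ℂ, α (mk (C c)) = algebraMap ℂ B c := (α.comp mk).commutes
      rw [hD, bondDenominator]
      simp only [map_mul, map_add, map_pow, map_one, hC]
      rfl
    rw [hαf]
    refine finrank_quotient_span_sub_I_le (hsq 0) (hsq 1) (hsq 2) hh4 (hsq 4) (hsq 5) hne.1 hne.2
      hl hl' hg rfl rfl rfl rfl rfl rfl rfl hclosed ?_ hαD heB ?_
    · rw [← hαf]
      rintro ⟨z, hz⟩ h0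
      obtain ⟨f', hf'⟩ := (IsLocalization.map_units F ⟨f, hfreg⟩).exists_left_inv
      have h1 : algebraMap A F f * z = 0 := congrArg Subtype.val h0
      refine Subtype.ext ?_
      change z = 0
      calc z = (f' * algebraMap A F f) * z := by rw [hf', one_mul]
        _ = 0 := by rw [mul_assoc, h1, mul_zero]
    · set S := Algebra.adjoin ℂ {t 0, t 1, t 2, ι ρ * t 3, t 4, t 5, eB} with hS
      have hsub : ∀ z ∈ ({t 0, t 1, t 2, ι ρ * t 3, t 4, t 5, eB} : Set B), z ∈ S :=
        fun z hz => Algebra.subset_adjoin hz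
      have hιS : ι ρ ∈ S := Subalgebra.algebraMap_mem _ _
      have h3 : t 3 ∈ S := by
        have h33 : t 3 = ι ρ * (ι ρ * t 3) := by
          rw [← mul_assoc, ← map_mul, hρ2, map_one, one_mul]
        rw [h33]
        exact mul_mem hιS (hsub _ (by simp))
      have ht : ∀ k, t k ∈ S := by
        intro k
        fin_cases k
        · exact hsub _ (by simp)
        · exact hsub _ (by simp)
        · exact hsub _ (by simp)
        · exact h3
        · exact hsub _ (by simp)
        · exact hsub _ (by simp)
      have hαS : ∀ a, α a ∈ S := by
        intro a
        obtain ⟨p, rfl⟩ := Ideal.Quotient.mkₐ_surjective ℂ (configIdeal h ∅) a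
        have : (α.comp mk) p ∈ (Algebra.adjoin ℂ (Set.range X)).map (α.comp mk) :=
          ⟨p, by rw [adjoin_range_X]; trivial, rfl⟩
        rw [AlgHom.map_adjoin] at this
        refine Algebra.adjoin_le ?_ this
        rintro _ ⟨_, ⟨k, rfl⟩, rfl⟩
        exact ht k
      rw [eq_top_iff]
      rintro ⟨z, hz⟩ -
      have hz' : z ∈ S.map B.val := by
        refine Algebra.adjoin_le ?_ hz
        rintro _ (rfl | ⟨a, rfl⟩)
        · exact ⟨eB, hsub _ (by simp), rfl⟩
        · exact ⟨α a, hαS a, rfl⟩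
      obtain ⟨y, hy, hyz⟩ := hz'
      rwa [show (⟨z, hz⟩ : B) = y from Subtype.ext hyz.symm]

end FibreOnNormalization

/-! ### Powers of maximal ideals and lengths -/

section Length

variable {k N : Type*} [Field k] [CommRing N] [Algebra k N]

/-- An element outside a maximal ideal is a unit modulo every power of that ideal. -/
lemma mem_pow_of_mul_mem {β : Ideal N} (hβ : β.IsMaximal) {u z : N} (hu : u ∉ β) {m : ℕ}
    (h : u * z ∈ β ^ m) : z ∈ β ^ m := by
  have h1 : IsCoprime (Ideal.span {u}) (β ^ m) := by
    refine IsCoprime.pow_right (Ideal.isCoprime_iff_sup_eq.2 ?_)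
    rw [sup_comm]
    exact hβ.1.2 _ (lt_of_le_of_ne le_sup_left fun h => hu (h ▸
      Ideal.mem_sup_right (Ideal.mem_span_singleton_self u)))
  obtain ⟨a, ha, b, hb, hab⟩ := Ideal.isCoprime_iff_exists.1 h1
  obtain ⟨c, rfl⟩ := Ideal.mem_span_singleton.1 ha
  rw [show z = c * (u * z) + b * z by linear_combination -z * hab]
  exact add_mem (Ideal.mul_mem_left _ _ h) (Ideal.mul_mem_right _ _ hb)

/-- Each strict step in the chain of powers contributes at least one dimension. -/
lemma le_finrank_quotient_pow (β : Ideal N) :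
    ∀ (m : ℕ) [Module.Finite k (N ⧸ β ^ m)], (∀ j < m, β ^ (j + 1) ≠ β ^ j) →
      m ≤ Module.finrank k (N ⧸ β ^ m)
  | 0, _, _ => Nat.zero_le _
  | m + 1, _, h => by
    have hle : β ^ (m + 1) ≤ β ^ m := Ideal.pow_le_pow_right (Nat.le_succ m)
    let p : (N ⧸ β ^ (m + 1)) →ₗ[k] (N ⧸ β ^ m) := (Ideal.Quotient.factorₐ k hle).toLinearMap
    have hp : Function.Surjective p := Ideal.Quotient.factor_surjective hle
    have : Module.Finite k (N ⧸ β ^ m) := Module.Finite.of_surjective p hp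
    have ih := le_finrank_quotient_pow β m fun j hj => h j (hj.trans (Nat.lt_succ_self m))
    refine lt_of_le_of_lt ih (lt_of_le_of_ne (LinearMap.finrank_le_finrank_of_surjective hp) ?_)
    intro heq
    have hinj := (LinearMap.injective_iff_surjective_of_finrank_eq_finrank heq.symm).2 hp
    refine h m (Nat.lt_succ_self m) (le_antisymm hle fun x hx => ?_)
    rw [← Ideal.Quotient.eq_zero_iff_mem]
    apply hinj
    rw [map_zero]
    exact Ideal.Quotient.eq_zero_iff_mem.2 hx

/-- Powers of distinct maximal ideals are coprime, so by the Chinese remainder theorem the quotient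
by their intersection maps onto the product of the local quotients. -/
lemma sum_le_of_rank_quotient_iInf_le {T : Finset (MaximalSpectrum N)}
    {m : MaximalSpectrum N → ℕ} (hm : ∀ β ∈ T, ∀ j < m β, β.asIdeal ^ (j + 1) ≠ β.asIdeal ^ j)
    {d : ℕ} (hd : Module.rank k (N ⧸ ⨅ β : T, β.1.asIdeal ^ m β.1) ≤ d) :
    ∑ β ∈ T, m β ≤ d := by
  set b := ⨅ β : T, β.1.asIdeal ^ m β.1 with hb
  have hfin : Module.Finite k (N ⧸ b) :=
    Module.rank_lt_aleph0_iff.1 (hd.trans_lt (Cardinal.natCast_lt_aleph0))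
  have hle : ∀ β : T, b ≤ β.1.asIdeal ^ m β.1 := fun β => iInf_le _ β
  let p : (N ⧸ b) →ₗ[k] (∀ β : T, N ⧸ β.1.asIdeal ^ m β.1) :=
    LinearMap.pi fun β => (Ideal.Quotient.factorₐ k (hle β)).toLinearMap
  have hcop : Pairwise fun β γ : T => IsCoprime (β.1.asIdeal ^ m β.1) (γ.1.asIdeal ^ m γ.1) := by
    intro β γ hne
    refine IsCoprime.pow (Ideal.isCoprime_iff_sup_eq.2 ?_)
    exact β.1.isMaximal.coprime_of_ne γ.1.isMaximal
      fun h => hne (Subtype.ext (MaximalSpectrum.ext h))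
  have hp : Function.Surjective p := by
    intro x
    obtain ⟨r, hr⟩ := Ideal.pi_quotient_surjective hcop x
    exact ⟨Ideal.Quotient.mk b r, funext hr⟩
  have hfin' : ∀ β : T, Module.Finite k (N ⧸ β.1.asIdeal ^ m β.1) := fun β =>
    Module.Finite.of_surjective (Ideal.Quotient.factorₐ k (hle β)).toLinearMap
      (Ideal.Quotient.factor_surjective (hle β))
  calc ∑ β ∈ T, m β = ∑ β : T, m β.1 := (Finset.sum_coe_sort T m).symm
    _ ≤ ∑ β : T, Module.finrank k (N ⧸ β.1.asIdeal ^ m β.1) :=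
        Finset.sum_le_sum fun β _ => le_finrank_quotient_pow _ _ (hm β.1 β.2)
    _ = Module.finrank k (∀ β : T, N ⧸ β.1.asIdeal ^ m β.1) :=
        (Module.finrank_pi_fintype k).symm
    _ ≤ Module.finrank k (N ⧸ b) := LinearMap.finrank_le_finrank_of_surjective hp
    _ ≤ d := Module.finrank_le_of_rank_le hd

end Length

/-! ### Vanishing orders at points of the normalization -/

section Bonds

open MvPolynomial

variable {n : ℕ} {h : Fin n → DH ℝ} {β : NormPoint h} {c : Fin n → ℂ}

lemma LiesOver.toNormRing_notMem (hc : LiesOver h β c) {p : MvPolynomial (Fin n) ℂ}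
    (hp : eval c p ≠ 0) : toNormRing h p ∉ β.asIdeal := by
  let π : MvPolynomial (Fin n) ℂ →+* NormRing h ⧸ β.asIdeal :=
    (Ideal.Quotient.mk β.asIdeal).comp (toNormRing h)
  have hπ : π = π.comp (C.comp (eval c)) := by
    refine MvPolynomial.ringHom_ext (fun a => by simp) fun k => ?_
    have h1 : (C.comp (eval c) : _ →+* MvPolynomial (Fin n) ℂ) (X k) = C (c k) := by simp
    rw [RingHom.comp_apply π, h1, ← sub_eq_zero, ← map_sub]
    exact Ideal.Quotient.eq_zero_iff_mem.2 (hc k)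
  intro hmem
  have h1 : π p = 0 := Ideal.Quotient.eq_zero_iff_mem.2 hmem
  have h2 : π (C (eval c p)) = 0 := (RingHom.congr_fun hπ p).symm.trans h1
  have h3 : IsUnit (π (C (eval c p))) := ((isUnit_iff_ne_zero.2 hp).map C).map π
  rw [h2, isUnit_zero_iff] at h3
  exact β.isMaximal.ne_top ((Ideal.eq_top_iff_one _).2 (Ideal.Quotient.eq_zero_iff_mem.1 h3.symm))

lemma vanishingOrder_eq_zero {i j : ℕ}
    (hF : ¬ ∀ x ∈ coords (couplerFun h i j), x ∈ β.asIdeal) : vanishingOrder h β i j = 0 := by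
  refine Nat.le_zero.1 (csSup_le ⟨0, fun x _ => by simp⟩ fun m hm => ?_)
  by_contra hm0
  exact hF fun x hx => Ideal.pow_le_self (by omega) (hm x hx)

lemma coords_mem_pow_vanishingOrder {i j : ℕ} {x : NormRing h}
    (hx : x ∈ coords (couplerFun h i j)) : x ∈ β.asIdeal ^ vanishingOrder h β i j := by
  rcases Nat.eq_zero_or_pos (vanishingOrder h β i j) with h0 | h0
  · simp [h0]
  · have hbdd : BddAbove {m : ℕ | ∀ x ∈ coords (couplerFun h i j), x ∈ β.asIdeal ^ m} := by
      by_contra hb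
      exact h0.ne' (Nat.sSup_of_not_bddAbove hb)
    exact Nat.sSup_mem ⟨0, fun x _ => by simp⟩ hbdd x hx

/-- If two consecutive powers below the vanishing order agreed, all later ones would too, and the
order could be raised by one. An unbounded set of orders has `sSup` equal to 0, and then there is no
such `l`. -/
lemma pow_succ_ne_pow_of_lt_vanishingOrder {i j l : ℕ} (hl : l < vanishingOrder h β i j) :
    β.asIdeal ^ (l + 1) ≠ β.asIdeal ^ l := by
  intro heq
  have hbdd : BddAbove {m : ℕ | ∀ x ∈ coords (couplerFun h i j), x ∈ β.asIdeal ^ m} := by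
    by_contra hb
    have := Nat.sSup_of_not_bddAbove hb
    exact absurd hl (by rw [vanishingOrder, this]; omega)
  have hpow : β.asIdeal ^ (vanishingOrder h β i j + 1) = β.asIdeal ^ vanishingOrder h β i j := by
    obtain ⟨s, hs⟩ := Nat.exists_eq_add_of_lt hl
    rw [hs, show l + s + 1 + 1 = (l + 1) + (s + 1) by ring, pow_add, heq, ← pow_add, add_assoc]
  have : vanishingOrder h β i j + 1 ≤ vanishingOrder h β i j :=
    le_csSup hbdd fun x hx => by rw [hpow]; exact coords_mem_pow_vanishingOrder hx
  omega

lemma pow_one_ne_pow_zero (β : NormPoint h) : β.asIdeal ^ (0 + 1) ≠ β.asIdeal ^ 0 := by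
  rw [zero_add, pow_one, pow_zero, Ideal.one_eq_top]
  exact β.isMaximal.ne_top

end Bonds

/-! ### Scalar consequences of vanishing chain products -/

section IdealMembership

variable {B : Type*} [CommRing B] {a b c d : DH B} (ha : IsLine a) (hb : IsLine b) (hc : IsLine c)
  (hd : IsLine d) {r s t u : B} {J : Ideal B}

include hb hc in
lemma mem_of_coords_pair (hJ : ∀ x ∈ coords ((scal s - b) * (scal t - c)), x ∈ J) :
    (s ^ 2 + 1) * (t ^ 2 + 1) ∈ J := by
  have h1 := linearMap_mem_of_coords hJ
    (reFst B ∘ₗ LinearMap.mulLeft B ((scal t + c) * (scal s + b)))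
  have h2 : (scal t + c) * (scal s + b) * ((scal s - b) * (scal t - c)) =
      scal ((s ^ 2 + 1) * (t ^ 2 + 1)) := by
    calc _ = (scal t + c) * ((scal s + b) * (scal s - b)) * (scal t - c) := by noncomm_ring
      _ = _ := by
        rw [scal_add_mul_scal_sub hb.sq, ← Algebra.commutes, mul_assoc,
          scal_add_mul_scal_sub hc.sq, ← map_mul]
  rw [LinearMap.comp_apply, LinearMap.mulLeft_apply, h2, reFst_scal] at h1
  exact h1

-- Left multiplication by the conjugate of the first three factors leaves their norm times `u - d`;
-- right multiplication by `d` turns this into `1 + u d`, whose real part is 1. The norm of the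
-- fourth factor is never used.
include ha hb hc hd in
lemma mem_of_coords_quadruple
    (hJ : ∀ x ∈ coords ((scal r - a) * (scal s - b) * (scal t - c) * (scal u - d)), x ∈ J) :
    (r ^ 2 + 1) * (s ^ 2 + 1) * (t ^ 2 + 1) ∈ J := by
  have h1 := linearMap_mem_of_coords hJ (reFst B ∘ₗ LinearMap.mulRight B d ∘ₗ
    LinearMap.mulLeft B (star ((scal r - a) * (scal s - b) * (scal t - c))))
  have h3 : (scal u - d) * d = u • d + scal 1 := by
    rw [sub_mul, ← pow_two, hd.sq, sub_neg_eq_add, scal_mul_eq_smul,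
      show (scal (1 : B) : DH B) = 1 from map_one (algebraMap B (DH B))]
  rw [LinearMap.comp_apply, LinearMap.comp_apply, LinearMap.mulLeft_apply,
    LinearMap.mulRight_apply, ← mul_assoc, star_mul_triple ha hb hc, mul_assoc, h3,
    scal_mul_eq_smul, map_smul, map_add, map_smul, hd.reFst_eq, smul_zero, zero_add, reFst_scal,
    smul_eq_mul, mul_one] at h1
  exact h1

end IdealMembership

/-! ### Counting the connecting bonds -/

section SixBonds

open MvPolynomial

variable {h : Fin 6 → DH ℝ} {β : NormPoint h}

lemma isLine_normRing (hL : IsClosedLinkage h) (k : Fin 6) :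
    IsLine (mapDH ((toNormRing h).comp (C.comp Complex.ofRealHom)) (h k)) :=
  isLine_mapDH _ (hL.2.1 k)

/-- At such a bond `t₁ + i` and `ρ t₄ + i` both equal `2i`, since `ρ ^ 2 = 1`. -/
lemma connecting_bond_properties {ρ : ℝ} (hρ : ρ = 1 ∨ ρ = -1)
    (hβ : β ∈ connectingBonds h 1 4 Complex.I (ρ * Complex.I)) :
    toNormRing h (X 0 - C Complex.I) ∈ β.asIdeal ∧
      toNormRing h (bondDenominator ρ) ∉ β.asIdeal := by
  obtain ⟨-, c, hc, hk, h0, h3⟩ := hβ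
  have e0 : c 0 = Complex.I := h0 0 rfl
  have e3 : c 3 = ρ * Complex.I := h3 3 rfl
  have hne : ∀ k : Fin 6, ¬ ((k : ℕ) + 1 = 1 ∨ (k : ℕ) + 1 = 4) → c k ^ 2 + 1 ≠ 0 :=
    fun k hk' h => hk' ((hk k).1 h)
  refine ⟨by rw [← e0]; exact hc 0, hc.toNormRing_notMem ?_⟩
  have hρ2 : (ρ : ℂ) * ρ = 1 := by rcases hρ with rfl | rfl <;> norm_num
  have hI : Complex.I + Complex.I ≠ 0 := by
    rw [← two_mul]; exact mul_ne_zero two_ne_zero Complex.I_ne_zero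
  simp only [bondDenominator, map_mul, map_add, map_pow, map_one, eval_X, eval_C, e0, e3]
  rw [← mul_assoc (ρ : ℂ), hρ2, one_mul]
  exact mul_ne_zero (mul_ne_zero (mul_ne_zero (mul_ne_zero (mul_ne_zero hI hI)
    (hne 1 (by decide))) (hne 2 (by decide))) (hne 4 (by decide))) (hne 5 (by decide))

lemma vanishingOrder_one_three (hL : IsClosedLinkage h) {D : NormRing h} (hD : D ∉ β.asIdeal)
    (h23 : ((toNormRing h (X 1)) ^ 2 + 1) * ((toNormRing h (X 2)) ^ 2 + 1) ∣ D) :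
    vanishingOrder h β 1 3 = 0 := by
  refine vanishingOrder_eq_zero fun hF => hD (Ideal.mem_of_dvd _ h23 ?_)
  have h2 : couplerFun h 1 3 = _ := chainProd_one_three _ _ _
  rw [h2] at hF
  exact mem_of_coords_pair (isLine_normRing hL 1) (isLine_normRing hL 2) hF

/-- Vanishing of `F_{0,4}` to order `v` puts `(t₁² + 1)(t₂² + 1)(t₃² + 1)` in the `v`-th power of
the maximal ideal, and every factor except `t₁ - i` is nonzero at the bond. -/
lemma sub_I_mem_pow_vanishingOrder (hL : IsClosedLinkage h) {D : NormRing h}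
    (hD : D ∉ β.asIdeal) (h123 : (toNormRing h (X 0) + toNormRing h (C Complex.I)) *
      ((toNormRing h (X 1)) ^ 2 + 1) * ((toNormRing h (X 2)) ^ 2 + 1) ∣ D) :
    toNormRing h (X 0 - C Complex.I) ∈ β.asIdeal ^ vanishingOrder h β 0 4 := by
  refine mem_pow_of_mul_mem β.isMaximal (fun hu => hD (Ideal.mem_of_dvd _ h123 hu)) ?_
  have hI : (toNormRing h (C Complex.I)) ^ 2 = -1 := by
    rw [← map_pow, ← map_pow, Complex.I_sq, map_neg, map_neg, map_one, map_one]
  have hF : ∀ x ∈ coords (couplerFun h 0 4), x ∈ β.asIdeal ^ vanishingOrder h β 0 4 :=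
    fun x hx => coords_mem_pow_vanishingOrder hx
  have h2 : couplerFun h 0 4 = _ := chainProd_zero_four _ _ _
  rw [h2] at hF
  have h1 := mem_of_coords_quadruple (isLine_normRing hL 0) (isLine_normRing hL 1)
    (isLine_normRing hL 2) (isLine_normRing hL 3) hF
  rw [map_sub]
  convert h1 using 1
  generalize toNormRing h (C Complex.I) = I at hI
  linear_combination (-(toNormRing h (X 1) ^ 2 + 1) * (toNormRing h (X 2) ^ 2 + 1)) * hI

/-- The bonds connecting the first and the fourth joint, counted with multiplicity, are bounded by
any common bound for the length of the fibre over `t₁ = i` near these bonds. -/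
theorem bondCountLE_of_rank_le (hL : IsClosedLinkage h) {ρ : ℝ} (hρ : ρ = 1 ∨ ρ = -1) {d : ℕ}
    (hd : ∀ b : Ideal (NormRing h), toNormRing h (X 0 - C Complex.I) ∈ b →
      (∀ z, toNormRing h (bondDenominator ρ) * z ∈ b → z ∈ b) →
        Module.rank ℂ (NormRing h ⧸ b) ≤ d) :
    BondCountLE h 1 4 Complex.I (ρ * Complex.I) d := by
  set S := connectingBonds h 1 4 Complex.I (ρ * Complex.I) with hS
  set D := toNormRing h (bondDenominator ρ) with hD
  have hexp : D = (toNormRing h (X 0) + toNormRing h (C Complex.I)) *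
      (toNormRing h (C (ρ : ℂ) * X 3 + C Complex.I)) * ((toNormRing h (X 1)) ^ 2 + 1) *
      ((toNormRing h (X 2)) ^ 2 + 1) * (toNormRing h (X 4 ^ 2 + 1)) *
      (toNormRing h (X 5 ^ 2 + 1)) := by
    rw [hD, bondDenominator]
    simp only [map_mul, map_add, map_pow, map_one]
  have key : ∀ (T : Finset (NormPoint h)) (m : NormPoint h → ℕ), ↑T ⊆ S →
      (∀ β ∈ T, toNormRing h (X 0 - C Complex.I) ∈ β.asIdeal ^ m β) →
      (∀ β ∈ T, ∀ j < m β, β.asIdeal ^ (j + 1) ≠ β.asIdeal ^ j) → ∑ β ∈ T, m β ≤ d := by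
    intro T m hT hf hm
    refine sum_le_of_rank_quotient_iInf_le (k := ℂ) hm (hd _ ?_ ?_)
    · exact (Submodule.mem_iInf _).2 fun β => hf β.1 β.2
    · intro z hz
      refine (Submodule.mem_iInf _).2 fun β => ?_
      exact mem_pow_of_mul_mem β.1.isMaximal (connecting_bond_properties hρ (hT β.2)).2
        ((Submodule.mem_iInf _).1 hz β)
  -- With all weights equal to 1, `key` bounds the number of bonds in any finite subset by `d`.
  have hfin : S.Finite := by
    by_contra hinf
    obtain ⟨T, hTS, hTc⟩ := Set.Infinite.exists_subset_card_eq hinf (d + 1)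
    have := key T (fun _ => 1) hTS
      (fun β hβ => by rw [pow_one]; exact (connecting_bond_properties hρ (hTS hβ)).1)
      (fun β _ j hj => by obtain rfl : j = 0 := by omega
                          exact pow_one_ne_pow_zero β)
    rw [Finset.sum_const, smul_eq_mul, mul_one, hTc] at this
    omega
  refine ⟨hfin, ?_⟩
  rw [finsum_mem_eq_finite_toFinset_sum _ hfin]
  -- `v(1,3)` vanishes, and the orders `v(1,4)` and `v(0,3)` enter with negative sign.
  have hle : ∀ β ∈ hfin.toFinset, connectionNumber h β 1 4 ≤ (vanishingOrder h β 0 4 : ℤ) := by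
    intro β hβ
    have hDβ := (connecting_bond_properties hρ (hfin.mem_toFinset.1 hβ)).2
    have h13 := vanishingOrder_one_three hL hDβ
      ⟨(toNormRing h (X 0) + toNormRing h (C Complex.I)) *
        (toNormRing h (C (ρ : ℂ) * X 3 + C Complex.I)) * (toNormRing h (X 4 ^ 2 + 1)) *
        (toNormRing h (X 5 ^ 2 + 1)), by rw [← hD, hexp]; ring⟩
    rw [connectionNumber]
    simp only [Nat.reduceSub, h13]
    omega
  refine (Finset.sum_le_sum hle).trans ?_
  rw [← Nat.cast_sum, Nat.cast_le]
  refine key _ _ (by simp) (fun β hβ => ?_) fun β _ j hj =>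
    pow_succ_ne_pow_of_lt_vanishingOrder hj
  have hDβ := (connecting_bond_properties hρ (hfin.mem_toFinset.1 hβ)).2
  exact sub_I_mem_pow_vanishingOrder hL hDβ
    ⟨(toNormRing h (C (ρ : ℂ) * X 3 + C Complex.I)) * (toNormRing h (X 4 ^ 2 + 1)) *
      (toNormRing h (X 5 ^ 2 + 1)), by rw [← hD, hexp]; ring⟩

end SixBonds

/-! ### The standard generator for lines that are not parallel -/

section StandardGenerator

/-- Quaternions of norm zero behave like matrices of rank one: `P z P` is `P` times the trace of `P
z`. -/
lemma mul_mul_self_of_star_mul_self {R : Type*} [CommRing R] {P : ℍ[R]} (hP : star P * P = 0)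
    (z : ℍ[R]) : P * z * P = algebraMap R ℍ[R] (2 * (P * z).re) * P := by
  have h1 : algebraMap R ℍ[R] (2 * (P * z).re) = P * z + star (P * z) :=
    (Quaternion.self_add_star' (P * z)).symm
  rw [h1, StarMul.star_mul, add_mul, mul_assoc (star z), hP, mul_zero, add_zero]

lemma real_line_norm {h : DH ℝ} (hh : h ^ 2 = -1) :
    h.imI.fst ^ 2 + h.imJ.fst ^ 2 + h.imK.fst ^ 2 = 1 := by
  have e := congrArg (fun q : DH ℝ => q.re.fst) hh
  simp [pow_two, real_line_pure hh] at e
  linarith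

lemma stdGenerator_re_fst {h₁ h₄ : DH ℝ} (hh₁ : h₁ ^ 2 = -1) (hh₄ : h₄ ^ 2 = -1) :
    (stdGenerator h₁ h₄).re.fst =
      ((h₁.imI.fst * h₄.imI.fst + h₁.imJ.fst * h₄.imJ.fst + h₁.imK.fst * h₄.imK.fst - 1 : ℝ) : ℂ) := by
  simp [stdGenerator, real_line_pure hh₁, real_line_pure hh₄]
  ring

/-- The primal real part is the inner product of the unit directions minus 1; it vanishes only if
the directions coincide. -/
lemma isUnit_stdGenerator_re {h₁ h₄ : DH ℝ} (hh₁ : h₁ ^ 2 = -1) (hh₄ : h₄ ^ 2 = -1)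
    (hp : ¬ Parallel h₁ h₄) : IsUnit (2 * (stdGenerator h₁ h₄).re) := by
  have h2 : IsUnit (2 : ℂ[ε]) := by
    have := (IsUnit.mk0 (2 : ℂ) two_ne_zero).map (algebraMap ℂ ℂ[ε])
    rwa [map_ofNat] at this
  refine h2.mul (TrivSqZeroExt.isUnit_iff_isUnit_fst.2 (isUnit_iff_ne_zero.2 fun h0 => hp ?_))
  rw [stdGenerator_re_fst hh₁ hh₄, Complex.ofReal_eq_zero] at h0
  have n1 := real_line_norm hh₁
  have n4 := real_line_norm hh₄
  have hI : h₁.imI.fst - h₄.imI.fst = 0 := by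
    apply pow_eq_zero_iff (two_ne_zero) |>.1
    nlinarith [sq_nonneg (h₁.imI.fst - h₄.imI.fst), sq_nonneg (h₁.imJ.fst - h₄.imJ.fst),
      sq_nonneg (h₁.imK.fst - h₄.imK.fst)]
  have hJ : h₁.imJ.fst - h₄.imJ.fst = 0 := by
    apply pow_eq_zero_iff (two_ne_zero) |>.1
    nlinarith [sq_nonneg (h₁.imI.fst - h₄.imI.fst), sq_nonneg (h₁.imJ.fst - h₄.imJ.fst),
      sq_nonneg (h₁.imK.fst - h₄.imK.fst)]
  have hK : h₁.imK.fst - h₄.imK.fst = 0 := by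
    apply pow_eq_zero_iff (two_ne_zero) |>.1
    nlinarith [sq_nonneg (h₁.imI.fst - h₄.imI.fst), sq_nonneg (h₁.imJ.fst - h₄.imJ.fst),
      sq_nonneg (h₁.imK.fst - h₄.imK.fst)]
  left
  ext
  · simp [primal, real_line_pure hh₁, real_line_pure hh₄]
  · exact sub_eq_zero.1 hI
  · exact sub_eq_zero.1 hJ
  · exact sub_eq_zero.1 hK

lemma star_stdGenerator {h₁ h₄ : DH ℝ} (hh₁ : h₁ ^ 2 = -1) (hh₄ : h₄ ^ 2 = -1) :
    star (stdGenerator h₁ h₄) = stdGenerator h₄ h₁ := by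
  rw [stdGenerator, StarMul.star_mul, iDH, toDHC, toDHC,
    (isLine_mapDH Complex.ofRealHom hh₁).star_sub, (isLine_mapDH Complex.ofRealHom hh₄).star_add]
  rfl

/-- The element `(i - h₁) (i + h₄)` generates `G` if the lines are not parallel. -/
theorem isGeneratorG_stdGenerator {h₁ h₄ : DH ℝ} (hh₁ : h₁ ^ 2 = -1) (hh₄ : h₄ ^ 2 = -1)
    (hp : ¬ Parallel h₁ h₄) : IsGeneratorG (stdGenerator h₁ h₄) h₁ h₄ := by
  set P := iDH - toDHC h₁ with hP
  set S := iDH + toDHC h₄ with hS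
  have hPS : stdGenerator h₁ h₄ = P * S := rfl
  have hP0 : star P * P = 0 := by
    rw [hP, iDH, toDHC, (isLine_mapDH Complex.ofRealHom hh₁).star_sub]
    exact iDH_add_mul_sub hh₁
  have hS0 : star S * S = 0 := by
    rw [hS, iDH, toDHC, (isLine_mapDH Complex.ofRealHom hh₄).star_add]
    exact iDH_sub_mul_add hh₄
  obtain ⟨τ, hτ⟩ := isUnit_stdGenerator_re hh₁ hh₄ hp
  rw [hPS] at hτ
  ext q
  constructor
  · rintro ⟨⟨r, rfl⟩, hq⟩
    rw [← hP] at hq ⊢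
    have h1 : P * r * S = (2 * Complex.I) • (P * r) := by
      calc P * r * S = P * r * (iDH + iDH) - P * r * (iDH - toDHC h₄) := by
            rw [hS]; noncomm_ring
        _ = (2 * Complex.I) • (P * r) := by
            rw [hq, sub_zero, ← map_add, ← two_mul, Algebra.smul_def, Algebra.commutes]
    -- The rank-one identity, applied to `P` and then to `S`, exhibits the unit multiple `τ P r S`
    -- as a scalar multiple of `P S`; and `P r S` is `2i P r` because `i - h₄` kills `P r` on the
    -- right.
    have h2 : algebraMap ℂ[ε] (DH ℂ) τ * (P * r * S) =
        algebraMap ℂ[ε] (DH ℂ) (2 * (S * (P * r)).re) * (P * S) := by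
      calc algebraMap ℂ[ε] (DH ℂ) τ * (P * r * S)
          = (algebraMap ℂ[ε] (DH ℂ) (2 * (P * S).re) * P) * (r * S) := by rw [hτ]; noncomm_ring
        _ = P * (S * (P * r) * S) := by
            rw [← mul_mul_self_of_star_mul_self hP0]; noncomm_ring
        _ = _ := by
            rw [mul_mul_self_of_star_mul_self hS0, ← mul_assoc, ← Algebra.commutes, mul_assoc]
    refine ⟨algebraMap ℂ ℂ[ε] (2 * Complex.I)⁻¹ * (↑τ⁻¹ * (2 * (S * (P * r)).re)), ?_⟩
    have hne : (2 * Complex.I) ≠ 0 := mul_ne_zero two_ne_zero Complex.I_ne_zero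
    change algebraMap ℂ[ε] (DH ℂ) _ * (P * S) = P * r
    rw [map_mul, map_mul, mul_assoc, mul_assoc, ← h2, ← mul_assoc (algebraMap ℂ[ε] (DH ℂ) ↑τ⁻¹),
      ← map_mul, Units.inv_mul, map_one, one_mul, h1, mul_smul_comm,
      ← IsScalarTower.algebraMap_apply ℂ ℂ[ε] (DH ℂ), ← Algebra.smul_def, smul_smul,
      mul_inv_cancel₀ hne, one_smul]
  · rintro ⟨d, rfl⟩
    refine ⟨⟨algebraMap ℂ[ε] (DH ℂ) d * S, ?_⟩, ?_⟩
    · change algebraMap ℂ[ε] (DH ℂ) d * (P * S) = P * _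
      rw [← mul_assoc, Algebra.commutes, mul_assoc]
    · change algebraMap ℂ[ε] (DH ℂ) d * (P * S) * _ = 0
      rw [mul_assoc, mul_assoc, hS, iDH_add_mul_sub hh₄, mul_zero, mul_zero]

lemma Parallel.of_neg {h₁ h₄ : DH ℝ} (hp : Parallel h₁ (-h₄)) : Parallel h₁ h₄ := by
  have : primal (-h₄) = -primal h₄ := by ext <;> rfl
  rw [Parallel, this, neg_neg] at hp
  exact hp.symm

end StandardGenerator

end BondTheory

end

open BondTheory in
theorem mainTheorem5 (h : Fin 6 → DH ℝ) (hL : IsClosedLinkage h) (hmob : mobility h = 1)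
    (h123 : couplingDim [h 0, h 1, h 2] = 8) (h654 : couplingDim [h 5, h 4, h 3] = 8) :
    (¬ Parallel (h 0) (h 3) →
      BondCountLE h 1 4 Complex.I Complex.I
        (EuclideanDomain.gcd (quadPoly (h 0) (h 1) (h 2) (h 3))
          (quadPoly (h 3) (h 4) (h 5) (h 0))).natDegree ∧
      BondCountLE h 1 4 Complex.I (-Complex.I)
        (EuclideanDomain.gcd (quadPoly (h 0) (h 1) (h 2) (-h 3))
          (quadPoly (-h 3) (h 4) (h 5) (h 0))).natDegree) ∧
    (∀ g : DH ℂ, IsGeneratorG g (h 0) (h 3) →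
      BondCountLE h 1 4 Complex.I Complex.I
        (EuclideanDomain.gcd (quadPolyWith g (h 0) (h 1) (h 2) (h 3))
          (quadPolyWith (star g) (h 3) (h 4) (h 5) (h 0))).natDegree) ∧
    (∀ g : DH ℂ, IsGeneratorG g (h 0) (-h 3) →
      BondCountLE h 1 4 Complex.I (-Complex.I)
        (EuclideanDomain.gcd (quadPolyWith g (h 0) (h 1) (h 2) (-h 3))
          (quadPolyWith (star g) (-h 3) (h 4) (h 5) (h 0))).natDegree) := by
  have hpos : ∀ g : DH ℂ, IsGeneratorG g (h 0) (h 3) →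
      BondCountLE h 1 4 Complex.I Complex.I
        (EuclideanDomain.gcd (quadPolyWith g (h 0) (h 1) (h 2) (h 3))
          (quadPolyWith (star g) (h 3) (h 4) (h 5) (h 0))).natDegree := by
    intro g hg
    have h1 := bondCountLE_of_rank_le hL (Or.inl rfl) fun b hf hD =>
      rank_normRing_quotient_le hL hmob h123 h654 (Or.inl rfl) (by rwa [one_smul]) b hf hD
    rwa [one_smul, Complex.ofReal_one, one_mul] at h1
  have hneg : ∀ g : DH ℂ, IsGeneratorG g (h 0) (-h 3) →
      BondCountLE h 1 4 Complex.I (-Complex.I)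
        (EuclideanDomain.gcd (quadPolyWith g (h 0) (h 1) (h 2) (-h 3))
          (quadPolyWith (star g) (-h 3) (h 4) (h 5) (h 0))).natDegree := by
    intro g hg
    have h1 := bondCountLE_of_rank_le hL (Or.inr rfl) fun b hf hD =>
      rank_normRing_quotient_le hL hmob h123 h654 (Or.inr rfl) (by rwa [neg_one_smul]) b hf hD
    rwa [neg_one_smul, Complex.ofReal_neg, Complex.ofReal_one, neg_one_mul] at h1
  refine ⟨fun hp => ⟨?_, ?_⟩, hpos, hneg⟩
  · have h1 := hpos _ (isGeneratorG_stdGenerator (hL.2.1 0) (hL.2.1 3) hp)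
    rwa [star_stdGenerator (hL.2.1 0) (hL.2.1 3)] at h1
  · have hsq : (-h 3) ^ 2 = -1 := by rw [neg_sq, hL.2.1 3]
    have h1 := hneg _ (isGeneratorG_stdGenerator (hL.2.1 0) hsq fun h => hp h.of_neg)
    rwa [star_stdGenerator (hL.2.1 0) hsq] at h1
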